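/- **Theorem.** Let $(M,g)$ be a connected (smooth, finite-dimensional, Hausdorff, second countable, boundaryless) Lorentzian manifold which is homogeneous, i.e. its isometry group $\mathrm{Isom}(M,g)$ acts transitively on $M$. Suppose that the isotropy group $\{f\in \mathrm{Isom}(M,g) : f(p)=p\}$ of a point $p\in M$, with the compact-open topology, is not compact. Then through every point $x\in M$ there passes a lightlike totally geodesic hypersurface, i.e. an embedded smooth submanifold $S\subset M$ of codimension $1$ with $x\in S$ such that 1. ($S$ is totally geodesic) every geodesic $\gamma$ of $M$ defined in a neighborhood of $0$ with $\gamma(0)\in S$ and $\gamma'(0)\in T_{\gamma(0)}S$ satisfies $\gamma(t)\in S$ for all $t$ in a neighborhood of $0$; 2. ($S$ is lightlike) for every $y\in S$ the restriction of $g_y$ to $T_yS$ is degenerate. -/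

import Mathlib

open Set Filter Topology Manifold
open scoped ContDiff

noncomputable section

/-- A smooth Lorentzian metric on a manifold `M` modelled on `E`: a smooth field of symmetric
bilinear forms on the tangent spaces, of signature `(-, +, …, +)`. The signature is expressed by
the existence, at each point, of a vector `v` with `g(v, v) < 0` on whose orthogonal complement
the form is positive definite. -/
structure LorentzianMetric (E : Type*) [NormedAddCommGroup E] [NormedSpace ℝ E]
    (M : Type*) [TopologicalSpace M] [ChartedSpace E M] [IsManifold 𝓘(ℝ, E) ∞ M] where
  /-- The bilinear form on each tangent space. -/
  inner (x : M) : TangentSpace 𝓘(ℝ, E) x →L[ℝ] TangentSpace 𝓘(ℝ, E) x →L[ℝ] ℝ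
  symm (x : M) (v w : TangentSpace 𝓘(ℝ, E) x) : inner x v w = inner x w v
  signature (x : M) : ∃ v : TangentSpace 𝓘(ℝ, E) x, inner x v v < 0 ∧
    ∀ w : TangentSpace 𝓘(ℝ, E) x, inner x v w = 0 → w ≠ 0 → 0 < inner x w w
  contMDiff : ContMDiff 𝓘(ℝ, E) (𝓘(ℝ, E).prod 𝓘(ℝ, E →L[ℝ] E →L[ℝ] ℝ)) ∞
    (fun x ↦ Bundle.TotalSpace.mk' (E →L[ℝ] E →L[ℝ] ℝ)
      (E := fun x : M ↦ TangentSpace 𝓘(ℝ, E) x →L[ℝ] TangentSpace 𝓘(ℝ, E) x →L[ℝ] ℝ)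
      x (inner x))

/-- An embedded smooth hypersurface of `M`: near each of its points, `S` is the preimage of a
linear hyperplane of the model space `E` under a smooth chart of `M`. -/
def IsHypersurface (E : Type*) [NormedAddCommGroup E] [NormedSpace ℝ E]
    {M : Type*} [TopologicalSpace M] [ChartedSpace E M] (S : Set M) : Prop :=
  ∀ x ∈ S, ∃ e ∈ IsManifold.maximalAtlas 𝓘(ℝ, E) ∞ M, x ∈ e.source ∧
    ∃ W : Submodule ℝ E, Module.finrank ℝ W + 1 = Module.finrank ℝ E ∧
      ∀ y ∈ e.source, y ∈ S ↔ e y ∈ W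

/-- The tangent space `T_x S ⊆ T_x M` of a subset `S`: spanned by the velocities at time `0` of the
smooth curves through `x` which stay in `S` (when `S` is an embedded submanifold and `x ∈ S`,
these velocities already form a linear subspace). -/
def tangentSubspace (E : Type*) [NormedAddCommGroup E] [NormedSpace ℝ E]
    {M : Type*} [TopologicalSpace M] [ChartedSpace E M] (S : Set M) (x : M) :
    Submodule ℝ (TangentSpace 𝓘(ℝ, E) x) :=
  Submodule.span ℝ {v | ∃ γ : ℝ → M, ContMDiffAt 𝓘(ℝ, ℝ) 𝓘(ℝ, E) ∞ γ 0 ∧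
    (∀ᶠ t in 𝓝 (0 : ℝ), γ t ∈ S) ∧
    tangentMap 𝓘(ℝ, ℝ) 𝓘(ℝ, E) γ ⟨0, (1 : ℝ)⟩ = ⟨x, v⟩}

namespace LorentzianMetric

variable {E : Type*} [NormedAddCommGroup E] [NormedSpace ℝ E]
  {M : Type*} [TopologicalSpace M] [ChartedSpace E M] [IsManifold 𝓘(ℝ, E) ∞ M]

/-- The isometry group `Isom(M, g)`: the smooth diffeomorphisms of `M` that preserve `g`. -/
def isometryGroup (g : LorentzianMetric E M) : Subgroup (M ≃ₜ M) where
  carrier := {f | ContMDiff 𝓘(ℝ, E) 𝓘(ℝ, E) ∞ f ∧ ContMDiff 𝓘(ℝ, E) 𝓘(ℝ, E) ∞ f.symm ∧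
    ∀ (x : M) (v w : TangentSpace 𝓘(ℝ, E) x),
      g.inner (f x) (mfderiv 𝓘(ℝ, E) 𝓘(ℝ, E) f x v) (mfderiv 𝓘(ℝ, E) 𝓘(ℝ, E) f x w)
        = g.inner x v w}
  one_mem' := by
    refine ⟨contMDiff_id, contMDiff_id, fun x v w ↦ ?_⟩
    change g.inner x (mfderiv 𝓘(ℝ, E) 𝓘(ℝ, E) id x v) (mfderiv 𝓘(ℝ, E) 𝓘(ℝ, E) id x w) = _
    rw [mfderiv_id]
    rfl
  mul_mem' := by
    rintro f h ⟨hf, hf', hfg⟩ ⟨hh, hh', hhg⟩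
    refine ⟨hf.comp hh, hh'.comp hf', fun x v w ↦ ?_⟩
    have hc : mfderiv 𝓘(ℝ, E) 𝓘(ℝ, E) (f ∘ h) x
        = (mfderiv 𝓘(ℝ, E) 𝓘(ℝ, E) f (h x)).comp (mfderiv 𝓘(ℝ, E) 𝓘(ℝ, E) h x) :=
      mfderiv_comp x (hf.mdifferentiable (by simp) (h x)) (hh.mdifferentiable (by simp) x)
    change g.inner (f (h x)) (mfderiv 𝓘(ℝ, E) 𝓘(ℝ, E) (f ∘ h) x v)
      (mfderiv 𝓘(ℝ, E) 𝓘(ℝ, E) (f ∘ h) x w) = _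
    rw [hc]
    exact (hfg (h x) _ _).trans (hhg x v w)
  inv_mem' := by
    rintro f ⟨hf, hf', hfg⟩
    refine ⟨hf', hf, fun x v w ↦ ?_⟩
    have hc : (mfderiv 𝓘(ℝ, E) 𝓘(ℝ, E) f (f.symm x)).comp
        (mfderiv 𝓘(ℝ, E) 𝓘(ℝ, E) f.symm x) = mfderiv 𝓘(ℝ, E) 𝓘(ℝ, E) (f ∘ f.symm) x :=
      (mfderiv_comp x (hf.mdifferentiable (by simp) (f.symm x))
        (hf'.mdifferentiable (by simp) x)).symm
    have hid : (f ∘ f.symm : M → M) = id := by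
      ext y; simp
    rw [hid] at hc
    have hv : ∀ u : TangentSpace 𝓘(ℝ, E) x, mfderiv 𝓘(ℝ, E) 𝓘(ℝ, E) f (f.symm x)
        (mfderiv 𝓘(ℝ, E) 𝓘(ℝ, E) f.symm x u) = u := fun u ↦ by
      have h1 := congrArg (fun L : E →L[ℝ] E ↦ L u) hc
      refine h1.trans ?_
      change mfderiv 𝓘(ℝ, E) 𝓘(ℝ, E) (id : M → M) x u = u
      rw [mfderiv_id]
      rfl
    have hz : ∀ z : M, z = x → ∀ a b : E, g.inner z a b = g.inner x a b := by
      rintro _ rfl a b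
      rfl
    have key := hfg (f.symm x) (mfderiv 𝓘(ℝ, E) 𝓘(ℝ, E) f.symm x v)
      (mfderiv 𝓘(ℝ, E) 𝓘(ℝ, E) f.symm x w)
    rw [hv v, hv w] at key
    exact key.symm.trans (hz _ (f.apply_symm_apply x) v w)

/-- The isometry group carries the compact-open topology, that is, the topology of uniform
convergence on compact sets. -/
instance (g : LorentzianMetric E M) : TopologicalSpace g.isometryGroup :=
  TopologicalSpace.induced (fun f ↦ ((f : M ≃ₜ M) : C(M, M))) inferInstance

/-- `(M, g)` is homogeneous: its isometry group acts transitively. -/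
def IsHomogeneous (g : LorentzianMetric E M) : Prop :=
  ∀ x y : M, ∃ f : g.isometryGroup, (f : M ≃ₜ M) x = y

/-- The isotropy group of `p`: the isometries that fix `p`. -/
def isotropyGroup (g : LorentzianMetric E M) (p : M) : Subgroup g.isometryGroup where
  carrier := {f | (f : M ≃ₜ M) p = p}
  one_mem' := rfl
  mul_mem' := by
    intro f h hf hh
    change (f : M ≃ₜ M) ((h : M ≃ₜ M) p) = p
    rw [show (h : M ≃ₜ M) p = p from hh]
    exact hf
  inv_mem' := by
    intro f hf
    change (f : M ≃ₜ M).symm p = p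
    rw [Homeomorph.symm_apply_eq]
    exact hf.symm

/-- The coefficients `g(∂_a, ∂_b)` of the metric in the chart `e`, at the point of coordinates `y`,
where `∂_a` is the constant coordinate field of direction `a ∈ E`. -/
def coeff (g : LorentzianMetric E M) (e : OpenPartialHomeomorph M E) (y a b : E) : ℝ :=
  g.inner (e.symm y) (mfderiv 𝓘(ℝ, E) 𝓘(ℝ, E) e.symm y a) (mfderiv 𝓘(ℝ, E) 𝓘(ℝ, E) e.symm y b)

/-- The Christoffel symbols of the first kind `Γ(a, b; c) = g(∇_{∂_a} ∂_b, ∂_c)` of the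
Levi-Civita connection of `g` in the chart `e`, at the point of coordinates `y`. -/
def christoffel (g : LorentzianMetric E M) (e : OpenPartialHomeomorph M E) (y a b c : E) : ℝ :=
  (fderiv ℝ (fun z ↦ g.coeff e z b c) y a + fderiv ℝ (fun z ↦ g.coeff e z a c) y b
    - fderiv ℝ (fun z ↦ g.coeff e z a b) y c) / 2

/-- `γ` is a geodesic of `g` on the open set `s` of times: it is smooth and `∇_{γ'} γ' = 0`. In each
chart, with `u` the coordinate expression of `γ`, the equation reads
`g(u'', c) + Γ(u', u'; c) = 0` for every `c`. -/
def IsGeodesicOn (g : LorentzianMetric E M) (γ : ℝ → M) (s : Set ℝ) : Prop :=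
  ContMDiffOn 𝓘(ℝ, ℝ) 𝓘(ℝ, E) ∞ γ s ∧
    ∀ e ∈ IsManifold.maximalAtlas 𝓘(ℝ, E) ∞ M, ∀ t ∈ s, γ t ∈ e.source → ∀ c : E,
      g.coeff e (e (γ t)) (deriv (deriv (e ∘ γ)) t) c
        + g.christoffel e (e (γ t)) (deriv (e ∘ γ) t) (deriv (e ∘ γ) t) c = 0

/-- `S` is totally geodesic: each geodesic of `M`, defined in a neighborhood of `0`, which is
tangent to `S` at time `0` stays in `S` for small times. -/
def IsTotallyGeodesic (g : LorentzianMetric E M) (S : Set M) : Prop :=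
  ∀ (γ : ℝ → M) (ε : ℝ), 0 < ε → g.IsGeodesicOn γ (Ioo (-ε) ε) → γ 0 ∈ S →
    mfderiv 𝓘(ℝ, ℝ) 𝓘(ℝ, E) γ 0 (1 : ℝ) ∈ tangentSubspace E S (γ 0) →
    ∀ᶠ t in 𝓝 (0 : ℝ), γ t ∈ S

/-- `S` is lightlike: the metric restricted to each tangent space `T_x S` is degenerate. -/
def IsLightlike (g : LorentzianMetric E M) (S : Set M) : Prop :=
  ∀ x ∈ S, ∃ v ∈ tangentSubspace E S x, v ≠ 0 ∧
    ∀ w ∈ tangentSubspace E S x, g.inner x v w = 0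

end LorentzianMetric

end

/-! In normal coordinates at `x` the isotropy group acts by linear maps, its derivatives `A` at `x`,
and these preserve the Lorentzian form `B = g_x`. If the derivatives were bounded, the isotropy
group would be compact. Indeed an isometry is `exp ∘ df ∘ log` near each point, so it is governed by
its first jet at one point, and convergence of first jets propagates over the connected manifold
(`tendsto_tangentMap_id`). Limits of isometries are again smooth isometries by the same formula
(`contMDiff_of_tendsto_tangentMap`). Homogeneity conjugates the isotropy groups, so at every `x`
there are isotropies whose derivatives satisfy `‖A n‖ → ∞`. Limits are taken along an ultrafilter,
which replaces passing to subsequences.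

The rest is Lorentzian linear algebra. The limit `T` of `A n / ‖A n‖` is nonzero with `B`-isotropic
image. In Lorentzian signature this image is a null line, so `F = ker T` is a hyperplane. A vector
`v` lies in `F` exactly when some `u n → v` has convergent images `A n (u n)`, and the limit can be
chosen of norm at most `C * ‖v‖` (`exists_hyperplane_of_divergent`). The smallest stretching factor
of a `B`-isometry is comparable to `1 / ‖A‖`, so some `y ≠ 0` in `F` has `u n → y` with `A n (u n) →
0` (`exists_contracted_direction`).

The hypersurface is the image under `exp` of a small ball of `F`
(`exists_hypersurface_of_linear_isometries`). For a geodesic tangent to it, the initial position and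
velocity lie in `F`, hence are limits of data whose images under `A n` converge. Isometries map
geodesics to geodesics and geodesics depend continuously on their data, so the later points have the
same property and lie in `F`. For lightlikeness, `g (y, w)` with `w` tangent is a limit of values of
`g` on vectors near `y` and `w`. By invariance these equal values on their images under `A n`, where
the first argument tends to `0` and the second stays bounded, so the limit is `0`. -/

noncomputable section

universe u

set_option maxSynthPendingDepth 3
set_option linter.unusedSectionVars false

/-! ### Smooth inverse functions -/

/-- The **smooth inverse function theorem**, as an open partial homeomorphism whose inverse is
smooth on its whole domain. -/
theorem exists_smooth_local_inverse {X Y : Type*} [NormedAddCommGroup X] [NormedSpace ℝ X]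
    [CompleteSpace X] [NormedAddCommGroup Y] [NormedSpace ℝ Y] {f : X → Y} {O : Set X} {a : X}
    (hO : IsOpen O) (hf : ContDiffOn ℝ ∞ f O) (ha : a ∈ O) (f' : X ≃L[ℝ] Y)
    (hf' : HasFDerivAt f (f' : X →L[ℝ] Y) a) :
    ∃ h : OpenPartialHomeomorph X Y, a ∈ h.source ∧ h.source ⊆ O ∧ (∀ x, h x = f x) ∧
      ContDiffOn ℝ ∞ h.symm h.target := by
  have hn : (∞ : WithTop ℕ∞) ≠ 0 := by simp
  have hfa : ContDiffAt ℝ ∞ f a := hf.contDiffAt (hO.mem_nhds ha)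
  let h0 := hfa.toOpenPartialHomeomorph f hf' hn
  have hcont : ContinuousOn (fderiv ℝ f) O := hf.continuousOn_fderiv_of_isOpen hO (by simp)
  -- Invertible operators form an open set. Restricting to points with invertible derivative makes
  -- the inverse smooth on its whole domain, not only at the image of `a`.
  let O' := O ∩ fderiv ℝ f ⁻¹' (range ((↑) : (X ≃L[ℝ] Y) → X →L[ℝ] Y))
  have hO' : IsOpen O' := hcont.isOpen_inter_preimage hO ContinuousLinearEquiv.isOpen
  refine ⟨h0.restrOpen O' hO', ?_, ?_, ?_, ?_⟩
  · rw [OpenPartialHomeomorph.restrOpen_source]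
    exact ⟨hfa.mem_toOpenPartialHomeomorph_source hf' hn, ha, f', hf'.fderiv.symm⟩
  · rw [OpenPartialHomeomorph.restrOpen_source]
    exact fun x hx ↦ hx.2.1
  · intro x
    rfl
  · intro y hy
    refine ContDiffAt.contDiffWithinAt ?_
    have hs := (h0.restrOpen O' hO').map_target hy
    rw [OpenPartialHomeomorph.restrOpen_source] at hs
    obtain ⟨-, hxO, g', hg'⟩ := hs
    have hd : DifferentiableAt ℝ f ((h0.restrOpen O' hO').symm y) :=
      (hf.contDiffAt (hO.mem_nhds hxO)).differentiableAt hn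
    refine (h0.restrOpen O' hO').contDiffAt_symm (f₀' := g') hy ?_ ?_
    · rw [hg']
      exact hd.hasFDerivAt
    · exact hf.contDiffAt (hO.mem_nhds hxO)

/-! ### Superposition operators on spaces of continuous curves -/

section Nemytskii

variable {I : Type*} [TopologicalSpace I] [CompactSpace I]
  {F : Type*} [NormedAddCommGroup F] [NormedSpace ℝ F]
  {H : Type*} [NormedAddCommGroup H] [NormedSpace ℝ H]

/-- Pointwise application of a continuous family of operators to a continuous curve. -/
def pointwiseApply (I F H : Type*) [TopologicalSpace I] [CompactSpace I]
    [NormedAddCommGroup F] [NormedSpace ℝ F] [NormedAddCommGroup H] [NormedSpace ℝ H] :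
    C(I, F →L[ℝ] H) →L[ℝ] C(I, F) →L[ℝ] C(I, H) :=
  LinearMap.mkContinuous₂
    (LinearMap.mk₂ ℝ (fun (A : C(I, F →L[ℝ] H)) (δ : C(I, F)) ↦
      (⟨fun t ↦ A t (δ t), by fun_prop⟩ : C(I, H)))
      (by intros; ext; simp) (by intros; ext; simp) (by intros; ext; simp)
      (by intros; ext; simp)) 1
    (by
      intro A δ
      rw [ContinuousMap.norm_le _ (by positivity)]
      intro t
      simp only [LinearMap.mk₂_apply, ContinuousMap.coe_mk, one_mul]
      exact (ContinuousLinearMap.le_opNorm _ _).trans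
        (mul_le_mul (A.norm_coe_le_norm t) (δ.norm_coe_le_norm t) (norm_nonneg _)
        (norm_nonneg (E := C(I, F →L[ℝ] H)) A)))

@[simp] theorem pointwiseApply_apply (A : C(I, F →L[ℝ] H)) (δ : C(I, F)) (t : I) :
    pointwiseApply I F H A δ t = A t (δ t) := rfl

/-- The superposition operator `α ↦ V ∘ α` is differentiable. -/
theorem hasFDerivAt_superposition (V : F → H) (hV : ContDiff ℝ 1 V) (α : C(I, F)) :
    HasFDerivAt (fun β : C(I, F) ↦ (⟨V, hV.continuous⟩ : C(F, H)).comp β)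
      (pointwiseApply I F H
        ((⟨fderiv ℝ V, hV.continuous_fderiv one_ne_zero⟩ : C(F, F →L[ℝ] H)).comp α)) α := by
  have hc := ContinuousMap.continuous_postcomp (X := I)
    (⟨fderiv ℝ V, hV.continuous_fderiv one_ne_zero⟩ : C(F, F →L[ℝ] H))
  rw [hasFDerivAt_iff_isLittleO, Asymptotics.isLittleO_iff]
  intro c hcpos
  obtain ⟨δ, hδ, hball⟩ := Metric.tendsto_nhds_nhds (α := C(I, F))
    (β := C(I, F →L[ℝ] H)) |>.1 (hc.tendsto α) c hcpos
  filter_upwards [Metric.ball_mem_nhds α hδ] with β hβ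
  rw [ContinuousMap.norm_le _ (by positivity)]
  intro t
  have hder : ∀ z ∈ Metric.ball (α t) δ, ‖fderiv ℝ V z - fderiv ℝ V (α t)‖ ≤ c := by
    intro z hz
    -- A bound on `fderiv ℝ V` uniform in `t` is needed. It comes from continuity at `α` of the
    -- superposition operator of `fderiv ℝ V`, tested on the translate of `α` by the constant `z - α
    -- t`.
    have h1 : dist (α + ContinuousMap.const I (z - α t)) α < δ := by
      rw [dist_eq_norm, add_sub_cancel_left, ContinuousMap.norm_lt_iff _ hδ]
      intro s
      rw [ContinuousMap.const_apply, ← dist_eq_norm]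
      exact hz
    have h2 := (ContinuousMap.dist_lt_iff hcpos).1 (hball h1) t
    rw [dist_eq_norm] at h2
    have h3 : α t + (z - α t) = z := by abel
    simpa [h3] using h2.le
  have h4 := (convex_ball (α t) δ).norm_image_sub_le_of_norm_hasFDerivWithin_le'
    (f := V) (f' := fderiv ℝ V) (φ := fderiv ℝ V (α t)) (C := c)
    (fun z _ ↦ ((hV.differentiable one_ne_zero) z).hasFDerivAt.hasFDerivWithinAt) hder
    (Metric.mem_ball_self hδ) (y := β t) (by
      rw [Metric.mem_ball]; exact (ContinuousMap.dist_apply_le_dist t).trans_lt hβ)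
  refine h4.trans ?_
  gcongr
  exact (β - α).norm_coe_le_norm t

end Nemytskii

/-- The superposition operator `α ↦ V ∘ α` of a smooth map is smooth. -/
theorem contDiff_superposition {I : Type*} [TopologicalSpace I] [CompactSpace I]
    {F H : Type u} [NormedAddCommGroup F] [NormedSpace ℝ F]
    [NormedAddCommGroup H] [NormedSpace ℝ H] (V : F → H) (hV : ContDiff ℝ ∞ V) :
    ContDiff ℝ ∞ (fun β : C(I, F) ↦ (⟨V, hV.continuous⟩ : C(F, H)).comp β) := by
  rw [contDiff_infty]
  intro n
  -- The derivative is a fixed bounded operator applied to the superposition operator of `fderiv ℝ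
  -- V`. Its target is `F →L[ℝ] H` instead of `H`, so `H` must vary, within the common universe of
  -- `F` and `H`.
  induction n generalizing H with
  | zero =>
    rw [Nat.cast_zero, contDiff_zero]
    exact ContinuousMap.continuous_postcomp _
  | succ n ih =>
    have hV1 : ContDiff ℝ 1 V := hV.of_le (by simp)
    have hV' : ContDiff ℝ ∞ (fderiv ℝ V) := hV.fderiv_right (by simp)
    rw [Nat.cast_add, Nat.cast_one, contDiff_succ_iff_hasFDerivAt]
    refine ⟨fun α ↦ pointwiseApply I F H ((⟨fderiv ℝ V, hV'.continuous⟩ : C(F, F →L[ℝ] H)).comp α),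
      ?_, fun α ↦ hasFDerivAt_superposition V hV1 α⟩
    have h2 : ContDiff ℝ n (pointwiseApply I F H) := ContinuousLinearMap.contDiff _
    exact h2.comp (ih (fderiv ℝ V) hV')

/-! ### Flows near a zero with nilpotent derivative -/

/-- The primitive, vanishing at time `0`, of a curve on `[-2, 2]`. -/
def volterra (F : Type*) [NormedAddCommGroup F] [NormedSpace ℝ F] [CompleteSpace F] :
    C(Icc (-2 : ℝ) 2, F) →L[ℝ] C(Icc (-2 : ℝ) 2, F) :=
  LinearMap.mkContinuous
    { toFun := fun (α : C(Icc (-2 : ℝ) 2, F)) ↦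
        ⟨fun t ↦ ∫ s in (0 : ℝ)..t, IccExtend (by norm_num : (-2 : ℝ) ≤ 2) α s,
        (intervalIntegral.continuous_primitive
          (fun a b ↦ (α.continuous.Icc_extend' (h := by norm_num)).intervalIntegrable a b) 0).comp
          continuous_subtype_val⟩
      map_add' := by
        intro α β
        ext t
        exact intervalIntegral.integral_add (α.continuous.Icc_extend'.intervalIntegrable _ _)
          (β.continuous.Icc_extend'.intervalIntegrable _ _)
      map_smul' := by
        intro c α
        ext t
        exact intervalIntegral.integral_smul c _ } 2
    (by
      intro α
      rw [ContinuousMap.norm_le _ (by positivity)]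
      intro t
      have h := intervalIntegral.norm_integral_le_of_norm_le_const (a := (0 : ℝ)) (b := t)
        (f := IccExtend (by norm_num : (-2 : ℝ) ≤ 2) α) (C := ‖α‖)
        (fun s _ ↦ α.norm_coe_le_norm _)
      refine h.trans ?_
      rw [mul_comm, sub_zero]
      gcongr
      exact abs_le.2 t.2)

/-- An autonomous smooth vector field has a flow, defined for times in `(-2, 2)` and depending
smoothly on the initial point, near a zero at which its derivative squares to zero. -/
theorem exists_smooth_flow_near_zero {F : Type u} [NormedAddCommGroup F] [NormedSpace ℝ F]
    [CompleteSpace F] (V : F → F) (hV : ContDiff ℝ ∞ V) (a₀ : F) (h0 : V a₀ = 0)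
    (hsq : ∀ b, fderiv ℝ V a₀ (fderiv ℝ V a₀ b) = 0) {O : Set F} (hO : IsOpen O) (ha₀ : a₀ ∈ O) :
    ∃ (Φ : F → ℝ → F) (Ω : Set F), IsOpen Ω ∧ a₀ ∈ Ω ∧
      (∀ a ∈ Ω, Φ a 0 = a) ∧ (∀ a ∈ Ω, ∀ t ∈ Ioo (-2 : ℝ) 2, Φ a t ∈ O) ∧
      (∀ a ∈ Ω, ∀ t ∈ Ioo (-2 : ℝ) 2, HasDerivAt (Φ a) (V (Φ a t)) t) ∧
      ContDiffOn ℝ ∞ (fun a ↦ Φ a 1) Ω ∧ Φ a₀ 1 = a₀ ∧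
      HasFDerivAt (fun a ↦ Φ a 1) (ContinuousLinearMap.id ℝ F + fderiv ℝ V a₀) a₀ := by
  have h22 : (-2 : ℝ) ≤ 2 := by norm_num
  set I := Icc (-2 : ℝ) 2
  let C : F →L[ℝ] C(I, F) := ContinuousLinearMap.const ℝ I
  let N : C(I, F) → C(I, F) := fun β ↦ (⟨V, hV.continuous⟩ : C(F, F)).comp β
  have hN : ContDiff ℝ ∞ N := contDiff_superposition V hV
  -- The equation `Ψ β = C a` is the integral form of `β' = V ∘ β` with `β 0 = a`. Inverting `Ψ`
  -- near the constant curve `a₀` produces all nearby solutions at once, smoothly in `a`. The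
  -- interval `[-2, 2]` has time `1` in its interior.
  let Ψ : C(I, F) → C(I, F) := fun β ↦ β - volterra F (N β)
  have hΨ : ContDiff ℝ ∞ Ψ := contDiff_id.sub ((volterra F).contDiff.comp hN)
  let P : C(I, F) →L[ℝ] C(I, F) := (fderiv ℝ V a₀).compLeftContinuous ℝ I
  let K : C(I, F) →L[ℝ] C(I, F) := volterra F ∘L P
  have hPP : ∀ α, P (P α) = 0 := fun α ↦ by ext t; exact hsq (α t)
  have hPv : ∀ α, P (volterra F α) = volterra F (P α) := by
    intro α
    ext t
    change fderiv ℝ V a₀ (∫ s in (0 : ℝ)..t, IccExtend h22 α s) = _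
    rw [← ContinuousLinearMap.intervalIntegral_comp_comm]
    · rfl
    · exact α.continuous.Icc_extend'.intervalIntegrable _ _
  have hKK : ∀ α, K (K α) = 0 := fun α ↦ by
    change volterra F (P (volterra F (P α))) = 0
    rw [hPv, hPP, map_zero, map_zero]
  -- Since `K` squares to zero, the Neumann series of `(1 - K)⁻¹` stops at `1 + K`. No shortening of
  -- the time interval is needed.
  let T : C(I, F) ≃L[ℝ] C(I, F) := ContinuousLinearEquiv.equivOfInverse
    (ContinuousLinearMap.id ℝ _ - K) (ContinuousLinearMap.id ℝ _ + K)
    (fun α ↦ by simp [hKK]) (fun α ↦ by simp [hKK])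
  have hΨd : HasFDerivAt Ψ (T : C(I, F) →L[ℝ] C(I, F)) (C a₀) := by
    have h1 := hasFDerivAt_superposition V (hV.of_le (by simp)) (C a₀)
    exact (hasFDerivAt_id _).sub ((volterra F).hasFDerivAt.comp _ h1)
  let S : Set C(I, F) := {β | ∀ t, β t ∈ O}
  have hS : IsOpen S := by
    have := ContinuousMap.isOpen_setOfPred_mapsTo (X := I) isCompact_univ hO
    simpa [S, MapsTo] using this
  have hΨ0 : Ψ (C a₀) = C a₀ := by
    have : N (C a₀) = 0 := by ext t; exact h0
    simp [Ψ, this]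
  obtain ⟨h, ha, hsub, hcoe, hsm⟩ := exists_smooth_local_inverse hS hΨ.contDiffOn
    (show C a₀ ∈ S from fun t ↦ ha₀) T hΨd
  have hCt : C a₀ ∈ h.target := by
    have := h.map_source ha
    rwa [hcoe, hΨ0] at this
  have hsymm0 : h.symm (C a₀) = C a₀ := by
    have := h.left_inv ha
    rwa [hcoe, hΨ0] at this
  have hinteq : ∀ a ∈ C ⁻¹' h.target, ∀ t : I, h.symm (C a) t
      = a + ∫ s in (0 : ℝ)..t, V (IccExtend h22 (h.symm (C a)) s) := by
    intro a haΩ t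
    have h1 : Ψ (h.symm (C a)) = C a := by rw [← hcoe]; exact h.right_inv haΩ
    have h2 := congrArg (fun β : C(I, F) ↦ β t) h1
    exact sub_eq_iff_eq_add.1 h2
  have heval : ∀ a ∈ C ⁻¹' h.target, ∀ t ∈ Icc (-2 : ℝ) 2, IccExtend h22 (h.symm (C a)) t
      = a + ∫ s in (0 : ℝ)..t, V (IccExtend h22 (h.symm (C a)) s) := by
    intro a haΩ t ht
    rw [IccExtend_of_mem h22 _ ht]
    exact hinteq a haΩ ⟨t, ht⟩
  let ev : C(I, F) →L[ℝ] F := ContinuousMap.evalCLM ℝ (⟨1, by norm_num, by norm_num⟩ : I)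
  have hΦ1 : ∀ a, IccExtend h22 (h.symm (C a)) 1 = ev (h.symm (C a)) := fun a ↦
    IccExtend_of_mem h22 _ (⟨by norm_num, by norm_num⟩ : (1 : ℝ) ∈ Icc (-2 : ℝ) 2)
  refine ⟨fun a ↦ IccExtend h22 (h.symm (C a)), C ⁻¹' h.target,
    h.open_target.preimage C.continuous, hCt, ?_, ?_, ?_, ?_, ?_, ?_⟩
  · intro a haΩ
    simpa using heval a haΩ 0 (by norm_num)
  · intro a haΩ t _
    exact hsub (h.map_target haΩ) _
  · intro a haΩ t ht
    have hcont : Continuous fun s ↦ V (IccExtend h22 (h.symm (C a)) s) :=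
      hV.continuous.comp (h.symm (C a)).continuous.Icc_extend'
    have h1 := (intervalIntegral.integral_hasDerivAt_right (hcont.intervalIntegrable 0 t)
      (hcont.stronglyMeasurableAtFilter _ _) hcont.continuousAt).const_add a
    refine h1.congr_of_eventuallyEq ?_
    filter_upwards [Icc_mem_nhds ht.1 ht.2] with s hs
    exact heval a haΩ s hs
  · simp only [hΦ1]
    exact ev.contDiff.comp_contDiffOn (hsm.comp C.contDiff.contDiffOn fun a ha ↦ ha)
  · refine (hΦ1 a₀).trans ?_
    rw [hsymm0]
    rfl
  · simp only [hΦ1]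
    have h1 : HasFDerivAt h.symm (T.symm : C(I, F) →L[ℝ] C(I, F)) (C a₀) := by
      refine h.hasFDerivAt_symm hCt ?_
      rw [hsymm0]
      exact hΨd.congr_of_eventuallyEq (Eventually.of_forall hcoe)
    have h2 := ev.hasFDerivAt.comp a₀ (h1.comp a₀ C.hasFDerivAt)
    refine h2.congr_fderiv ?_
    ext b
    change b + (∫ s in (0 : ℝ)..1, IccExtend h22 (P (C b)) s) = b + fderiv ℝ V a₀ b
    have h3 : IccExtend h22 (P (C b)) = fun _ ↦ fderiv ℝ V a₀ b := rfl
    rw [h3]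
    simp

/-- A version of `exists_smooth_flow_near_zero` for a vector field on an open set. -/
theorem exists_smooth_flow_near_zero_of_contDiffOn {F : Type u} [NormedAddCommGroup F]
    [NormedSpace ℝ F] [FiniteDimensional ℝ F] (V : F → F) {O : Set F} (hO : IsOpen O)
    (hV : ContDiffOn ℝ ∞ V O) (a₀ : F) (ha₀ : a₀ ∈ O) (h0 : V a₀ = 0)
    (hsq : ∀ b, fderiv ℝ V a₀ (fderiv ℝ V a₀ b) = 0) :
    ∃ (Φ : F → ℝ → F) (Ω : Set F), IsOpen Ω ∧ a₀ ∈ Ω ∧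
      (∀ a ∈ Ω, Φ a 0 = a) ∧ (∀ a ∈ Ω, ∀ t ∈ Ioo (-2 : ℝ) 2, Φ a t ∈ O) ∧
      (∀ a ∈ Ω, ∀ t ∈ Ioo (-2 : ℝ) 2, HasDerivAt (Φ a) (V (Φ a t)) t) ∧
      ContDiffOn ℝ ∞ (fun a ↦ Φ a 1) Ω ∧ Φ a₀ 1 = a₀ ∧
      HasFDerivAt (fun a ↦ Φ a 1) (ContinuousLinearMap.id ℝ F + fderiv ℝ V a₀) a₀ := by
  have := FiniteDimensional.complete ℝ F
  obtain ⟨χ, hχO, hcomp, hχ, -, hχ1⟩ : ∃ χ : F → ℝ, tsupport χ ⊆ O ∧ HasCompactSupport χ ∧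
      ContDiff ℝ ∞ χ ∧ range χ ⊆ Icc 0 1 ∧ χ =ᶠ[𝓝 a₀] 1 := by
    obtain ⟨r, hr, hrO⟩ := Metric.nhds_basis_closedBall.mem_iff.1 (hO.mem_nhds ha₀)
    let b : ContDiffBump a₀ := ⟨r / 2, r, by positivity, by linarith⟩
    refine ⟨b, ?_, b.hasCompactSupport, b.contDiff, ?_, b.eventuallyEq_one⟩
    · rw [b.tsupport_eq]
      exact hrO
    · rintro _ ⟨x, rfl⟩
      exact ⟨b.nonneg, b.le_one⟩
  let V' : F → F := fun x ↦ χ x • V x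
  have hV' : ContDiff ℝ ∞ V' := by
    rw [contDiff_iff_contDiffAt]
    intro x
    by_cases hx : x ∈ O
    · exact hχ.contDiffAt.smul (hV.contDiffAt (hO.mem_nhds hx))
    · have h1 : V' =ᶠ[𝓝 x] fun _ ↦ 0 := by
        have h2 : x ∉ tsupport χ := fun h ↦ hx (hχO h)
        filter_upwards [(isClosed_tsupport χ).isOpen_compl.mem_nhds h2] with y hy
        simp [V', image_eq_zero_of_notMem_tsupport hy]
      exact contDiffAt_const.congr_of_eventuallyEq h1
  have heq : V' =ᶠ[𝓝 a₀] V := by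
    filter_upwards [hχ1] with x hx
    simp [V', hx]
  -- The flow curves can be confined to any neighborhood of `a₀`. It is chosen where the cutoff does
  -- not change `V`, so they are integral curves of `V` itself.
  obtain ⟨O', hO'sub, hO', ha₀'⟩ := mem_nhds_iff.1 (inter_mem (hO.mem_nhds ha₀) heq)
  have hd : fderiv ℝ V' a₀ = fderiv ℝ V a₀ := heq.fderiv_eq
  obtain ⟨Φ, Ω, h1, h2, h3, h4, h5, h6, h7, h8⟩ := exists_smooth_flow_near_zero V' hV' a₀
    (by rw [heq.eq_of_nhds, h0]) (by rw [hd]; exact hsq) hO' ha₀'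
  refine ⟨Φ, Ω, h1, h2, h3, fun a ha t ht ↦ (hO'sub (h4 a ha t ht)).1, fun a ha t ht ↦ ?_,
    h6, h7, hd ▸ h8⟩
  have h9 : V' (Φ a t) = V (Φ a t) := (hO'sub (h4 a ha t ht)).2
  exact h9 ▸ h5 a ha t ht

theorem two_le_infty : (2 : WithTop ℕ∞) ≤ ∞ :=
  WithTop.coe_le_coe.2 (le_top : (2 : ℕ∞) ≤ ⊤)

/-! ### Metrics, geodesic sprays and isometries in coordinates -/

section CoordinateMetric

variable {E : Type u} [NormedAddCommGroup E] [NormedSpace ℝ E]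

/-- A smooth field of nondegenerate symmetric bilinear forms on an open subset of a vector
space. -/
structure IsMetricOn (G : E → E →L[ℝ] E →L[ℝ] ℝ) (U : Set E) : Prop where
  isOpen : IsOpen U
  contDiffOn : ContDiffOn ℝ ∞ G U
  symm : ∀ x ∈ U, ∀ v w, G x v w = G x w v
  nondegenerate : ∀ x ∈ U, ∀ v, (∀ w, G x v w = 0) → v = 0

/-- The covector `c ↦ Γ(a, a; c)` given by the Christoffel symbols of the first kind of `G`. -/
def geodesicForm (G : E → E →L[ℝ] E →L[ℝ] ℝ) (x a : E) : E →L[ℝ] ℝ :=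
  fderiv ℝ G x a a - (1 / 2 : ℝ) • ((fderiv ℝ G x).flip a).flip a

theorem geodesicForm_apply (G : E → E →L[ℝ] E →L[ℝ] ℝ) (x a c : E) :
    geodesicForm G x a c = fderiv ℝ G x a a c - 1 / 2 * fderiv ℝ G x c a a := by
  simp [geodesicForm]

theorem geodesicForm_smul (G : E → E →L[ℝ] E →L[ℝ] ℝ) (x a : E) (s : ℝ) :
    geodesicForm G x (s • a) = (s * s) • geodesicForm G x a := by
  ext c
  simp only [geodesicForm_apply, map_smul, smul_apply, smul_eq_mul]
  ring

/-- The geodesic vector field of `G` on `U × E`. -/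
def spray (G : E → E →L[ℝ] E →L[ℝ] ℝ) (q : E × E) : E × E :=
  (q.2, -(G q.1).inverse (geodesicForm G q.1 q.2))

/-- The tangent map of `F` in coordinates. -/
def coordTangentMap (F : E → E) (q : E × E) : E × E := (F q.1, fderiv ℝ F q.1 q.2)

/-- `F` is a smooth isometry of the open set `O` onto its image, from `G` to `G'`. -/
structure IsIsometryOn (G G' : E → E →L[ℝ] E →L[ℝ] ℝ) (F : E → E) (O U' : Set E) : Prop where
  isOpen : IsOpen O
  contDiffOn : ContDiffOn ℝ ∞ F O
  mapsTo : MapsTo F O U'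
  preserve : ∀ x ∈ O, ∀ v w, G' (F x) (fderiv ℝ F x v) (fderiv ℝ F x w) = G x v w

variable [FiniteDimensional ℝ E]
  {G G' : E → E →L[ℝ] E →L[ℝ] ℝ} {U U' O : Set E} {F : E → E}

theorem IsMetricOn.exists_equiv (h : IsMetricOn G U) {x : E} (hx : x ∈ U) :
    ∃ e : E ≃L[ℝ] (E →L[ℝ] ℝ), (e : E →L[ℝ] E →L[ℝ] ℝ) = G x := by
  have hinj : Function.Injective (G x) := by
    rw [injective_iff_map_eq_zero]
    intro v hv
    exact h.nondegenerate x hx v fun w ↦ by rw [hv]; rfl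
  have hdim : Module.finrank ℝ E = Module.finrank ℝ (E →L[ℝ] ℝ) := by
    rw [← (LinearMap.toContinuousLinearMap (𝕜 := ℝ) (E := E) (F' := ℝ)).finrank_eq]
    exact (Subspace.dual_finrank_eq (K := ℝ) (V := E)).symm
  refine ⟨(LinearMap.linearEquivOfInjective (G x : E →ₗ[ℝ] E →L[ℝ] ℝ) hinj
    hdim).toContinuousLinearEquiv, ?_⟩
  ext v w
  rfl

theorem IsMetricOn.apply_inverse (h : IsMetricOn G U) {x : E} (hx : x ∈ U) (φ : E →L[ℝ] ℝ) :
    G x ((G x).inverse φ) = φ := by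
  obtain ⟨e, he⟩ := h.exists_equiv hx
  rw [← he, ContinuousLinearMap.inverse_equiv]
  exact e.apply_symm_apply φ

theorem IsMetricOn.spray_contDiffOn (h : IsMetricOn G U) :
    ContDiffOn ℝ ∞ (spray G) (U ×ˢ univ) := by
  have hfst : ContDiffOn ℝ ∞ (Prod.fst : E × E → E) (U ×ˢ univ) := contDiffOn_fst
  have hsnd : ContDiffOn ℝ ∞ (Prod.snd : E × E → E) (U ×ˢ univ) := contDiffOn_snd
  have hmaps : MapsTo (Prod.fst : E × E → E) (U ×ˢ univ) U := fun q hq ↦ hq.1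
  have hD : ContDiffOn ℝ ∞ (fderiv ℝ G) U := h.contDiffOn.fderiv_of_isOpen h.isOpen (by simp)
  have hD' := hD.comp hfst hmaps
  have hinv : ContDiffOn ℝ ∞ (fun x ↦ (G x).inverse) U := by
    intro x hx
    obtain ⟨e, he⟩ := h.exists_equiv hx
    have := contDiffAt_map_inverse (n := ∞) e
    rw [he] at this
    exact this.comp_contDiffWithinAt x (h.contDiffOn x hx)
  have hflip1 : ContDiffOn ℝ ∞ (fun q : E × E ↦ (fderiv ℝ G q.1).flip) (U ×ˢ univ) :=
    (ContinuousLinearMap.flipₗᵢ ℝ E E (E →L[ℝ] ℝ)).contDiff.comp_contDiffOn hD'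
  have hflip2 : ContDiffOn ℝ ∞ (fun q : E × E ↦ ((fderiv ℝ G q.1).flip q.2).flip) (U ×ˢ univ) :=
    (ContinuousLinearMap.flipₗᵢ ℝ E E ℝ).contDiff.comp_contDiffOn (hflip1.clm_apply hsnd)
  have hform : ContDiffOn ℝ ∞ (fun q : E × E ↦ geodesicForm G q.1 q.2) (U ×ˢ univ) :=
    ((hD'.clm_apply hsnd).clm_apply hsnd).sub ((hflip2.clm_apply hsnd).const_smul _)
  exact hsnd.prodMk ((hinv.comp hfst hmaps).clm_apply hform).neg

omit [FiniteDimensional ℝ E] in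
theorem IsMetricOn.isOpen_prod (h : IsMetricOn G U) : IsOpen (U ×ˢ (univ : Set E)) :=
  h.isOpen.prod isOpen_univ

omit [FiniteDimensional ℝ E] in
theorem IsMetricOn.spray_zero (x : E) : spray G (x, 0) = 0 := by
  have : geodesicForm G x 0 = 0 := by
    simpa using geodesicForm_smul G x 0 0
  simp [spray, this]

/-- The acceleration is quadratic in the velocity, so it has no first order term along the zero
section. The resulting map `(v, w) ↦ (w, 0)` squares to zero, which is what the flow theorem
requires near a constant geodesic. -/
theorem IsMetricOn.fderiv_spray_zero (h : IsMetricOn G U) {x : E} (hx : x ∈ U) (q : E × E) :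
    fderiv ℝ (spray G) (x, 0) q = (q.2, 0) := by
  have hd : HasFDerivAt (spray G) (fderiv ℝ (spray G) (x, 0)) (x, 0) :=
    ((h.spray_contDiffOn.contDiffAt (h.isOpen_prod.mem_nhds ⟨hx, mem_univ _⟩)).differentiableAt
      (by simp)).hasFDerivAt
  have h1 : fderiv ℝ (spray G) (x, 0) (q.1, 0) = 0 := by
    have hl : HasDerivAt (fun t : ℝ ↦ ((x, 0) : E × E) + t • (q.1, (0 : E))) (q.1, 0) 0 := by
      simpa using ((hasDerivAt_id (0 : ℝ)).smul_const (q.1, (0 : E))).const_add ((x, 0) : E × E)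
    have h2 := HasFDerivAt.comp_hasDerivAt_of_eq (0 : ℝ) hd hl (by simp)
    refine h2.unique ((hasDerivAt_const (0 : ℝ) (0 : E × E)).congr_of_eventuallyEq
      (Eventually.of_forall fun t ↦ ?_))
    simpa using IsMetricOn.spray_zero (G := G) (x + t • q.1)
  have h2 : fderiv ℝ (spray G) (x, 0) (0, q.2) = (q.2, 0) := by
    have hl : HasDerivAt (fun t : ℝ ↦ ((x, 0) : E × E) + t • ((0 : E), q.2)) (0, q.2) 0 := by
      simpa using ((hasDerivAt_id (0 : ℝ)).smul_const ((0 : E), q.2)).const_add ((x, 0) : E × E)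
    have h3 := HasFDerivAt.comp_hasDerivAt_of_eq (0 : ℝ) hd hl (by simp)
    have h4 : HasDerivAt (fun t : ℝ ↦ (t • q.2,
        (t * t) • -(G x).inverse (geodesicForm G x q.2))) (q.2, 0) 0 := by
      have h5 : HasDerivAt (fun t : ℝ ↦ t * t) 0 0 := by
        simpa using (hasDerivAt_id' (0 : ℝ)).fun_mul (hasDerivAt_id' (0 : ℝ))
      simpa using ((hasDerivAt_id (0 : ℝ)).smul_const q.2).prodMk
        (h5.smul_const (-(G x).inverse (geodesicForm G x q.2)))
    refine h3.unique (h4.congr_of_eventuallyEq (Eventually.of_forall fun t ↦ ?_))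
    simp [spray, geodesicForm_smul]
  have h3 : q = (q.1, 0) + (0, q.2) := by simp
  conv_lhs => rw [h3, map_add, h1, h2, zero_add]

/-- A solution of the geodesic equation, as a solution of the first order system. -/
theorem IsMetricOn.hasDerivAt_spray (h : IsMetricOn G U) {u w : ℝ → E} {w' : E} {t : ℝ}
    (hU : u t ∈ U) (hu : HasDerivAt u (w t) t) (hw : HasDerivAt w w' t)
    (heq : ∀ c, G (u t) w' c + geodesicForm G (u t) (w t) c = 0) :
    HasDerivAt (fun s ↦ (u s, w s)) (spray G (u t, w t)) t := by
  have h1 : w' = -(G (u t)).inverse (geodesicForm G (u t) (w t)) := by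
    rw [← sub_eq_zero]
    refine h.nondegenerate _ hU _ fun c ↦ ?_
    rw [sub_neg_eq_add, map_add, h.apply_inverse hU]
    exact heq c
  rw [spray, ← h1]
  exact hu.prodMk hw

/-- Geodesics depend smoothly on their initial data, near a constant geodesic. -/
theorem IsMetricOn.exists_exponential (h : IsMetricOn G U) {x₀ : E} (hx₀ : x₀ ∈ U) :
    ∃ (Φ : E × E → ℝ → E × E) (Ω : Set (E × E)), IsOpen Ω ∧ (x₀, 0) ∈ Ω ∧
      (∀ a ∈ Ω, Φ a 0 = a) ∧ (∀ a ∈ Ω, ∀ t ∈ Ioo (-2 : ℝ) 2, (Φ a t).1 ∈ U) ∧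
      (∀ a ∈ Ω, ∀ t ∈ Ioo (-2 : ℝ) 2, HasDerivAt (Φ a) (spray G (Φ a t)) t) ∧
      ContDiffOn ℝ ∞ (fun a ↦ (Φ a 1).1) Ω ∧ (Φ (x₀, 0) 1).1 = x₀ ∧
      HasFDerivAt (fun a ↦ (Φ a 1).1)
        (ContinuousLinearMap.fst ℝ E E + ContinuousLinearMap.snd ℝ E E) (x₀, 0) := by
  obtain ⟨Φ, Ω, h1, h2, h3, h4, h5, h6, h7, h8⟩ :=
    exists_smooth_flow_near_zero_of_contDiffOn (spray G) h.isOpen_prod h.spray_contDiffOn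
      (x₀, 0) ⟨hx₀, mem_univ _⟩ (IsMetricOn.spray_zero x₀)
      (fun b ↦ by simp only [h.fderiv_spray_zero hx₀]; rfl)
  refine ⟨Φ, Ω, h1, h2, h3, fun a ha t ht ↦ (h4 a ha t ht).1, h5, h6.fst, by rw [h7], ?_⟩
  -- The derivative of the time-one flow is `(v, w) ↦ (v + w, w)`, of which the first component is
  -- kept.
  refine h8.fst.congr_fderiv ?_
  ext q <;> simp [h.fderiv_spray_zero hx₀]

omit [FiniteDimensional ℝ E] in
theorem IsIsometryOn.injective_fderiv (hG : IsMetricOn G U) (hF : IsIsometryOn G G' F O U')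
    {x : E} (hx : x ∈ O) (hxU : x ∈ U) : Function.Injective (fderiv ℝ F x) := by
  rw [injective_iff_map_eq_zero]
  intro v hv
  refine hG.nondegenerate x hxU v fun w ↦ ?_
  rw [← hF.preserve x hx, hv]
  simp

theorem IsIsometryOn.surjective_fderiv (hG : IsMetricOn G U) (hF : IsIsometryOn G G' F O U')
    {x : E} (hx : x ∈ O) (hxU : x ∈ U) : Function.Surjective (fderiv ℝ F x) :=
  (LinearMap.injective_iff_surjective (f := (fderiv ℝ F x : E →ₗ[ℝ] E))).1
    (hF.injective_fderiv hG hx hxU)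

omit [FiniteDimensional ℝ E] in
theorem IsIsometryOn.hasFDerivAt_coordTangentMap (hF : IsIsometryOn G G' F O U') {x a : E}
    (hx : x ∈ O) : HasFDerivAt (coordTangentMap F)
      (((fderiv ℝ F x) ∘L ContinuousLinearMap.fst ℝ E E).prod
        ((fderiv ℝ F x) ∘L ContinuousLinearMap.snd ℝ E E
          + ((fderiv ℝ (fderiv ℝ F) x) ∘L ContinuousLinearMap.fst ℝ E E).flip a)) (x, a) := by
  have hFx := hF.contDiffOn.contDiffAt (hF.isOpen.mem_nhds hx)
  have h1 : HasFDerivAt F (fderiv ℝ F x) x := (hFx.differentiableAt (by simp)).hasFDerivAt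
  have h2 : HasFDerivAt (fderiv ℝ F) (fderiv ℝ (fderiv ℝ F) x) x :=
    ((hFx.fderiv_right (m := 1)
      (by rw [one_add_one_eq_two]; exact two_le_infty)).differentiableAt one_ne_zero).hasFDerivAt
  have h3 : HasFDerivAt (fun q : E × E ↦ F q.1) _ (x, a) := h1.comp (x, a) hasFDerivAt_fst
  have h4 : HasFDerivAt (fun q : E × E ↦ fderiv ℝ F q.1) _ (x, a) :=
    h2.comp (x, a) hasFDerivAt_fst
  exact h3.prodMk (h4.clm_apply hasFDerivAt_snd)

omit [FiniteDimensional ℝ E] in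
/-- The derivative of the isometry relation. -/
theorem IsIsometryOn.fderiv_preserve (hG : IsMetricOn G U) (hG' : IsMetricOn G' U')
    (hF : IsIsometryOn G G' F O U') {x : E} (hx : x ∈ O) (hxU : x ∈ U) (b u v : E) :
    fderiv ℝ G' (F x) (fderiv ℝ F x b) (fderiv ℝ F x u) (fderiv ℝ F x v)
      + G' (F x) (fderiv ℝ (fderiv ℝ F) x b u) (fderiv ℝ F x v)
      + G' (F x) (fderiv ℝ F x u) (fderiv ℝ (fderiv ℝ F) x b v) = fderiv ℝ G x b u v := by
  have hFx := hF.contDiffOn.contDiffAt (hF.isOpen.mem_nhds hx)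
  have h1 : HasFDerivAt F (fderiv ℝ F x) x := (hFx.differentiableAt (by simp)).hasFDerivAt
  have h2 : HasFDerivAt (fderiv ℝ F) (fderiv ℝ (fderiv ℝ F) x) x :=
    ((hFx.fderiv_right (m := 1)
      (by rw [one_add_one_eq_two]; exact two_le_infty)).differentiableAt one_ne_zero).hasFDerivAt
  have h3 : HasFDerivAt G' (fderiv ℝ G' (F x)) (F x) :=
    ((hG'.contDiffOn.contDiffAt (hG'.isOpen.mem_nhds (hF.mapsTo hx))).differentiableAt
      (by simp)).hasFDerivAt
  have h4 : HasFDerivAt G (fderiv ℝ G x) x :=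
    ((hG.contDiffOn.contDiffAt (hG.isOpen.mem_nhds hxU)).differentiableAt (by simp)).hasFDerivAt
  have h5 := ((h3.comp x h1).clm_apply (h2.clm_apply (hasFDerivAt_const u x))).clm_apply
    (h2.clm_apply (hasFDerivAt_const v x))
  have h6 := (h4.clm_apply (hasFDerivAt_const u x)).clm_apply (hasFDerivAt_const v x)
  have h7 := h5.congr_of_eventuallyEq (f₁ := fun y ↦ G y u v) (by
    filter_upwards [hF.isOpen.mem_nhds hx] with y hy
    exact (hF.preserve y hy u v).symm)
  have h8 := congrArg (fun L : E →L[ℝ] ℝ ↦ L b) (h6.unique h7)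
  simp at h8
  linarith

/-- An isometry maps the geodesic vector field to the geodesic vector field. -/
theorem IsIsometryOn.spray_coordTangentMap (hG : IsMetricOn G U) (hG' : IsMetricOn G' U')
    (hF : IsIsometryOn G G' F O U') {x a : E} (hx : x ∈ O) (hxU : x ∈ U) :
    fderiv ℝ (coordTangentMap F) (x, a) (spray G (x, a)) = spray G' (coordTangentMap F (x, a)) := by
  rw [(hF.hasFDerivAt_coordTangentMap hx).fderiv]
  have hFx := hF.contDiffOn.contDiffAt (hF.isOpen.mem_nhds hx)
  have hsymm : ∀ b c, fderiv ℝ (fderiv ℝ F) x b c = fderiv ℝ (fderiv ℝ F) x c b := fun b c ↦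
    (hFx.isSymmSndFDerivAt (by simpa using two_le_infty)) b c
  refine Prod.ext rfl ?_
  rw [← sub_eq_zero]
  refine hG'.nondegenerate _ (hF.mapsTo hx) _ fun c' ↦ ?_
  obtain ⟨c, rfl⟩ := hF.surjective_fderiv hG hx hxU c'
  -- In `h1 - h2 / 2` the terms containing the mixed second derivative of `F` in the directions `a`,
  -- `c` cancel by symmetry. What is left is the transformation rule of the Christoffel symbols,
  -- with the single correction term given by the second derivative on `(a, a)`.
  have h1 := hF.fderiv_preserve hG hG' hx hxU a a c
  have h2 := hF.fderiv_preserve hG hG' hx hxU c a a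
  have h3 := hF.preserve x hx (-(G x).inverse (geodesicForm G x a)) c
  rw [map_neg (G x), hG.apply_inverse hxU] at h3
  have h4 := hG'.apply_inverse (hF.mapsTo hx) (geodesicForm G' (F x) (fderiv ℝ F x a))
  rw [map_neg, map_neg, neg_apply, neg_apply, geodesicForm_apply] at h3
  simp only [spray, coordTangentMap, ContinuousLinearMap.prod_apply, add_apply,
    ContinuousLinearMap.comp_apply, ContinuousLinearMap.flip_apply, ContinuousLinearMap.coe_fst',
    ContinuousLinearMap.coe_snd', map_sub, map_add, sub_apply, map_neg, h4,
    neg_apply, geodesicForm_apply]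
  rw [hsymm c a] at h2
  rw [hG'.symm _ (hF.mapsTo hx) (fderiv ℝ F x a)] at h1 h2
  linarith

end CoordinateMetric

/-! ### Tangent vectors and tangent maps in charts -/

section TangentCoordinates

variable {E : Type u} [NormedAddCommGroup E] [NormedSpace ℝ E]
  {M : Type*} [TopologicalSpace M] [ChartedSpace E M]

/-- The tangent vector of `M` with coordinates `q` in the chart `e`. -/
def chartVector (e : OpenPartialHomeomorph M E) (q : E × E) : TangentBundle 𝓘(ℝ, E) M :=
  tangentMap 𝓘(ℝ, E) 𝓘(ℝ, E) e.symm (⟨q.1, q.2⟩ : TangentBundle 𝓘(ℝ, E) E)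

/-- The coordinates of a tangent vector of `M` in the chart `e`. -/
def chartCoord (e : OpenPartialHomeomorph M E) (ξ : TangentBundle 𝓘(ℝ, E) M) : E × E :=
  ((tangentMap 𝓘(ℝ, E) 𝓘(ℝ, E) e ξ).1, (tangentMap 𝓘(ℝ, E) 𝓘(ℝ, E) e ξ).2)

/-- The expression of `f` in the charts `e` and `e'`. -/
def chartMap (e e' : OpenPartialHomeomorph M E) (f : M → M) : E → E := e' ∘ f ∘ e.symm

/-- The domain of the expression of `f` in the charts `e` and `e'`. -/
def chartDomain (e e' : OpenPartialHomeomorph M E) (f : M → M) : Set E :=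
  e.target ∩ e.symm ⁻¹' (f ⁻¹' e'.source)

theorem isOpen_chartDomain (e e' : OpenPartialHomeomorph M E) {f : M → M} (hf : Continuous f) :
    IsOpen (chartDomain e e' f) :=
  e.isOpen_inter_preimage_symm (e'.open_source.preimage hf)

theorem symm_chartMap {e e' : OpenPartialHomeomorph M E} {f : M → M} {y : E}
    (hy : y ∈ chartDomain e e' f) : e'.symm (chartMap e e' f y) = f (e.symm y) :=
  e'.left_inv hy.2

variable [IsManifold 𝓘(ℝ, E) ∞ M] {e e' : OpenPartialHomeomorph M E}

theorem mdifferentiableAt_chart (he : e ∈ IsManifold.maximalAtlas 𝓘(ℝ, E) ∞ M) {x : M}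
    (hx : x ∈ e.source) : MDifferentiableAt 𝓘(ℝ, E) 𝓘(ℝ, E) e x :=
  (contMDiffAt_of_mem_maximalAtlas he hx).mdifferentiableAt (by simp)

theorem mdifferentiableAt_chart_symm (he : e ∈ IsManifold.maximalAtlas 𝓘(ℝ, E) ∞ M) {y : E}
    (hy : y ∈ e.target) : MDifferentiableAt 𝓘(ℝ, E) 𝓘(ℝ, E) e.symm y :=
  (contMDiffAt_symm_of_mem_maximalAtlas he hy).mdifferentiableAt (by simp)

theorem tangentMap_congr_of_eventuallyEq {N : Type*} [TopologicalSpace N] [ChartedSpace E N]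
    {f f' : N → M} {ξ : TangentBundle 𝓘(ℝ, E) N}
    (h : f =ᶠ[𝓝 ξ.1] f') : tangentMap 𝓘(ℝ, E) 𝓘(ℝ, E) f ξ = tangentMap 𝓘(ℝ, E) 𝓘(ℝ, E) f' ξ := by
  have h1 : f ξ.1 = f' ξ.1 := h.eq_of_nhds
  have h2 := h.mfderiv_eq (I := 𝓘(ℝ, E)) (I' := 𝓘(ℝ, E))
  unfold tangentMap
  congr 1
  exact congr_heq (congr_arg_heq _ h2) HEq.rfl

theorem chartCoord_fst (ξ : TangentBundle 𝓘(ℝ, E) M) : (chartCoord e ξ).1 = e ξ.1 := rfl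

theorem chartVector_chartCoord (he : e ∈ IsManifold.maximalAtlas 𝓘(ℝ, E) ∞ M)
    {ξ : TangentBundle 𝓘(ℝ, E) M} (hξ : ξ.1 ∈ e.source) : chartVector e (chartCoord e ξ) = ξ := by
  have h1 : chartVector e (chartCoord e ξ)
      = tangentMap 𝓘(ℝ, E) 𝓘(ℝ, E) e.symm (tangentMap 𝓘(ℝ, E) 𝓘(ℝ, E) e ξ) := rfl
  rw [h1, ← tangentMap_comp_at ξ (mdifferentiableAt_chart_symm he (e.map_source hξ))
    (mdifferentiableAt_chart he hξ), tangentMap_congr_of_eventuallyEq (f' := id), tangentMap_id]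
  · rfl
  · exact e.eventually_left_inverse hξ

theorem chartCoord_chartVector (he : e ∈ IsManifold.maximalAtlas 𝓘(ℝ, E) ∞ M)
    {q : E × E} (hq : q.1 ∈ e.target) : chartCoord e (chartVector e q) = q := by
  have h1 : tangentMap 𝓘(ℝ, E) 𝓘(ℝ, E) e (chartVector e q)
      = (⟨q.1, q.2⟩ : TangentBundle 𝓘(ℝ, E) E) := by
    unfold chartVector
    rw [← tangentMap_comp_at _ (mdifferentiableAt_chart he (e.map_target hq))
      (mdifferentiableAt_chart_symm he hq), tangentMap_congr_of_eventuallyEq (f' := id),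
      tangentMap_id]
    · rfl
    · exact e.eventually_right_inverse hq
  rw [chartCoord, h1]

theorem contMDiffOn_chartVector_const (he : e ∈ IsManifold.maximalAtlas 𝓘(ℝ, E) ∞ M) (a : E) :
    ContMDiffOn 𝓘(ℝ, E) 𝓘(ℝ, E).tangent ∞ (fun y ↦ chartVector e (y, a)) e.target := by
  have h1 := (contMDiffOn_symm_of_mem_maximalAtlas he).contMDiffOn_tangentMapWithin (m := ∞)
    (by simp) e.open_target.uniqueMDiffOn
  have h2 : ContMDiff 𝓘(ℝ, E) 𝓘(ℝ, E).tangent ∞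
      (fun y ↦ (⟨y, a⟩ : TangentBundle 𝓘(ℝ, E) E)) := fun y ↦ by
    have h := contMDiffWithinAt_vectorSpace_iff_contDiffWithinAt (𝕜 := ℝ) (E := E) (n := ∞)
      (V := fun _ ↦ a) (s := univ) (x := y)
    exact h.2 contDiffWithinAt_const
  refine (h1.comp h2.contMDiffOn (fun q hq ↦ hq)).congr fun y hy ↦ ?_
  exact (tangentMapWithin_eq_tangentMap (e.open_target.uniqueMDiffOn _ hy)
    (mdifferentiableAt_chart_symm he hy)).symm

theorem continuousOn_chartVector (he : e ∈ IsManifold.maximalAtlas 𝓘(ℝ, E) ∞ M) :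
    ContinuousOn (chartVector e) (e.target ×ˢ univ) := by
  have h1 := (contMDiffOn_symm_of_mem_maximalAtlas he).continuousOn_tangentMapWithin (by simp)
    e.open_target.uniqueMDiffOn
  have h2 : Continuous (fun q : E × E ↦ (⟨q.1, q.2⟩ : TangentBundle 𝓘(ℝ, E) E)) :=
    (tangentBundleModelSpaceHomeomorph 𝓘(ℝ, E)).symm.continuous
  refine (h1.comp h2.continuousOn (fun q hq ↦ hq.1)).congr fun q hq ↦ ?_
  exact (tangentMapWithin_eq_tangentMap (e.open_target.uniqueMDiffOn _ hq.1)
    (mdifferentiableAt_chart_symm he hq.1)).symm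

theorem continuousOn_chartCoord (he : e ∈ IsManifold.maximalAtlas 𝓘(ℝ, E) ∞ M) :
    ContinuousOn (chartCoord e) {ξ : TangentBundle 𝓘(ℝ, E) M | ξ.1 ∈ e.source} := by
  have h1 := (contMDiffOn_of_mem_maximalAtlas he).continuousOn_tangentMapWithin (by simp)
    e.open_source.uniqueMDiffOn
  have h2 : Continuous (fun ξ : TangentBundle 𝓘(ℝ, E) E ↦ ((ξ.1, ξ.2) : E × E)) :=
    (tangentBundleModelSpaceHomeomorph 𝓘(ℝ, E)).continuous
  refine (h2.comp_continuousOn h1).congr fun ξ hξ ↦ ?_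
  simp only [Function.comp_apply]
  rw [tangentMapWithin_eq_tangentMap (e.open_source.uniqueMDiffOn _ hξ)
    (mdifferentiableAt_chart he hξ)]
  rfl

theorem contDiffOn_chartMap (he : e ∈ IsManifold.maximalAtlas 𝓘(ℝ, E) ∞ M)
    (he' : e' ∈ IsManifold.maximalAtlas 𝓘(ℝ, E) ∞ M) {f : M → M}
    (hf : ContMDiff 𝓘(ℝ, E) 𝓘(ℝ, E) ∞ f) :
    ContDiffOn ℝ ∞ (chartMap e e' f) (chartDomain e e' f) := by
  rw [← contMDiffOn_iff_contDiffOn]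
  refine (contMDiffOn_of_mem_maximalAtlas he').comp (hf.comp_contMDiffOn
    ((contMDiffOn_symm_of_mem_maximalAtlas he).mono inter_subset_left)) fun y hy ↦ hy.2

theorem chartVector_coordTangentMap (he : e ∈ IsManifold.maximalAtlas 𝓘(ℝ, E) ∞ M)
    (he' : e' ∈ IsManifold.maximalAtlas 𝓘(ℝ, E) ∞ M) {f : M → M}
    (hf : ContMDiff 𝓘(ℝ, E) 𝓘(ℝ, E) ∞ f) {q : E × E} (hq : q.1 ∈ chartDomain e e' f) :
    chartVector e' (coordTangentMap (chartMap e e' f) q)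
      = tangentMap 𝓘(ℝ, E) 𝓘(ℝ, E) f (chartVector e q) := by
  have hO := isOpen_chartDomain e e' hf.continuous
  have hd : DifferentiableAt ℝ (chartMap e e' f) q.1 :=
    ((contDiffOn_chartMap he he' hf).contDiffAt (hO.mem_nhds hq)).differentiableAt (by simp)
  have h1 : chartVector e' (coordTangentMap (chartMap e e' f) q)
      = tangentMap 𝓘(ℝ, E) 𝓘(ℝ, E) e'.symm (tangentMap 𝓘(ℝ, E) 𝓘(ℝ, E) (chartMap e e' f)
        (⟨q.1, q.2⟩ : TangentBundle 𝓘(ℝ, E) E)) := by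
    simp only [chartVector, coordTangentMap, tangentMap, mfderiv_eq_fderiv]
    rfl
  rw [h1, chartVector, ← tangentMap_comp_at _ (mdifferentiableAt_chart_symm he'
      (show chartMap e e' f q.1 ∈ e'.target from e'.map_source hq.2)) hd.mdifferentiableAt,
    ← tangentMap_comp_at _ (hf.mdifferentiable (by simp) _) (mdifferentiableAt_chart_symm he hq.1)]
  apply tangentMap_congr_of_eventuallyEq
  filter_upwards [hO.mem_nhds hq] with y hy
  exact symm_chartMap hy

theorem coordTangentMap_chartMap (he : e ∈ IsManifold.maximalAtlas 𝓘(ℝ, E) ∞ M)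
    (he' : e' ∈ IsManifold.maximalAtlas 𝓘(ℝ, E) ∞ M) {f : M → M}
    (hf : ContMDiff 𝓘(ℝ, E) 𝓘(ℝ, E) ∞ f) {q : E × E} (hq : q.1 ∈ chartDomain e e' f) :
    coordTangentMap (chartMap e e' f) q
      = chartCoord e' (tangentMap 𝓘(ℝ, E) 𝓘(ℝ, E) f (chartVector e q)) := by
  rw [← chartVector_coordTangentMap he he' hf hq, chartCoord_chartVector he']
  exact e'.map_source hq.2

end TangentCoordinates

/-! ### The Lorentzian metric in charts -/

namespace LorentzianMetric

variable {E : Type u} [NormedAddCommGroup E] [NormedSpace ℝ E]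
  {M : Type*} [TopologicalSpace M] [ChartedSpace E M] [IsManifold 𝓘(ℝ, E) ∞ M]
  (g : LorentzianMetric E M) {e e' : OpenPartialHomeomorph M E}

/-- Equality in the total space records the equality of base points along with that of vectors.
Vectors over points that are only provably equal are thus compared without explicit transport. -/
theorem inner_congr {x x' : M} {v w : TangentSpace 𝓘(ℝ, E) x} {v' w' : TangentSpace 𝓘(ℝ, E) x'}
    (hv : (⟨x, v⟩ : TangentBundle 𝓘(ℝ, E) M) = ⟨x', v'⟩)
    (hw : (⟨x, w⟩ : TangentBundle 𝓘(ℝ, E) M) = ⟨x', w'⟩) : g.inner x v w = g.inner x' v' w' := by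
  cases hv
  cases hw
  rfl

theorem nondegenerate (x : M) (v : TangentSpace 𝓘(ℝ, E) x) (hv : ∀ w, g.inner x v w = 0) :
    v = 0 := by
  obtain ⟨z, -, hz⟩ := g.signature x
  by_contra hne
  have h := hz v (by rw [g.symm, hv]) hne
  rw [hv] at h
  exact h.false

/-- The matrix of the metric in a chart, as a field of bilinear forms. -/
def chartMetric (e : OpenPartialHomeomorph M E) (y : E) : E →L[ℝ] E →L[ℝ] ℝ :=
  let B : E →L[ℝ] E →L[ℝ] ℝ := g.inner (e.symm y)
  let L : E →L[ℝ] E := mfderiv 𝓘(ℝ, E) 𝓘(ℝ, E) e.symm y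
  B.bilinearComp L L

theorem chartMetric_apply (y a b : E) : g.chartMetric e y a b = g.coeff e y a b := by
  rw [chartMetric, coeff]
  rfl

theorem chartMetric_eq_inner {x : M} {v w : TangentSpace 𝓘(ℝ, E) x} {y a b : E}
    (ha : chartVector e (y, a) = ⟨x, v⟩) (hb : chartVector e (y, b) = ⟨x, w⟩) :
    g.chartMetric e y a b = g.inner x v w :=
  (g.chartMetric_apply y a b).trans (g.inner_congr ha hb)

theorem contDiffOn_coeff (he : e ∈ IsManifold.maximalAtlas 𝓘(ℝ, E) ∞ M) (a b : E) :
    ContDiffOn ℝ ∞ (fun y ↦ g.coeff e y a b) e.target := by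
  intro y hy
  have h1 : ContMDiffAt 𝓘(ℝ, E) (𝓘(ℝ, E).prod 𝓘(ℝ)) ∞
      (fun y ↦ Bundle.TotalSpace.mk' ℝ (E := Bundle.Trivial M ℝ) (e.symm y)
        (g.inner (e.symm y) (chartVector e (y, a)).2 (chartVector e (y, b)).2)) y := by
    apply ContMDiffAt.clm_bundle_apply₂ (F₁ := E) (F₂ := E)
    · exact g.contMDiff.contMDiffAt.comp y (contMDiffAt_symm_of_mem_maximalAtlas he hy)
    · exact (contMDiffOn_chartVector_const he a).contMDiffAt (e.open_target.mem_nhds hy)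
    · exact (contMDiffOn_chartVector_const he b).contMDiffAt (e.open_target.mem_nhds hy)
  rw [Bundle.contMDiffAt_totalSpace] at h1
  have h2 : ContMDiffAt 𝓘(ℝ, E) 𝓘(ℝ) ∞ (fun y ↦
    g.inner (e.symm y) (chartVector e (y, a)).2 (chartVector e (y, b)).2) y := h1.2
  exact h2.contDiffAt.contDiffWithinAt

theorem chartMetric_nondegenerate (he : e ∈ IsManifold.maximalAtlas 𝓘(ℝ, E) ∞ M) {y : E}
    (hy : y ∈ e.target) {v : E} (hv : ∀ w, g.chartMetric e y v w = 0) : v = 0 := by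
  have h2 : (chartVector e (y, v)).2 = 0 := by
    refine g.nondegenerate _ _ fun w ↦ ?_
    have h3 := chartVector_chartCoord (ξ := ⟨e.symm y, w⟩) he (e.map_target hy)
    have h4 : chartCoord e (⟨e.symm y, w⟩ : TangentBundle 𝓘(ℝ, E) M)
        = (y, (chartCoord e (⟨e.symm y, w⟩ : TangentBundle 𝓘(ℝ, E) M)).2) :=
      Prod.ext (e.right_inv hy) rfl
    rw [h4] at h3
    exact (g.chartMetric_eq_inner rfl h3).symm.trans (hv _)
  have h5 : (chartVector e (y, (0 : E))).2 = 0 :=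
    map_zero (mfderiv 𝓘(ℝ, E) 𝓘(ℝ, E) e.symm y)
  have h1 : chartVector e (y, v) = chartVector e (y, 0) :=
    congrArg (Bundle.TotalSpace.mk (F := E) (e.symm y)) (h2.trans h5.symm)
  have h2 := congrArg (chartCoord e) h1
  rw [chartCoord_chartVector he hy, chartCoord_chartVector he hy] at h2
  exact congrArg Prod.snd h2

theorem isMetricOn_chartMetric [FiniteDimensional ℝ E]
    (he : e ∈ IsManifold.maximalAtlas 𝓘(ℝ, E) ∞ M) :
    IsMetricOn (g.chartMetric e) e.target where
  isOpen := e.open_target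
  contDiffOn := by
    rw [contDiffOn_clm_apply]
    intro a
    rw [contDiffOn_clm_apply]
    intro b
    exact (g.contDiffOn_coeff he a b).congr fun y _ ↦ g.chartMetric_apply y a b
  symm x _ v w := by
    rw [chartMetric_apply, chartMetric_apply]
    exact g.symm _ _ _
  nondegenerate y hy v hv := g.chartMetric_nondegenerate he hy hv

theorem isIsometryOn_chartMap (he : e ∈ IsManifold.maximalAtlas 𝓘(ℝ, E) ∞ M)
    (he' : e' ∈ IsManifold.maximalAtlas 𝓘(ℝ, E) ∞ M) (f : g.isometryGroup) :
    IsIsometryOn (g.chartMetric e) (g.chartMetric e') (chartMap e e' (f : M ≃ₜ M))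
      (chartDomain e e' (f : M ≃ₜ M)) e'.target where
  isOpen := isOpen_chartDomain e e' (f : M ≃ₜ M).continuous
  contDiffOn := contDiffOn_chartMap he he' f.2.1
  mapsTo y hy := e'.map_source hy.2
  preserve y hy v w := by
    have h := fun v ↦ chartVector_coordTangentMap he he' f.2.1 (q := (y, v)) hy
    exact (g.inner_congr (h v) (h w)).trans (f.2.2.2 _ _ _)

end LorentzianMetric

/-! ### Geodesics in charts and their transport by isometries -/

namespace LorentzianMetric

variable {E : Type u} [NormedAddCommGroup E] [NormedSpace ℝ E] [FiniteDimensional ℝ E]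
  {M : Type*} [TopologicalSpace M] [ChartedSpace E M] [IsManifold 𝓘(ℝ, E) ∞ M]
  (g : LorentzianMetric E M) {e e' : OpenPartialHomeomorph M E}

/-- `ζ` is the velocity curve of a geodesic in the chart `e` at the times in `s`. -/
def IsChartGeodesicOn (e : OpenPartialHomeomorph M E) (ζ : ℝ → E × E) (s : Set ℝ) : Prop :=
  ∀ t ∈ s, (ζ t).1 ∈ e.target ∧ HasDerivAt ζ (spray (g.chartMetric e) (ζ t)) t

variable {g}

/-- The spray is continuously differentiable, hence locally Lipschitz, so integral curves with a
common value agree nearby. -/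
theorem IsChartGeodesicOn.eventually_eq (he : e ∈ IsManifold.maximalAtlas 𝓘(ℝ, E) ∞ M)
    {ζ ζ' : ℝ → E × E} {t : ℝ} (hζ : ∀ᶠ s in 𝓝 t, g.IsChartGeodesicOn e ζ {s})
    (hζ' : ∀ᶠ s in 𝓝 t, g.IsChartGeodesicOn e ζ' {s}) (h : ζ t = ζ' t) : ζ =ᶠ[𝓝 t] ζ' := by
  have hG := g.isMetricOn_chartMetric he
  have ht := hζ.self_of_nhds t rfl
  have ht' := hζ'.self_of_nhds t rfl
  obtain ⟨K, s, hs, hK⟩ := ((hG.spray_contDiffOn.contDiffAt (hG.isOpen_prod.mem_nhds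
    ⟨ht.1, mem_univ _⟩)).of_le (by simp)).exists_lipschitzOnWith
  refine ODE_solution_unique_of_eventually (v := fun _ ↦ spray (g.chartMetric e)) (s := fun _ ↦ s)
    (K := K) (Eventually.of_forall fun _ ↦ hK) ?_ ?_ h
  · filter_upwards [hζ, ht.2.continuousAt.preimage_mem_nhds hs] with r hr hr'
    exact ⟨(hr r rfl).2, hr'⟩
  · filter_upwards [hζ', ht'.2.continuousAt.preimage_mem_nhds (h ▸ hs)] with r hr hr'
    exact ⟨(hr r rfl).2, hr'⟩

/-- An isometry maps geodesics to geodesics, in charts. -/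
theorem IsChartGeodesicOn.coordTangentMap (he : e ∈ IsManifold.maximalAtlas 𝓘(ℝ, E) ∞ M)
    (he' : e' ∈ IsManifold.maximalAtlas 𝓘(ℝ, E) ∞ M) (f : g.isometryGroup) {ζ : ℝ → E × E}
    {s : Set ℝ} (hζ : g.IsChartGeodesicOn e ζ s)
    (hs : ∀ t ∈ s, (ζ t).1 ∈ chartDomain e e' (f : M ≃ₜ M)) :
    g.IsChartGeodesicOn e'
      (fun t ↦ _root_.coordTangentMap (chartMap e e' (f : M ≃ₜ M)) (ζ t)) s := by
  intro t ht
  have hF := g.isIsometryOn_chartMap he he' f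
  have hG := g.isMetricOn_chartMetric he
  have hG' := g.isMetricOn_chartMetric he'
  refine ⟨hF.mapsTo (hs t ht), ?_⟩
  have h1 := hF.hasFDerivAt_coordTangentMap (a := (ζ t).2) (hs t ht)
  have h2 := hF.spray_coordTangentMap (a := (ζ t).2) hG hG' (hs t ht) (hζ t ht).1
  rw [← h2, h1.fderiv]
  exact h1.comp_hasDerivAt t (hζ t ht).2

/-- Two geodesics which correspond under an isometry at time `0` correspond at all times. -/
theorem IsChartGeodesicOn.eq_tangentMap [T2Space M]
    (he : e ∈ IsManifold.maximalAtlas 𝓘(ℝ, E) ∞ M)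
    (he' : e' ∈ IsManifold.maximalAtlas 𝓘(ℝ, E) ∞ M) (f : g.isometryGroup) {ζ ζ' : ℝ → E × E}
    {τ : ℝ} (hτ : 0 < τ) (hζ : g.IsChartGeodesicOn e ζ (Ioo (-τ) τ))
    (hζ' : g.IsChartGeodesicOn e' ζ' (Ioo (-τ) τ))
    (h0 : chartVector e' (ζ' 0) = tangentMap 𝓘(ℝ, E) 𝓘(ℝ, E) (f : M ≃ₜ M) (chartVector e (ζ 0))) :
    ∀ t ∈ Ioo (-τ) τ, chartVector e' (ζ' t)
      = tangentMap 𝓘(ℝ, E) 𝓘(ℝ, E) (f : M ≃ₜ M) (chartVector e (ζ t)) := by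
  set T := tangentMap 𝓘(ℝ, E) 𝓘(ℝ, E) (f : M ≃ₜ M) with hT
  let W := {t | (ζ t).1 ∈ chartDomain e e' (f : M ≃ₜ M)}
  let C := _root_.coordTangentMap (chartMap e e' (f : M ≃ₜ M))
  have hO := isOpen_chartDomain e e' (f : M ≃ₜ M).continuous
  have hF := g.isIsometryOn_chartMap he he' f
  have hcont : ∀ t ∈ Ioo (-τ) τ, ContinuousAt ζ t := fun t ht ↦ (hζ t ht).2.continuousAt
  have hcont' : ∀ t ∈ Ioo (-τ) τ, ContinuousAt ζ' t := fun t ht ↦ (hζ' t ht).2.continuousAt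
  have hW : ∀ t ∈ Ioo (-τ) τ, t ∈ W → W ∈ 𝓝 t := fun t ht htW ↦
    (hcont t ht).fst.preimage_mem_nhds (hO.mem_nhds htW)
  -- Nothing guarantees in advance that `f` sends the first geodesic into `e'.source`. Coincidence
  -- with the second one forces it, because `ζ'` stays in `e'.target`.
  have hbase : ∀ t ∈ Ioo (-τ) τ,
      e'.symm (ζ' t).1 = (f : M ≃ₜ M) (e.symm (ζ t).1) → t ∈ W := fun t ht h ↦
    ⟨(hζ t ht).1, by
      change (f : M ≃ₜ M) (e.symm (ζ t).1) ∈ e'.source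
      rw [← h]
      exact e'.map_target (hζ' t ht).1⟩
  have hiff : ∀ t ∈ Ioo (-τ) τ, t ∈ W → (chartVector e' (ζ' t) = T (chartVector e (ζ t)) ↔
      C (ζ t) = ζ' t) := by
    intro t ht htW
    rw [hT, ← chartVector_coordTangentMap he he' f.2.1 htW]
    refine ⟨fun h ↦ ?_, fun h ↦ ?_⟩
    · have h1 := congrArg (chartCoord e') h
      rwa [chartCoord_chartVector he' (hζ' t ht).1,
        chartCoord_chartVector he' (hF.mapsTo htW), eq_comm] at h1
    · exact congrArg _ h.symm
  -- Continuation along the interval: the set of coincidence is open by uniqueness for the spray. It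
  -- is closed in the interval because `M` is Hausdorff, which gives the coincidence of base points
  -- at a limit time, after which the comparison takes place in `e'`.
  have hopen : IsOpen {t | t ∈ Ioo (-τ) τ ∧ chartVector e' (ζ' t) = T (chartVector e (ζ t))} := by
    rw [isOpen_iff_mem_nhds]
    rintro t ⟨ht, h⟩
    have htW : t ∈ W := hbase t ht (congrArg Bundle.TotalSpace.proj h)
    have hI := Ioo_mem_nhds ht.1 ht.2
    have h1 : (fun t ↦ C (ζ t)) =ᶠ[𝓝 t] ζ' := by
      refine IsChartGeodesicOn.eventually_eq (g := g) he' ?_ ?_ ((hiff t ht htW).1 h)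
      · filter_upwards [hI, hW t ht htW] with s hs hsW
        exact IsChartGeodesicOn.coordTangentMap he he' f (fun r hr ↦ hζ r (by rwa [hr]))
          (fun r hr ↦ by rw [hr]; exact hsW)
      · filter_upwards [hI] with s hs
        exact fun r hr ↦ hζ' r (by rwa [hr])
    filter_upwards [hI, hW t ht htW, h1] with s hs hsW h2
    exact ⟨hs, (hiff s hs hsW).2 h2⟩
  refine fun t ht ↦ (isPreconnected_Ioo.subset_of_closure_inter_subset hopen
    ⟨0, ⟨by linarith, hτ⟩, ⟨by linarith, hτ⟩, h0⟩ ?_ ht).2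
  rintro t ⟨htc, ht⟩
  refine ⟨ht, ?_⟩
  rw [mem_closure_iff_frequently] at htc
  have htW : t ∈ W := by
    refine hbase t ht ?_
    have h1 : Tendsto (fun s ↦ e'.symm (ζ' s).1) (𝓝 t) (𝓝 (e'.symm (ζ' t).1)) :=
      (e'.continuousAt_symm (hζ' t ht).1).tendsto.comp (hcont' t ht).fst
    have h2 : Tendsto (fun s ↦ (f : M ≃ₜ M) (e.symm (ζ s).1)) (𝓝 t)
        (𝓝 ((f : M ≃ₜ M) (e.symm (ζ t).1))) :=
      ((f : M ≃ₜ M).continuous.tendsto _).comp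
        ((e.continuousAt_symm (hζ t ht).1).tendsto.comp (hcont t ht).fst)
    exact tendsto_nhds_unique_of_frequently_eq h1 h2
      (htc.mono fun s hs ↦ congrArg Bundle.TotalSpace.proj hs.2)
  have h1 : Tendsto (fun s ↦ C (ζ s)) (𝓝 t) (𝓝 (C (ζ t))) :=
    (hF.hasFDerivAt_coordTangentMap (a := (ζ t).2) htW).continuousAt.tendsto.comp (hcont t ht)
  refine (hiff t ht htW).2 (tendsto_nhds_unique_of_frequently_eq h1 (hcont' t ht) ?_)
  exact (htc.and_eventually (hW t ht htW)).mono fun s hs ↦ (hiff s hs.1.1 hs.2).1 hs.1.2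

/-- A geodesic has a velocity curve which solves the geodesic equation in every chart. -/
theorem IsGeodesicOn.isChartGeodesicOn (he : e ∈ IsManifold.maximalAtlas 𝓘(ℝ, E) ∞ M)
    {γ : ℝ → M} {s : Set ℝ} (hs : IsOpen s) (hγ : g.IsGeodesicOn γ s) :
    g.IsChartGeodesicOn e (fun t ↦ (e (γ t), deriv (e ∘ γ) t)) (s ∩ γ ⁻¹' e.source) := by
  have hG := g.isMetricOn_chartMetric he
  rintro t ⟨hts, hte⟩
  have hte' := e.map_source hte
  refine ⟨hte', ?_⟩
  have h1 : ContDiffAt ℝ ∞ (e ∘ γ) t :=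
    ((contMDiffAt_of_mem_maximalAtlas he hte).comp t
      ((hγ.1 t hts).contMDiffAt (hs.mem_nhds hts))).contDiffAt
  have h2 : HasDerivAt (e ∘ γ) (deriv (e ∘ γ) t) t := (h1.differentiableAt (by simp)).hasDerivAt
  have h3 : HasDerivAt (deriv (e ∘ γ)) (deriv (deriv (e ∘ γ)) t) t := by
    have h4 := ((h1.fderiv_right (m := 1)
      (by rw [one_add_one_eq_two]; exact two_le_infty)).clm_apply
      contDiffAt_const (g := fun _ ↦ (1 : ℝ))).differentiableAt one_ne_zero
    simp only [fderiv_apply_one_eq_deriv] at h4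
    exact h4.hasDerivAt
  refine hG.hasDerivAt_spray (u := e ∘ γ) hte' h2 h3 fun c ↦ ?_
  have h4 := hγ.2 e he t hts hte c
  rw [← h4, chartMetric_apply, geodesicForm_apply, christoffel]
  have hd : DifferentiableAt ℝ (g.chartMetric e) (e (γ t)) :=
    (hG.contDiffOn.contDiffAt (hG.isOpen.mem_nhds hte')).differentiableAt (by simp)
  have h5 : ∀ a b v, fderiv ℝ (fun z ↦ g.coeff e z a b) (e (γ t)) v
      = fderiv ℝ (g.chartMetric e) (e (γ t)) v a b := by
    intro a b v
    have h6 := (hd.hasFDerivAt.clm_apply (hasFDerivAt_const a _)).clm_apply (hasFDerivAt_const b _)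
    have h7 := congrArg (fun L : E →L[ℝ] ℝ ↦ L v) h6.fderiv
    simp only [chartMetric_apply] at h7
    simpa using h7
  rw [h5, h5]
  simp only [Function.comp_apply]
  ring

/-- The local flow of geodesics with given initial data, continuous in the initial data. -/
theorem exists_local_geodesic_flow (g : LorentzianMetric E M)
    (he : e ∈ IsManifold.maximalAtlas 𝓘(ℝ, E) ∞ M) (q : E × E)
    (hq : q.1 ∈ e.target) : ∃ (α : E × E → ℝ → E × E) (τ : ℝ), 0 < τ ∧
      (∀ᶠ a in 𝓝 q, α a 0 = a ∧ g.IsChartGeodesicOn e (α a) (Ioo (-τ) τ)) ∧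
      ∀ t ∈ Ioo (-τ) τ, ContinuousAt (fun a ↦ α a t) q := by
  have hG := g.isMetricOn_chartMetric he
  -- The initial velocity is arbitrary here, so only a short time is available. Continuity in the
  -- data suffices for the hypersurface argument.
  obtain ⟨ε, hε, a, r, L, K, hr, hpl⟩ := IsPicardLindelof.of_contDiffAt_one
    ((hG.spray_contDiffOn.contDiffAt (hG.isOpen_prod.mem_nhds
      (show q ∈ e.target ×ˢ univ from ⟨hq, mem_univ _⟩))).of_le (by simp))
  obtain ⟨α, hα, hcont⟩ :=
    (hpl 0).exists_forall_mem_closedBall_eq_hasDerivWithinAt_continuousOn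
  simp only [zero_sub, zero_add] at hα hcont
  have hball : Metric.closedBall q r ∈ 𝓝 q := Metric.closedBall_mem_nhds q hr
  have hcat : ∀ t ∈ Ioo (-ε) ε, ContinuousAt α (q, t) := fun t ht ↦
    hcont.continuousAt (prod_mem_nhds hball (Icc_mem_nhds ht.1 ht.2))
  have h0 : ∀ᶠ x in 𝓝 (q, (0 : ℝ)), (α x).1 ∈ e.target := by
    refine (hcat 0 ⟨by linarith, hε⟩).fst.preimage_mem_nhds (e.open_target.mem_nhds ?_)
    rw [(hα q (Metric.mem_closedBall_self r.2)).1]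
    exact hq
  rw [nhds_prod_eq, eventually_prod_iff] at h0
  obtain ⟨P, hP, Q, hQ, hPQ⟩ := h0
  obtain ⟨τ, hτ, hτQ⟩ := Metric.eventually_nhds_iff_ball.1 hQ
  rw [Real.ball_eq_Ioo, zero_sub, zero_add] at hτQ
  refine ⟨fun a t ↦ α (a, t), min τ ε, lt_min hτ hε, ?_, ?_⟩
  · filter_upwards [hball, hP] with b hb hbP
    refine ⟨(hα b hb).1, fun t ht ↦ ⟨hPQ hbP (hτQ t ⟨?_, ?_⟩), ?_⟩⟩
    · linarith [ht.1, min_le_left τ ε]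
    · linarith [ht.2, min_le_left τ ε]
    · have h1 : -ε < t := by linarith [ht.1, min_le_right τ ε]
      have h2 : t < ε := by linarith [ht.2, min_le_right τ ε]
      exact ((hα b hb).2 t ⟨h1.le, h2.le⟩).hasDerivAt (Icc_mem_nhds h1 h2)
  · intro t ht
    refine (hcat t ⟨?_, ?_⟩).comp (f := fun a : E × E ↦ (a, t))
      (by fun_prop : Continuous fun a : E × E ↦ (a, t)).continuousAt
    · linarith [ht.1, min_le_right τ ε]
    · linarith [ht.2, min_le_right τ ε]

/-- The exponential map in a chart: a smooth family of geodesics parametrized by the initial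
data. -/
theorem exists_chart_exponential (g : LorentzianMetric E M)
    (he : e ∈ IsManifold.maximalAtlas 𝓘(ℝ, E) ∞ M) {x₀ : E} (hx₀ : x₀ ∈ e.target) :
    ∃ (Φ : E × E → ℝ → E × E) (Ω : Set (E × E)), IsOpen Ω ∧ (x₀, 0) ∈ Ω ∧
      (∀ a ∈ Ω, Φ a 0 = a ∧ g.IsChartGeodesicOn e (Φ a) (Ioo (-2) 2)) ∧
      ContDiffOn ℝ ∞ (fun a ↦ (Φ a 1).1) Ω ∧ (Φ (x₀, 0) 1).1 = x₀ ∧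
      HasFDerivAt (fun a ↦ (Φ a 1).1)
        (ContinuousLinearMap.fst ℝ E E + ContinuousLinearMap.snd ℝ E E) (x₀, 0) := by
  obtain ⟨Φ, Ω, h1, h2, h3, h4, h5, h6, h7, h8⟩ :=
    (g.isMetricOn_chartMetric he).exists_exponential hx₀
  exact ⟨Φ, Ω, h1, h2, fun a ha ↦ ⟨h3 a ha, fun t ht ↦ ⟨h4 a ha t ht, h5 a ha t ht⟩⟩, h6, h7, h8⟩

/-- Isometries commute with exponential maps. -/
theorem exponential_comm [T2Space M] (he : e ∈ IsManifold.maximalAtlas 𝓘(ℝ, E) ∞ M)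
    (he' : e' ∈ IsManifold.maximalAtlas 𝓘(ℝ, E) ∞ M) (f : g.isometryGroup)
    {Φ Φ' : E × E → ℝ → E × E} {Ω Ω' : Set (E × E)}
    (hΦ : ∀ a ∈ Ω, Φ a 0 = a ∧ g.IsChartGeodesicOn e (Φ a) (Ioo (-2) 2))
    (hΦ' : ∀ a ∈ Ω', Φ' a 0 = a ∧ g.IsChartGeodesicOn e' (Φ' a) (Ioo (-2) 2))
    {a : E × E} (ha : a ∈ Ω) (hdom : a.1 ∈ chartDomain e e' (f : M ≃ₜ M))
    (ha' : coordTangentMap (chartMap e e' (f : M ≃ₜ M)) a ∈ Ω') :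
    (Φ a 1).1 ∈ chartDomain e e' (f : M ≃ₜ M) ∧ chartMap e e' (f : M ≃ₜ M) (Φ a 1).1
      = (Φ' (coordTangentMap (chartMap e e' (f : M ≃ₜ M)) a) 1).1 := by
  have h1 := IsChartGeodesicOn.eq_tangentMap he he' f two_pos (hΦ a ha).2 (hΦ' _ ha').2
    (by rw [(hΦ a ha).1, (hΦ' _ ha').1, chartVector_coordTangentMap he he' f.2.1 hdom])
    1 (by norm_num)
  have h2 : e'.symm (Φ' (coordTangentMap (chartMap e e' (f : M ≃ₜ M)) a) 1).1
      = (f : M ≃ₜ M) (e.symm (Φ a 1).1) := congrArg Bundle.TotalSpace.proj h1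
  have h3 := ((hΦ a ha).2 1 (by norm_num)).1
  have h4 := ((hΦ' _ ha').2 1 (by norm_num)).1
  refine ⟨⟨h3, ?_⟩, ?_⟩
  · change (f : M ≃ₜ M) (e.symm (Φ a 1).1) ∈ e'.source
    rw [← h2]
    exact e'.map_target h4
  · change e' ((f : M ≃ₜ M) (e.symm (Φ a 1).1)) = _
    rw [← h2, e'.right_inv h4]

end LorentzianMetric

/-! ### Isometries are governed by their first jets -/

/-- In finite dimension, pointwise convergence of linear maps is convergence in norm. -/
theorem tendsto_clm_of_forall_tendsto {E F ι : Type*} [NormedAddCommGroup E] [NormedSpace ℝ E]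
    [FiniteDimensional ℝ E] [NormedAddCommGroup F] [NormedSpace ℝ F] [FiniteDimensional ℝ F]
    {l : Filter ι} {D : ι → E →L[ℝ] F} {A : E →L[ℝ] F}
    (h : ∀ w, Tendsto (fun i ↦ D i w) l (𝓝 (A w))) : Tendsto D l (𝓝 A) := by
  let j : (E →L[ℝ] F) →ₗ[ℝ] (E → F) :=
    { toFun := fun L ↦ L, map_add' := fun _ _ ↦ rfl, map_smul' := fun _ _ ↦ rfl }
  have hj : IsClosedEmbedding j := LinearMap.isClosedEmbedding_of_injective
    (LinearMap.ker_eq_bot.2 DFunLike.coe_injective)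
  rw [hj.isInducing.tendsto_nhds_iff, tendsto_pi_nhds]
  exact h

theorem tendsto_clm_apply {E F ι : Type*} [NormedAddCommGroup E] [NormedSpace ℝ E]
    [NormedAddCommGroup F] [NormedSpace ℝ F] {l : Filter ι} {D : ι → E →L[ℝ] F} {A : E →L[ℝ] F}
    {u : ι → E} {v : E} (hD : Tendsto D l (𝓝 A)) (hu : Tendsto u l (𝓝 v)) :
    Tendsto (fun i ↦ D i (u i)) l (𝓝 (A v)) :=
  (isBoundedBilinearMap_apply.continuous.tendsto (A, v)).comp (hD.prodMk_nhds hu)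

namespace LorentzianMetric

variable {E : Type u} [NormedAddCommGroup E] [NormedSpace ℝ E] [FiniteDimensional ℝ E]
  {M : Type*} [TopologicalSpace M] [ChartedSpace E M] [IsManifold 𝓘(ℝ, E) ∞ M]
  {g : LorentzianMetric E M} {e e' : OpenPartialHomeomorph M E}

/-- The exponential map in a chart together with its inverse: nearby points are joined by a
geodesic, whose initial velocity depends smoothly on the points. -/
theorem exists_chart_logarithm (g : LorentzianMetric E M)
    (he : e ∈ IsManifold.maximalAtlas 𝓘(ℝ, E) ∞ M) {x₀ : E} (hx₀ : x₀ ∈ e.target) :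
    ∃ (Φ : E × E → ℝ → E × E) (Ω : Set (E × E)) (σ : E × E → E) (B : Set E),
      IsOpen Ω ∧ (x₀, 0) ∈ Ω ∧
      (∀ a ∈ Ω, Φ a 0 = a ∧ g.IsChartGeodesicOn e (Φ a) (Ioo (-2) 2)) ∧
      ContDiffOn ℝ ∞ (fun a ↦ (Φ a 1).1) Ω ∧ (Φ (x₀, 0) 1).1 = x₀ ∧
      HasFDerivAt (fun a ↦ (Φ a 1).1)
        (ContinuousLinearMap.fst ℝ E E + ContinuousLinearMap.snd ℝ E E) (x₀, 0) ∧
      IsOpen B ∧ x₀ ∈ B ∧ B ⊆ e.target ∧ ContDiffOn ℝ ∞ σ (B ×ˢ B) ∧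
      (∀ z ∈ B, ∀ y ∈ B, (z, σ (z, y)) ∈ Ω ∧ (Φ (z, σ (z, y)) 1).1 = y) ∧ σ (x₀, x₀) = 0 := by
  have := FiniteDimensional.complete ℝ E
  obtain ⟨Φ, Ω, hΩ, hx₀Ω, hΦ, hsm, h0, hd⟩ := g.exists_chart_exponential he hx₀
  -- The map `(z, v) ↦ (z, exp_z v)` has derivative `(a, b) ↦ (a, a + b)` at `(x₀, 0)`, hence is a
  -- local diffeomorphism there. The second component of its inverse is the logarithm.
  let Θ : E × E → E × E := fun a ↦ (a.1, (Φ a 1).1)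
  have hΘ : ContDiffOn ℝ ∞ Θ Ω := contDiffOn_fst.prodMk hsm
  let T : (E × E) ≃L[ℝ] (E × E) := ContinuousLinearEquiv.equivOfInverse
    ((ContinuousLinearMap.fst ℝ E E).prod
      (ContinuousLinearMap.fst ℝ E E + ContinuousLinearMap.snd ℝ E E))
    ((ContinuousLinearMap.fst ℝ E E).prod
      (ContinuousLinearMap.snd ℝ E E - ContinuousLinearMap.fst ℝ E E))
    (fun a ↦ by ext <;> simp) (fun a ↦ by ext <;> simp)
  have hT : HasFDerivAt Θ (T : E × E →L[ℝ] E × E) (x₀, 0) := hasFDerivAt_fst.prodMk hd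
  obtain ⟨h, hsrc, hsub, hcoe, hinv⟩ := exists_smooth_local_inverse hΩ hΘ hx₀Ω T hT
  have hval : h (x₀, 0) = (x₀, x₀) := by
    rw [hcoe]
    exact Prod.ext rfl h0
  have htgt : (x₀, x₀) ∈ h.target := hval ▸ h.map_source hsrc
  obtain ⟨B₁, B₂, hB₁, hx₁, hB₂, hx₂, hBsub⟩ :=
    mem_nhds_prod_iff'.1 (h.open_target.mem_nhds htgt)
  refine ⟨Φ, Ω, fun q ↦ (h.symm q).2, B₁ ∩ B₂ ∩ e.target, hΩ, hx₀Ω, hΦ, hsm, h0, hd,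
    (hB₁.inter hB₂).inter e.open_target, ⟨⟨hx₁, hx₂⟩, hx₀⟩, inter_subset_right, ?_, ?_, ?_⟩
  · refine (hinv.mono fun q hq ↦ hBsub ⟨hq.1.1.1, hq.2.1.2⟩).snd
  · intro z hz y hy
    have hq : (z, y) ∈ h.target := hBsub ⟨hz.1.1, hy.1.2⟩
    have h1 : Θ (h.symm (z, y)) = (z, y) := by rw [← hcoe]; exact h.right_inv hq
    have h2 : (z, (h.symm (z, y)).2) = h.symm (z, y) :=
      Prod.ext (congrArg Prod.fst h1).symm rfl
    rw [h2]
    exact ⟨hsub (h.map_target hq), congrArg Prod.snd h1⟩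
  · have h1 := h.left_inv hsrc
    rw [hval] at h1
    change (h.symm (x₀, x₀)).2 = 0
    rw [h1]

/-- An isometry is determined near a point by its first jet at a nearby point. -/
theorem eventually_chartMap_eq [T2Space M] (he : e ∈ IsManifold.maximalAtlas 𝓘(ℝ, E) ∞ M)
    (he' : e' ∈ IsManifold.maximalAtlas 𝓘(ℝ, E) ∞ M)
    {Φ Φ' : E × E → ℝ → E × E} {Ω Ω' : Set (E × E)}
    (hΦ : ∀ a ∈ Ω, Φ a 0 = a ∧ g.IsChartGeodesicOn e (Φ a) (Ioo (-2) 2))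
    (hΦ' : ∀ a ∈ Ω', Φ' a 0 = a ∧ g.IsChartGeodesicOn e' (Φ' a) (Ioo (-2) 2))
    (hΩ' : IsOpen Ω') {l : Filter g.isometryGroup} {z p x : E} {A : E →L[ℝ] E} {σ : E → E}
    (hdom : ∀ᶠ f : g.isometryGroup in l, z ∈ chartDomain e e' (f : M ≃ₜ M))
    (hp : Tendsto (fun f : g.isometryGroup ↦ chartMap e e' (f : M ≃ₜ M) z) l (𝓝 p))
    (hA : Tendsto (fun f : g.isometryGroup ↦ fderiv ℝ (chartMap e e' (f : M ≃ₜ M)) z) l (𝓝 A))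
    (hσ : ContinuousAt σ x) (hσΩ : ∀ᶠ y in 𝓝 x, (z, σ y) ∈ Ω ∧ (Φ (z, σ y) 1).1 = y)
    (hlim : (p, A (σ x)) ∈ Ω') :
    ∀ᶠ q in l ×ˢ 𝓝 x, q.2 ∈ chartDomain e e' (q.1 : M ≃ₜ M) ∧
      chartMap e e' (q.1 : M ≃ₜ M) q.2 = (Φ' (chartMap e e' (q.1 : M ≃ₜ M) z,
        fderiv ℝ (chartMap e e' (q.1 : M ≃ₜ M)) z (σ q.2)) 1).1 := by
  have h1 : Tendsto (fun q : g.isometryGroup × E ↦ (chartMap e e' (q.1 : M ≃ₜ M) z,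
      fderiv ℝ (chartMap e e' (q.1 : M ≃ₜ M)) z (σ q.2))) (l ×ˢ 𝓝 x) (𝓝 (p, A (σ x))) :=
    (hp.comp tendsto_fst).prodMk_nhds
      (tendsto_clm_apply (hA.comp tendsto_fst) (hσ.tendsto.comp tendsto_snd))
  filter_upwards [h1.eventually (hΩ'.mem_nhds hlim), tendsto_fst.eventually hdom,
    tendsto_snd.eventually hσΩ] with q hq1 hq2 hq3
  -- Writing the moving point as `exp_z (σ y)` turns `f ∘ exp = exp ∘ df` into the formula `f y =
  -- exp (df (σ y))`.
  have h2 := exponential_comm he he' q.1 hΦ hΦ' hq3.1 hq2 hq1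
  rw [hq3.2] at h2
  exact h2

/-- Isometries whose first jet at a point tends to the identity converge, with their first
derivatives, to the identity near this point. -/
theorem exists_coord_jet_tendsto_id [T2Space M] (g : LorentzianMetric E M)
    (he : e ∈ IsManifold.maximalAtlas 𝓘(ℝ, E) ∞ M) {x₀ : E} (hx₀ : x₀ ∈ e.target) :
    ∃ B : Set E, IsOpen B ∧ x₀ ∈ B ∧ B ⊆ e.target ∧
      ∀ (l : Filter g.isometryGroup), ∀ z ∈ B,
      (∀ᶠ f : g.isometryGroup in l, z ∈ chartDomain e e (f : M ≃ₜ M)) →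
      Tendsto (fun f : g.isometryGroup ↦ chartMap e e (f : M ≃ₜ M) z) l (𝓝 z) →
      Tendsto (fun f : g.isometryGroup ↦ fderiv ℝ (chartMap e e (f : M ≃ₜ M)) z) l
        (𝓝 (ContinuousLinearMap.id ℝ E)) →
      ∀ x ∈ B, ∀ w, (∀ᶠ q in l ×ˢ 𝓝 (x, w), q.2.1 ∈ chartDomain e e (q.1 : M ≃ₜ M)) ∧
        Tendsto (fun q : g.isometryGroup × (E × E) ↦
          _root_.coordTangentMap (chartMap e e (q.1 : M ≃ₜ M)) q.2)
          (l ×ˢ 𝓝 (x, w)) (𝓝 (x, w)) := by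
  obtain ⟨Φ, Ω, σ, B, hΩ, hx₀Ω, hΦ, hsm, -, -, hB, hxB, hBe, hσ, hσΦ, -⟩ :=
    g.exists_chart_logarithm he hx₀
  refine ⟨B, hB, hxB, hBe, fun l z hz hdom hp hA x hx w ↦ ?_⟩
  have hσz : ContDiffOn ℝ ∞ (fun y ↦ σ (z, y)) B :=
    hσ.comp (contDiffOn_const.prodMk contDiffOn_id) fun y hy ↦ ⟨hz, hy⟩
  have hev := eventually_chartMap_eq he he hΦ hΦ hΩ (l := l) hdom hp hA
    (hσz.continuousOn.continuousAt (hB.mem_nhds hx))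
    (by filter_upwards [hB.mem_nhds hx] with y hy using hσΦ z hz y hy)
    (hσΦ z hz x hx).1
  let X : E × E → E := fun a ↦ (Φ a 1).1
  -- `K (p, A, y) = exp_p (A (log_z y))` is smooth in all its arguments. It equals the isometry `f`
  -- near `x` when `(p, A)` is the first jet of `f` at `z`, and the identity when `(p, A) = (z,
  -- id)`. Convergence of the jets at `z` therefore gives convergence of values and derivatives near
  -- `x`.
  let K : E × (E →L[ℝ] E) × E → E := fun r ↦ X (r.1, r.2.1 (σ (z, r.2.2)))
  let r₀ : E × (E →L[ℝ] E) × E := (z, ContinuousLinearMap.id ℝ E, x)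
  have hK : ContDiffAt ℝ ∞ K r₀ := by
    have h2 : ContDiffAt ℝ ∞ (fun r : E × (E →L[ℝ] E) × E ↦ σ (z, r.2.2)) r₀ :=
      ContDiffAt.comp (g := fun y ↦ σ (z, y)) (f := fun r : E × (E →L[ℝ] E) × E ↦ r.2.2) r₀
        (hσz.contDiffAt (hB.mem_nhds hx)) contDiffAt_snd.snd
    have h1 : ContDiffAt ℝ ∞ (fun r : E × (E →L[ℝ] E) × E ↦ (r.1, r.2.1 (σ (z, r.2.2)))) r₀ :=
      contDiffAt_fst.prodMk (contDiffAt_snd.fst.clm_apply h2)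
    exact ContDiffAt.comp (g := X) r₀ (hsm.contDiffAt (hΩ.mem_nhds (hσΦ z hz x hx).1)) h1
  have hK1 : ∀ᶠ r in 𝓝 r₀, DifferentiableAt ℝ K r :=
    ((hK.of_le (m := 1) (by simp)).eventually (by simp)).mono fun r hr ↦
      hr.differentiableAt one_ne_zero
  have hpart : ∀ r : E × (E →L[ℝ] E) × E, DifferentiableAt ℝ K r → ∀ v,
      fderiv ℝ (fun y ↦ K (r.1, r.2.1, y)) r.2.2 v = fderiv ℝ K r (0, 0, v) := by
    intro r hr v
    have h1 : HasFDerivAt (fun y ↦ (r.1, r.2.1, y)) ((0 : E →L[ℝ] E).prod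
        ((0 : E →L[ℝ] (E →L[ℝ] E)).prod (ContinuousLinearMap.id ℝ E))) r.2.2 :=
      (hasFDerivAt_const _ _).prodMk ((hasFDerivAt_const _ _).prodMk (hasFDerivAt_id _))
    have h2 := HasFDerivAt.comp (g := K) r.2.2 hr.hasFDerivAt h1
    exact congrArg (fun L : E →L[ℝ] E ↦ L v) h2.fderiv
  have hK0 : ∀ᶠ y in 𝓝 x, K (z, ContinuousLinearMap.id ℝ E, y) = y := by
    filter_upwards [hB.mem_nhds hx] with y hy using (hσΦ z hz y hy).2
  have hKd : fderiv ℝ K r₀ (0, 0, w) = w := by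
    rw [← hpart r₀ hK1.self_of_nhds]
    have h1 : (fun y ↦ K (z, ContinuousLinearMap.id ℝ E, y)) =ᶠ[𝓝 x] id := hK0
    change fderiv ℝ (fun y ↦ K (z, ContinuousLinearMap.id ℝ E, y)) x w = w
    rw [h1.fderiv_eq, fderiv_id]
    rfl
  rw [eventually_prod_iff] at hev
  obtain ⟨P, hP, Q, hQ, hPQ⟩ := hev
  have hfst : Tendsto (fun q : g.isometryGroup × (E × E) ↦ q.2.1) (l ×ˢ 𝓝 (x, w)) (𝓝 x) :=
    (continuous_fst.tendsto (x, w)).comp tendsto_snd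
  have hsnd : Tendsto (fun q : g.isometryGroup × (E × E) ↦ q.2.2) (l ×ˢ 𝓝 (x, w)) (𝓝 w) :=
    (continuous_snd.tendsto (x, w)).comp tendsto_snd
  have hr : Tendsto (fun q : g.isometryGroup × (E × E) ↦ (chartMap e e (q.1 : M ≃ₜ M) z,
      fderiv ℝ (chartMap e e (q.1 : M ≃ₜ M)) z, q.2.1)) (l ×ˢ 𝓝 (x, w)) (𝓝 r₀) :=
    (hp.comp tendsto_fst).prodMk_nhds ((hA.comp tendsto_fst).prodMk_nhds hfst)
  refine ⟨?_, ?_⟩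
  · filter_upwards [tendsto_fst.eventually hP, hfst.eventually hQ] with q h1 h2
    exact (hPQ h1 h2).1
  · have hlim : Tendsto (fun q : g.isometryGroup × (E × E) ↦
        (K (chartMap e e (q.1 : M ≃ₜ M) z, fderiv ℝ (chartMap e e (q.1 : M ≃ₜ M)) z, q.2.1),
          fderiv ℝ K (chartMap e e (q.1 : M ≃ₜ M) z,
            fderiv ℝ (chartMap e e (q.1 : M ≃ₜ M)) z, q.2.1) (0, 0, q.2.2)))
        (l ×ˢ 𝓝 (x, w)) (𝓝 (x, w)) := by
      have h1 := (hK.continuousAt.tendsto.comp hr)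
      have h2 : ContinuousAt (fderiv ℝ K) r₀ := (hK.fderiv_right (m := 0) (by simp)).continuousAt
      have h3 := tendsto_clm_apply (h2.tendsto.comp hr)
        ((tendsto_const_nhds (x := (0 : E))).prodMk_nhds
          ((tendsto_const_nhds (x := (0 : E →L[ℝ] E))).prodMk_nhds hsnd))
      rw [hKd] at h3
      rw [show K r₀ = x from hK0.self_of_nhds] at h1
      exact h1.prodMk_nhds h3
    refine hlim.congr' ?_
    filter_upwards [tendsto_fst.eventually hP, hfst.eventually hQ.eventually_nhds,
      hr.eventually hK1] with q h1 h2 h3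
    have h4 : chartMap e e (q.1 : M ≃ₜ M) =ᶠ[𝓝 q.2.1] fun y ↦ K (chartMap e e (q.1 : M ≃ₜ M) z,
        fderiv ℝ (chartMap e e (q.1 : M ≃ₜ M)) z, y) :=
      h2.mono fun y hy ↦ (hPQ h1 hy).2
    refine Prod.ext h4.eq_of_nhds.symm ?_
    change _ = fderiv ℝ (chartMap e e (q.1 : M ≃ₜ M)) q.2.1 q.2.2
    rw [h4.fderiv_eq]
    exact (hpart _ h3 _).symm

end LorentzianMetric

/-! ### Limits of families of isometries -/

/-- A family of homeomorphisms of a locally compact space, convergent in the sense of Cauchy,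
converges along an ultrafilter, locally uniformly. -/
theorem exists_limit_of_cauchy {ι X : Type*} [TopologicalSpace X] [LocallyCompactSpace X]
    (l : Ultrafilter ι) (T S : ι → X → X) (hT : ∀ i, Continuous (T i))
    (hST : ∀ i x, S i (T i x) = x) (hTS : ∀ i x, T i (S i x) = x)
    (h1 : ∀ x, Tendsto (fun q : (ι × ι) × X ↦ S q.1.1 (T q.1.2 q.2))
      (((l : Filter ι) ×ˢ (l : Filter ι)) ×ˢ 𝓝 x) (𝓝 x))
    (h2 : ∀ x, Tendsto (fun q : (ι × ι) × X ↦ T q.1.1 (S q.1.2 q.2))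
      (((l : Filter ι) ×ˢ (l : Filter ι)) ×ˢ 𝓝 x) (𝓝 x)) (x : X) :
    ∃ y, Tendsto (fun q : ι × X ↦ T q.1 q.2) ((l : Filter ι) ×ˢ 𝓝 x) (𝓝 y) := by
  obtain ⟨K, hK, hKx⟩ := exists_compact_mem_nhds x
  have h3 : Tendsto (fun q : ι × ι ↦ S q.1 (T q.2 x)) ((l : Filter ι) ×ˢ (l : Filter ι)) (𝓝 x) :=
    (h1 x).comp (tendsto_id.prodMk (tendsto_const_pure.mono_right (pure_le_nhds x)))
  obtain ⟨m, hm⟩ := ((h3.eventually hKx).curry).exists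
  -- For one fixed late index `m`, the point `S m (T n x)` stays in the compact set `K`. Hence `T n
  -- x` stays in the compact set `T m '' K`, where the ultrafilter has a limit.
  have h4 : ∀ᶠ n in (l : Filter ι), T n x ∈ T m '' K :=
    hm.mono fun n hn ↦ ⟨S m (T n x), hn, hTS m _⟩
  obtain ⟨y, -, hy⟩ := (hK.image (hT m)).ultrafilter_le_nhds (l.map fun n ↦ T n x)
    (le_principal_iff.2 h4)
  have hy' : Tendsto (fun n ↦ T n x) l (𝓝 y) := hy
  refine ⟨y, fun W hW ↦ ?_⟩
  obtain ⟨P, hP, Q, hQ, hPQ⟩ := eventually_prod_iff.1 ((h2 y).eventually hW)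
  -- With `n` fixed, `T m x' = T m (S n (T n x'))`, where `T n x'` is near `y` for `x'` near `x`.
  -- The second Cauchy condition at `y` then makes the convergence locally uniform.
  have hP' : ∀ᶠ n in (l : Filter ι), ∀ᶠ m in (l : Filter ι), P (m, n) :=
    (eventually_swap_iff.1 hP).curry
  obtain ⟨n, hn, hnQ⟩ := (hP'.and (hy'.eventually hQ.eventually_nhds)).exists
  have h5 : ∀ᶠ x' in 𝓝 x, Q (T n x') := (hT n).continuousAt.eventually hnQ
  change ∀ᶠ q : ι × X in (l : Filter ι) ×ˢ 𝓝 x, T q.1 q.2 ∈ W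
  filter_upwards [tendsto_fst.eventually hn, tendsto_snd.eventually h5] with q h6 h7
  have h8 := hPQ h6 h7
  simp only [hST] at h8
  exact h8

section TangentLimits

variable {E : Type u} [NormedAddCommGroup E] [NormedSpace ℝ E] [FiniteDimensional ℝ E]
  {M : Type*} [TopologicalSpace M] [ChartedSpace E M] [IsManifold 𝓘(ℝ, E) ∞ M]
  {g : LorentzianMetric E M} {e e' : OpenPartialHomeomorph M E}

namespace LorentzianMetric

/-- Convergence in the tangent bundle from convergence in a chart. -/
theorem tendsto_tangentMap_of_chart (he : e ∈ IsManifold.maximalAtlas 𝓘(ℝ, E) ∞ M)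
    {l : Filter g.isometryGroup} {ξ : TangentBundle 𝓘(ℝ, E) M} (hξ : ξ.1 ∈ e.source)
    (hdom : ∀ᶠ q in l ×ˢ 𝓝 (chartCoord e ξ), q.2.1 ∈ chartDomain e e (q.1 : M ≃ₜ M))
    (hlim : Tendsto (fun q : g.isometryGroup × (E × E) ↦
      _root_.coordTangentMap (chartMap e e (q.1 : M ≃ₜ M)) q.2)
      (l ×ˢ 𝓝 (chartCoord e ξ)) (𝓝 (chartCoord e ξ))) :
    Tendsto (fun q : g.isometryGroup × TangentBundle 𝓘(ℝ, E) M ↦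
      tangentMap 𝓘(ℝ, E) 𝓘(ℝ, E) (q.1 : M ≃ₜ M) q.2) (l ×ˢ 𝓝 ξ) (𝓝 ξ) := by
  have hsrc : {ξ : TangentBundle 𝓘(ℝ, E) M | ξ.1 ∈ e.source} ∈ 𝓝 ξ :=
    (FiberBundle.continuous_proj E (TangentSpace 𝓘(ℝ, E))).continuousAt.preimage_mem_nhds
      (e.open_source.mem_nhds hξ)
  have h1 : Tendsto (fun q : g.isometryGroup × TangentBundle 𝓘(ℝ, E) M ↦ (q.1, chartCoord e q.2))
      (l ×ˢ 𝓝 ξ) (l ×ˢ 𝓝 (chartCoord e ξ)) :=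
    tendsto_id.prodMap ((continuousOn_chartCoord he).continuousAt hsrc).tendsto
  have h2 : Tendsto (chartVector e) (𝓝 (chartCoord e ξ)) (𝓝 ξ) := by
    have h3 : ContinuousAt (chartVector e) (chartCoord e ξ) :=
      (continuousOn_chartVector he).continuousAt ((e.open_target.prod isOpen_univ).mem_nhds
        ⟨e.map_source hξ, mem_univ _⟩)
    have h4 := h3.tendsto
    rwa [chartVector_chartCoord he hξ] at h4
  refine ((h2.comp hlim).comp h1).congr' ?_
  filter_upwards [h1.eventually hdom, tendsto_snd.eventually hsrc] with q hq hq'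
  have h5 := chartVector_coordTangentMap he he q.1.2.1 hq
  rw [chartVector_chartCoord he hq'] at h5
  exact h5

/-- Convergence in charts from convergence in the tangent bundle. -/
theorem tendsto_chart_of_tangentMap (he : e ∈ IsManifold.maximalAtlas 𝓘(ℝ, E) ∞ M)
    (he' : e' ∈ IsManifold.maximalAtlas 𝓘(ℝ, E) ∞ M)
    {l : Filter g.isometryGroup} {z w : E} (hz : z ∈ e.target) {η : TangentBundle 𝓘(ℝ, E) M}
    (hη : η.1 ∈ e'.source) (h : Tendsto (fun f : g.isometryGroup ↦
      tangentMap 𝓘(ℝ, E) 𝓘(ℝ, E) (f : M ≃ₜ M) (chartVector e (z, w))) l (𝓝 η)) :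
    (∀ᶠ f : g.isometryGroup in l, z ∈ chartDomain e e' (f : M ≃ₜ M)) ∧
    Tendsto (fun f : g.isometryGroup ↦
      _root_.coordTangentMap (chartMap e e' (f : M ≃ₜ M)) (z, w)) l (𝓝 (chartCoord e' η)) := by
  have hsrc : {ξ : TangentBundle 𝓘(ℝ, E) M | ξ.1 ∈ e'.source} ∈ 𝓝 η :=
    (FiberBundle.continuous_proj E (TangentSpace 𝓘(ℝ, E))).continuousAt.preimage_mem_nhds
      (e'.open_source.mem_nhds hη)
  have h1 : ∀ᶠ f : g.isometryGroup in l, z ∈ chartDomain e e' (f : M ≃ₜ M) :=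
    (h.eventually hsrc).mono fun f hf ↦ ⟨hz, hf⟩
  refine ⟨h1, ?_⟩
  refine (((continuousOn_chartCoord he').continuousAt hsrc).tendsto.comp h).congr' ?_
  filter_upwards [h1] with f hf
  exact (coordTangentMap_chartMap he he' f.2.1 (q := (z, w)) hf).symm

/-- Isometries of a connected manifold whose first jet at a point tends to the identity converge
everywhere to the identity, with their derivatives. -/
theorem tendsto_tangentMap_id [T2Space M] [ConnectedSpace M]
    (he : e ∈ IsManifold.maximalAtlas 𝓘(ℝ, E) ∞ M) {l : Filter g.isometryGroup}
    {z : E} (hz : z ∈ e.target)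
    (hdom : ∀ᶠ f : g.isometryGroup in l, z ∈ chartDomain e e (f : M ≃ₜ M))
    (hp : Tendsto (fun f : g.isometryGroup ↦ chartMap e e (f : M ≃ₜ M) z) l (𝓝 z))
    (hA : Tendsto (fun f : g.isometryGroup ↦ fderiv ℝ (chartMap e e (f : M ≃ₜ M)) z) l
      (𝓝 (ContinuousLinearMap.id ℝ E))) (ξ : TangentBundle 𝓘(ℝ, E) M) :
    Tendsto (fun q : g.isometryGroup × TangentBundle 𝓘(ℝ, E) M ↦
      tangentMap 𝓘(ℝ, E) 𝓘(ℝ, E) (q.1 : M ≃ₜ M) q.2) (l ×ˢ 𝓝 ξ) (𝓝 ξ) := by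
  let Good : Set M := {x | ∀ ξ : TangentBundle 𝓘(ℝ, E) M, ξ.1 = x →
    Tendsto (fun q : g.isometryGroup × TangentBundle 𝓘(ℝ, E) M ↦
      tangentMap 𝓘(ℝ, E) 𝓘(ℝ, E) (q.1 : M ≃ₜ M) q.2) (l ×ˢ 𝓝 ξ) (𝓝 ξ)}
  have hstep : ∀ {e : OpenPartialHomeomorph M E}, e ∈ IsManifold.maximalAtlas 𝓘(ℝ, E) ∞ M →
      ∀ x₀ ∈ e.source, ∃ B : Set E, IsOpen B ∧ e x₀ ∈ B ∧ ∀ z ∈ B,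
      (∀ᶠ f : g.isometryGroup in l, z ∈ chartDomain e e (f : M ≃ₜ M)) →
      Tendsto (fun f : g.isometryGroup ↦ chartMap e e (f : M ≃ₜ M) z) l (𝓝 z) →
      Tendsto (fun f : g.isometryGroup ↦ fderiv ℝ (chartMap e e (f : M ≃ₜ M)) z) l
        (𝓝 (ContinuousLinearMap.id ℝ E)) → ∀ x ∈ e.source, e x ∈ B → x ∈ Good := by
    intro e he x₀ hx₀
    obtain ⟨B, hB, hxB, -, h⟩ := g.exists_coord_jet_tendsto_id he (e.map_source hx₀)
    refine ⟨B, hB, hxB, fun z hz h1 h2 h3 x hx hxB ξ hξ ↦ ?_⟩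
    subst hξ
    have h4 := h l z hz h1 h2 h3 (e ξ.1) hxB (chartCoord e ξ).2
    exact tendsto_tangentMap_of_chart he hx h4.1 h4.2
  -- One good point of `V` makes all of `V` good. This symmetric statement yields both openness and
  -- closedness of `Good`.
  have hnhds : ∀ x₀ : M, ∃ V ∈ 𝓝 x₀, ∀ z ∈ V, z ∈ Good → V ⊆ Good := by
    intro x₀
    have he₀ : chartAt E x₀ ∈ IsManifold.maximalAtlas 𝓘(ℝ, E) ∞ M :=
      IsManifold.chart_mem_maximalAtlas x₀
    set e₀ := chartAt E x₀
    obtain ⟨B, hB, hxB, h⟩ := hstep he₀ x₀ (mem_chart_source E x₀)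
    refine ⟨e₀.source ∩ e₀ ⁻¹' B, (e₀.isOpen_inter_preimage hB).mem_nhds
      ⟨mem_chart_source E x₀, hxB⟩, fun z hz hgood x hx ↦ ?_⟩
    have h1 : ∀ w, (∀ᶠ f : g.isometryGroup in l, e₀ z ∈ chartDomain e₀ e₀ (f : M ≃ₜ M)) ∧
        Tendsto (fun f : g.isometryGroup ↦
          _root_.coordTangentMap (chartMap e₀ e₀ (f : M ≃ₜ M)) (e₀ z, w)) l (𝓝 (e₀ z, w)) := by
      intro w
      have hbase : (chartVector e₀ (e₀ z, w)).1 = z := e₀.left_inv hz.1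
      have h2 := (hgood _ hbase).comp
        (tendsto_id.prodMk (tendsto_const_pure.mono_right (pure_le_nhds _)))
      have h3 := tendsto_chart_of_tangentMap he₀ he₀ (e₀.map_source hz.1)
        (by rw [hbase]; exact hz.1) h2
      rwa [chartCoord_chartVector he₀ (e₀.map_source hz.1)] at h3
    refine h (e₀ z) hz.2 (h1 0).1 ((continuous_fst.tendsto _).comp (h1 0).2)
      (tendsto_clm_of_forall_tendsto fun w ↦ (continuous_snd.tendsto _).comp (h1 w).2)
      x hx.1 hx.2
  have hopen : IsOpen Good := isOpen_iff_mem_nhds.2 fun x hx ↦ by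
    obtain ⟨V, hV, h⟩ := hnhds x
    exact mem_of_superset hV (h x (mem_of_mem_nhds hV) hx)
  have hclosed : IsClosed Good := isOpen_compl_iff.1 (isOpen_iff_mem_nhds.2 fun x hx ↦ by
    obtain ⟨V, hV, h⟩ := hnhds x
    exact mem_of_superset hV fun z hz hzG ↦ hx (h z hz hzG (mem_of_mem_nhds hV)))
  have hne : Good.Nonempty := by
    obtain ⟨B, hB, hxB, h⟩ := hstep he (e.symm z) (e.map_target hz)
    rw [e.right_inv hz] at hxB
    refine ⟨e.symm z, h z hxB hdom hp hA _ (e.map_target hz) ?_⟩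
    rwa [e.right_inv hz]
  have huniv := IsClopen.eq_univ ⟨hclosed, hopen⟩ hne
  exact (huniv ▸ mem_univ ξ.1 : ξ.1 ∈ Good) ξ rfl

/-- A pointwise limit of isometries, together with their tangent maps, is smooth and preserves the
metric. -/
theorem contMDiff_of_tendsto_tangentMap [T2Space M] {l : Filter g.isometryGroup} [l.NeBot]
    {F : TangentBundle 𝓘(ℝ, E) M → TangentBundle 𝓘(ℝ, E) M} {f : M → M}
    (hf : ∀ ξ, (F ξ).1 = f ξ.1)
    (hF : ∀ ξ, Tendsto (fun h : g.isometryGroup ↦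
      tangentMap 𝓘(ℝ, E) 𝓘(ℝ, E) (h : M ≃ₜ M) ξ) l (𝓝 (F ξ))) :
    ContMDiff 𝓘(ℝ, E) 𝓘(ℝ, E) ∞ f ∧ ∀ (x : M) (v w : TangentSpace 𝓘(ℝ, E) x),
      g.inner (f x) (mfderiv 𝓘(ℝ, E) 𝓘(ℝ, E) f x v) (mfderiv 𝓘(ℝ, E) 𝓘(ℝ, E) f x w)
        = g.inner x v w := by
  -- Passing to the limit in `h = exp ∘ dh ∘ log` shows that near `x₀` the limit map is `exp ∘ A ∘
  -- log`, with `A` the limit of the derivatives at `x₀`. It is thus smooth with derivative `A`, and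
  -- the metric relation passes to the limit.
  have key : ∀ x₀ : M, ∃ A : E →L[ℝ] E, let e := chartAt E x₀; let e' := chartAt E (f x₀)
      ContDiffAt ℝ ∞ (chartMap e e' f) (e x₀) ∧ (∀ᶠ y in 𝓝 (e x₀), y ∈ chartDomain e e' f) ∧
      fderiv ℝ (chartMap e e' f) (e x₀) = A ∧ ∀ v w, g.chartMetric e' (e' (f x₀)) (A v) (A w)
        = g.chartMetric e (e x₀) v w := by
    intro x₀
    have he : chartAt E x₀ ∈ IsManifold.maximalAtlas 𝓘(ℝ, E) ∞ M :=
      IsManifold.chart_mem_maximalAtlas x₀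
    have he' : chartAt E (f x₀) ∈ IsManifold.maximalAtlas 𝓘(ℝ, E) ∞ M :=
      IsManifold.chart_mem_maximalAtlas (f x₀)
    set e := chartAt E x₀
    set e' := chartAt E (f x₀)
    have hx₀ : x₀ ∈ e.source := mem_chart_source E x₀
    have hfx₀ : f x₀ ∈ e'.source := mem_chart_source E (f x₀)
    have hz := e.map_source hx₀
    have hleft : ∀ w, (chartVector e (e x₀, w)).1 = x₀ := fun w ↦ e.left_inv hx₀
    have h1 : ∀ w, (∀ᶠ h : g.isometryGroup in l, e x₀ ∈ chartDomain e e' (h : M ≃ₜ M)) ∧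
        Tendsto (fun h : g.isometryGroup ↦
          _root_.coordTangentMap (chartMap e e' (h : M ≃ₜ M)) (e x₀, w)) l
          (𝓝 (chartCoord e' (F (chartVector e (e x₀, w))))) := fun w ↦
      tendsto_chart_of_tangentMap he he' hz (by rw [hf, hleft]; exact hfx₀) (hF _)
    have hD : ∀ w, Tendsto (fun h : g.isometryGroup ↦
        fderiv ℝ (chartMap e e' (h : M ≃ₜ M)) (e x₀) w) l
          (𝓝 (chartCoord e' (F (chartVector e (e x₀, w)))).2) := fun w ↦
      (continuous_snd.tendsto _).comp (h1 w).2
    let A₀ : E →ₗ[ℝ] E := linearMapOfTendsto (l := l)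
      (fun w ↦ (chartCoord e' (F (chartVector e (e x₀, w)))).2)
      (fun h : g.isometryGroup ↦ (fderiv ℝ (chartMap e e' (h : M ≃ₜ M)) (e x₀)).toLinearMap)
      (tendsto_pi_nhds.2 hD)
    let A : E →L[ℝ] E := A₀.toContinuousLinearMap
    have hA : Tendsto (fun h : g.isometryGroup ↦
        fderiv ℝ (chartMap e e' (h : M ≃ₜ M)) (e x₀)) l (𝓝 A) := tendsto_clm_of_forall_tendsto hD
    have hp : Tendsto (fun h : g.isometryGroup ↦ chartMap e e' (h : M ≃ₜ M) (e x₀)) l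
        (𝓝 (e' (f x₀))) := by
      have h2 := (continuous_fst.tendsto _).comp (h1 0).2
      rwa [chartCoord_fst, hf, hleft] at h2
    have hbase : ∀ y ∈ e.target, (∀ᶠ h : g.isometryGroup in l,
        y ∈ chartDomain e e' (h : M ≃ₜ M)) → Tendsto (fun h : g.isometryGroup ↦
        (h : M ≃ₜ M) (e.symm y)) l (𝓝 (f (e.symm y))) := by
      intro y _ _
      have h2 := ((FiberBundle.continuous_proj E (TangentSpace 𝓘(ℝ, E))).tendsto _).comp
        (hF (chartVector e (y, 0)))
      rw [hf] at h2
      exact h2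
    obtain ⟨Φ, Ω, σ, B, hΩ, hzΩ, hΦ, hsm, hX0, hX, hB, hzB, hBe, hσ, hσΦ, hσ0⟩ :=
      g.exists_chart_logarithm he hz
    obtain ⟨Φ', Ω', hΩ', hpΩ', hΦ', hsm', hX0', hX'⟩ :=
      g.exists_chart_exponential he' (e'.map_source hfx₀)
    have hσz : ContDiffAt ℝ ∞ (fun y ↦ σ (e x₀, y)) (e x₀) :=
      (hσ.comp (contDiffOn_const.prodMk contDiffOn_id) fun y hy ↦ ⟨hzB, hy⟩).contDiffAt
        (hB.mem_nhds hzB)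
    have hev := eventually_chartMap_eq he he' hΦ hΦ' hΩ' (l := l) (h1 0).1 hp hA
      hσz.continuousAt (by filter_upwards [hB.mem_nhds hzB] with y hy using hσΦ _ hzB y hy)
      (by rw [hσ0, map_zero]; exact hpΩ')
    let X' : E × E → E := fun a ↦ (Φ' a 1).1
    have hlim : ∀ᶠ y in 𝓝 (e x₀), y ∈ chartDomain e e' f ∧
        chartMap e e' f y = X' (e' (f x₀), A (σ (e x₀, y))) := by
      obtain ⟨P, hP, Q, hQ, hPQ⟩ := eventually_prod_iff.1 hev
      have hcont : ContinuousAt (fun y ↦ (e' (f x₀), A (σ (e x₀, y)))) (e x₀) :=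
        continuousAt_const.prodMk (A.continuous.continuousAt.comp hσz.continuousAt)
      filter_upwards [hQ, e.open_target.mem_nhds hz, hcont.preimage_mem_nhds (hΩ'.mem_nhds
        (by rw [hσ0, map_zero]; exact hpΩ'))] with y hy hye hyΩ
      have h2 : ∀ᶠ h : g.isometryGroup in l, y ∈ chartDomain e e' (h : M ≃ₜ M) ∧
          chartMap e e' (h : M ≃ₜ M) y = X' (chartMap e e' (h : M ≃ₜ M) (e x₀),
            fderiv ℝ (chartMap e e' (h : M ≃ₜ M)) (e x₀) (σ (e x₀, y))) :=
        hP.mono fun h hh ↦ hPQ hh hy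
      have h3 := hbase y hye (h2.mono fun h hh ↦ hh.1)
      have h4 : Tendsto (fun h : g.isometryGroup ↦ X' (chartMap e e' (h : M ≃ₜ M) (e x₀),
          fderiv ℝ (chartMap e e' (h : M ≃ₜ M)) (e x₀) (σ (e x₀, y)))) l
          (𝓝 (X' (e' (f x₀), A (σ (e x₀, y))))) :=
        ((hsm'.continuousOn.continuousAt (hΩ'.mem_nhds hyΩ)).tendsto).comp
          (hp.prodMk_nhds (tendsto_clm_apply hA tendsto_const_nhds))
      have h5 : X' (e' (f x₀), A (σ (e x₀, y))) ∈ e'.target :=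
        ((hΦ' _ hyΩ).2 1 (by norm_num)).1
      have h6 : f (e.symm y) = e'.symm (X' (e' (f x₀), A (σ (e x₀, y)))) := by
        refine tendsto_nhds_unique h3 ?_
        refine ((e'.continuousAt_symm h5).tendsto.comp h4).congr' ?_
        filter_upwards [h2] with h hh
        simp only [Function.comp_apply]
        rw [← hh.2]
        exact symm_chartMap hh.1
      refine ⟨⟨hye, ?_⟩, ?_⟩
      · change f (e.symm y) ∈ e'.source
        rw [h6]
        exact e'.map_target h5
      · change e' (f (e.symm y)) = _
        rw [h6, e'.right_inv h5]
    have hsmX' : ContDiffAt ℝ ∞ X' (e' (f x₀), A (σ (e x₀, e x₀))) := by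
      rw [hσ0, map_zero]
      exact hsm'.contDiffAt (hΩ'.mem_nhds hpΩ')
    have heq : chartMap e e' f =ᶠ[𝓝 (e x₀)] fun y ↦ X' (e' (f x₀), A (σ (e x₀, y))) :=
      hlim.mono fun y hy ↦ hy.2
    refine ⟨A, ?_, hlim.mono fun y hy ↦ hy.1, ?_, ?_⟩
    · exact (ContDiffAt.comp (g := X') (e x₀) hsmX' (contDiffAt_const.prodMk
        (A.contDiff.contDiffAt.comp _ hσz))).congr_of_eventuallyEq heq
    -- The logarithm based at `x₀` has derivative the identity at that point: differentiate `exp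
    -- (log y) = y`, using that `exp` has velocity derivative the identity.
    · have h2 : HasFDerivAt (fun y ↦ σ (e x₀, y)) (ContinuousLinearMap.id ℝ E) (e x₀) := by
        have h3 : HasFDerivAt (fun y ↦ σ (e x₀, y)) (fderiv ℝ (fun y ↦ σ (e x₀, y)) (e x₀))
            (e x₀) := (hσz.differentiableAt (by simp)).hasFDerivAt
        rw [← hσ0] at hX
        have h4 := HasFDerivAt.comp (g := fun a ↦ (Φ a 1).1)
          (f := fun y ↦ (e x₀, σ (e x₀, y))) (e x₀) hX
          ((hasFDerivAt_const (e x₀) (e x₀)).prodMk h3)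
        have h5 : HasFDerivAt ((fun a ↦ (Φ a 1).1) ∘ fun y ↦ (e x₀, σ (e x₀, y)))
            (ContinuousLinearMap.id ℝ E) (e x₀) := (hasFDerivAt_id _).congr_of_eventuallyEq (by
          filter_upwards [hB.mem_nhds hzB] with y hy using (hσΦ _ hzB y hy).2)
        have h6 := h4.unique h5
        have h7 : fderiv ℝ (fun y ↦ σ (e x₀, y)) (e x₀) = ContinuousLinearMap.id ℝ E := by
          rw [← h6]
          ext v
          simp
        rwa [h7] at h3
      rw [← map_zero A, ← hσ0] at hX'
      have h3 := HasFDerivAt.comp (g := X') (f := fun y ↦ (e' (f x₀), A (σ (e x₀, y))))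
        (e x₀) hX' ((hasFDerivAt_const (e' (f x₀)) (e x₀)).prodMk (A.hasFDerivAt.comp (e x₀) h2))
      rw [heq.fderiv_eq]
      refine h3.fderiv.trans ?_
      ext v
      simp
    · intro v w
      have hG' := g.isMetricOn_chartMetric he'
      have h2 : Tendsto (fun h : g.isometryGroup ↦ g.chartMetric e'
          (chartMap e e' (h : M ≃ₜ M) (e x₀))
          (fderiv ℝ (chartMap e e' (h : M ≃ₜ M)) (e x₀) v)
          (fderiv ℝ (chartMap e e' (h : M ≃ₜ M)) (e x₀) w)) l
          (𝓝 (g.chartMetric e' (e' (f x₀)) (A v) (A w))) :=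
        tendsto_clm_apply (tendsto_clm_apply
          ((hG'.contDiffOn.continuousOn.continuousAt
            (hG'.isOpen.mem_nhds (e'.map_source hfx₀))).tendsto.comp hp)
          (tendsto_clm_apply hA tendsto_const_nhds)) (tendsto_clm_apply hA tendsto_const_nhds)
      refine tendsto_nhds_unique h2 (tendsto_const_nhds.congr' ?_)
      filter_upwards [(h1 0).1] with h hh
      exact ((g.isIsometryOn_chartMap he he' h).preserve _ hh v w).symm
  have hcont : ContMDiff 𝓘(ℝ, E) 𝓘(ℝ, E) ∞ f := by
    intro x₀
    obtain ⟨A, h1, h2, -, -⟩ := key x₀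
    have he : chartAt E x₀ ∈ IsManifold.maximalAtlas 𝓘(ℝ, E) ∞ M :=
      IsManifold.chart_mem_maximalAtlas x₀
    have he' : chartAt E (f x₀) ∈ IsManifold.maximalAtlas 𝓘(ℝ, E) ∞ M :=
      IsManifold.chart_mem_maximalAtlas (f x₀)
    set e := chartAt E x₀
    set e' := chartAt E (f x₀)
    have hx₀ : x₀ ∈ e.source := mem_chart_source E x₀
    have h3 : ContMDiffAt 𝓘(ℝ, E) 𝓘(ℝ, E) ∞ (e'.symm ∘ chartMap e e' f ∘ e) x₀ :=
      (contMDiffAt_symm_of_mem_maximalAtlas he' (e'.map_source h2.self_of_nhds.2)).comp x₀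
        (h1.contMDiffAt.comp x₀ (contMDiffAt_of_mem_maximalAtlas he hx₀))
    refine h3.congr_of_eventuallyEq ?_
    filter_upwards [e.open_source.mem_nhds hx₀, (e.continuousAt hx₀).eventually h2] with x hx hxd
    have h4 := symm_chartMap hxd
    rw [e.left_inv hx] at h4
    exact h4.symm
  refine ⟨hcont, fun x v w ↦ ?_⟩
  obtain ⟨A, -, h2, h3, h4⟩ := key x
  have he : chartAt E x ∈ IsManifold.maximalAtlas 𝓘(ℝ, E) ∞ M :=
    IsManifold.chart_mem_maximalAtlas x
  have he' : chartAt E (f x) ∈ IsManifold.maximalAtlas 𝓘(ℝ, E) ∞ M :=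
    IsManifold.chart_mem_maximalAtlas (f x)
  set e := chartAt E x
  set e' := chartAt E (f x)
  have hx : x ∈ e.source := mem_chart_source E x
  have h5 : ∀ u : TangentSpace 𝓘(ℝ, E) x,
      chartVector e (e x, (chartCoord e (⟨x, u⟩ : TangentBundle 𝓘(ℝ, E) M)).2) = ⟨x, u⟩ :=
    fun u ↦ chartVector_chartCoord (ξ := ⟨x, u⟩) he hx
  have h6 : ∀ u : TangentSpace 𝓘(ℝ, E) x,
      chartVector e' (e' (f x), A (chartCoord e (⟨x, u⟩ : TangentBundle 𝓘(ℝ, E) M)).2)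
        = ⟨f x, mfderiv 𝓘(ℝ, E) 𝓘(ℝ, E) f x u⟩ := by
    intro u
    have h7 := chartVector_coordTangentMap he he' hcont
      (q := (e x, (chartCoord e (⟨x, u⟩ : TangentBundle 𝓘(ℝ, E) M)).2)) h2.self_of_nhds
    rw [h5, _root_.coordTangentMap, h3, chartMap, Function.comp_apply, Function.comp_apply,
      e.left_inv hx] at h7
    exact h7
  rw [← g.chartMetric_eq_inner (h5 v) (h5 w), ← g.chartMetric_eq_inner (h6 v) (h6 w)]
  exact h4 _ _

end LorentzianMetric

end TangentLimits

/-! ### The isotropy representation and a compactness criterion -/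

namespace LorentzianMetric

variable {E : Type u} [NormedAddCommGroup E] [NormedSpace ℝ E] [FiniteDimensional ℝ E]
  {M : Type*} [TopologicalSpace M] [ChartedSpace E M] [IsManifold 𝓘(ℝ, E) ∞ M]
  {g : LorentzianMetric E M} {e : OpenPartialHomeomorph M E}

/-- The derivative at `p` of an isometry fixing `p`, in a chart. -/
def isotropyDeriv (e : OpenPartialHomeomorph M E) (p : M) (f : g.isometryGroup) : E →L[ℝ] E :=
  fderiv ℝ (chartMap e e (f : M ≃ₜ M)) (e p)

theorem mem_chartDomain_isotropy {p : M} (hp : p ∈ e.source) {f : g.isometryGroup}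
    (hf : f ∈ g.isotropyGroup p) : e p ∈ chartDomain e e (f : M ≃ₜ M) := by
  refine ⟨e.map_source hp, ?_⟩
  change (f : M ≃ₜ M) (e.symm (e p)) ∈ e.source
  rw [e.left_inv hp, show (f : M ≃ₜ M) p = p from hf]
  exact hp

theorem chartMap_isotropy {p : M} (hp : p ∈ e.source) {f : g.isometryGroup}
    (hf : f ∈ g.isotropyGroup p) : chartMap e e (f : M ≃ₜ M) (e p) = e p := by
  change e ((f : M ≃ₜ M) (e.symm (e p))) = e p
  rw [e.left_inv hp, show (f : M ≃ₜ M) p = p from hf]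

theorem isotropyDeriv_mul (he : e ∈ IsManifold.maximalAtlas 𝓘(ℝ, E) ∞ M) {p : M}
    (hp : p ∈ e.source) {f h : g.isometryGroup} (hf : f ∈ g.isotropyGroup p)
    (hh : h ∈ g.isotropyGroup p) :
    isotropyDeriv e p (f * h) = isotropyDeriv e p f ∘L isotropyDeriv e p h := by
  have hd : ∀ k : g.isometryGroup, k ∈ g.isotropyGroup p →
      DifferentiableAt ℝ (chartMap e e (k : M ≃ₜ M)) (e p) := fun k hk ↦
    ((contDiffOn_chartMap he he k.2.1).contDiffAt ((isOpen_chartDomain e e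
      (k : M ≃ₜ M).continuous).mem_nhds (mem_chartDomain_isotropy hp hk))).differentiableAt
      (by simp)
  have h1 : chartMap e e ((f * h : g.isometryGroup) : M ≃ₜ M)
      =ᶠ[𝓝 (e p)] chartMap e e (f : M ≃ₜ M) ∘ chartMap e e (h : M ≃ₜ M) := by
    filter_upwards [(isOpen_chartDomain e e (h : M ≃ₜ M).continuous).mem_nhds
      (mem_chartDomain_isotropy hp hh)] with y hy
    change e ((f : M ≃ₜ M) ((h : M ≃ₜ M) (e.symm y)))
      = e ((f : M ≃ₜ M) (e.symm (chartMap e e (h : M ≃ₜ M) y)))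
    rw [symm_chartMap hy]
  have hfd := hd f hf
  rw [← chartMap_isotropy hp hh] at hfd
  unfold isotropyDeriv
  rw [h1.fderiv_eq, fderiv_comp _ hfd (hd h hh), chartMap_isotropy hp hh]

theorem isotropyDeriv_one {p : M} (hp : p ∈ e.source) :
    isotropyDeriv e p (1 : g.isometryGroup) = ContinuousLinearMap.id ℝ E := by
  have h1 : chartMap e e ((1 : g.isometryGroup) : M ≃ₜ M) =ᶠ[𝓝 (e p)] id := by
    filter_upwards [e.open_target.mem_nhds (e.map_source hp)] with y hy using e.right_inv hy
  rw [isotropyDeriv, h1.fderiv_eq, fderiv_id]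

/-- An ultrafilter of isometries fixing a point, with bounded derivatives at this point, converges
locally uniformly to a smooth map preserving the metric. -/
theorem exists_limit_of_bounded_isotropyDeriv [T2Space M] [ConnectedSpace M]
    (he : e ∈ IsManifold.maximalAtlas 𝓘(ℝ, E) ∞ M) {p : M} (hp : p ∈ e.source) {C : ℝ}
    (hC : ∀ f ∈ g.isotropyGroup p, ‖isotropyDeriv e p f‖ ≤ C)
    (l : Ultrafilter g.isometryGroup)
    (hl : ∀ᶠ f in (l : Filter g.isometryGroup), f ∈ g.isotropyGroup p) :
    ∃ f : M → M, ContMDiff 𝓘(ℝ, E) 𝓘(ℝ, E) ∞ f ∧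
      (∀ (x : M) (v w : TangentSpace 𝓘(ℝ, E) x),
        g.inner (f x) (mfderiv 𝓘(ℝ, E) 𝓘(ℝ, E) f x v) (mfderiv 𝓘(ℝ, E) 𝓘(ℝ, E) f x w)
          = g.inner x v w) ∧
      ∀ x, Tendsto (fun q : g.isometryGroup × M ↦ (q.1 : M ≃ₜ M) q.2)
        ((l : Filter g.isometryGroup) ×ˢ 𝓝 x) (𝓝 (f x)) := by
  have : ProperSpace (E →L[ℝ] E) := FiniteDimensional.proper ℝ _
  have hlim : ∀ k : g.isometryGroup → g.isometryGroup,
      (∀ f ∈ g.isotropyGroup p, k f ∈ g.isotropyGroup p) →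
      ∃ A, Tendsto (fun f ↦ isotropyDeriv e p (k f)) l (𝓝 A) := by
    intro k hk
    obtain ⟨A, -, hA⟩ := (isCompact_closedBall (0 : E →L[ℝ] E) C).ultrafilter_le_nhds
      (l.map fun f ↦ isotropyDeriv e p (k f)) (le_principal_iff.2 (hl.mono fun f hf ↦ by
        rw [mem_closedBall_zero_iff]
        exact hC _ (hk f hf)))
    exact ⟨A, hA⟩
  -- Boundedness holds for the whole group, so the derivatives of the inverses converge too. Their
  -- limit `A'` is inverse to `A`, which rules out degeneration.
  obtain ⟨A, hA⟩ := hlim id fun f hf ↦ hf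
  obtain ⟨A', hA'⟩ := hlim (fun f ↦ f⁻¹) fun f hf ↦ inv_mem hf
  have hcomp : ∀ {ι : Type _} {l : Filter ι} {a b : ι → E →L[ℝ] E} {a₀ b₀ : E →L[ℝ] E},
      Tendsto a l (𝓝 a₀) → Tendsto b l (𝓝 b₀) → Tendsto (fun i ↦ a i ∘L b i) l (𝓝 (a₀ ∘L b₀)) :=
    fun ha hb ↦ (isBoundedBilinearMap_comp.continuous.tendsto (_, _)).comp (ha.prodMk_nhds hb)
  have hAA' : A ∘L A' = ContinuousLinearMap.id ℝ E := by
    refine tendsto_nhds_unique (hcomp hA hA') (tendsto_const_nhds.congr' ?_)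
    filter_upwards [hl] with f hf
    rw [← isotropyDeriv_one hp (g := g), ← mul_inv_cancel f]
    exact isotropyDeriv_mul he hp hf (inv_mem hf)
  have hA'A : A' ∘L A = ContinuousLinearMap.id ℝ E := by
    refine tendsto_nhds_unique (hcomp hA' hA) (tendsto_const_nhds.congr' ?_)
    filter_upwards [hl] with f hf
    rw [← isotropyDeriv_one hp (g := g), ← inv_mul_cancel f]
    exact isotropyDeriv_mul he hp (inv_mem hf) hf
  have hcauchy : ∀ k : g.isometryGroup × g.isometryGroup → g.isometryGroup,
      (∀ q, q.1 ∈ g.isotropyGroup p → q.2 ∈ g.isotropyGroup p → k q ∈ g.isotropyGroup p) →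
      Tendsto (fun q ↦ isotropyDeriv e p (k q))
        ((l : Filter g.isometryGroup) ×ˢ (l : Filter g.isometryGroup))
        (𝓝 (ContinuousLinearMap.id ℝ E)) → ∀ ξ : TangentBundle 𝓘(ℝ, E) M,
      Tendsto (fun q : (g.isometryGroup × g.isometryGroup) × TangentBundle 𝓘(ℝ, E) M ↦
        tangentMap 𝓘(ℝ, E) 𝓘(ℝ, E) (k q.1 : M ≃ₜ M) q.2)
        (((l : Filter g.isometryGroup) ×ˢ (l : Filter g.isometryGroup)) ×ˢ 𝓝 ξ) (𝓝 ξ) := by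
    intro k hk hlimk ξ
    have hkl : ∀ᶠ q in (l : Filter g.isometryGroup) ×ˢ (l : Filter g.isometryGroup),
        k q ∈ g.isotropyGroup p := (hl.prod_mk hl).mono fun q hq ↦ hk q hq.1 hq.2
    have h1 := tendsto_tangentMap_id he (e.map_source hp)
      (l := map k ((l : Filter g.isometryGroup) ×ˢ (l : Filter g.isometryGroup)))
      (hkl.mono fun q hq ↦ mem_chartDomain_isotropy hp hq)
      (tendsto_map'_iff.2 (tendsto_const_nhds.congr' (hkl.mono fun q hq ↦
        (chartMap_isotropy hp hq).symm)))
      (tendsto_map'_iff.2 hlimk) ξ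
    exact h1.comp (tendsto_map.prodMap tendsto_id)
  have hTm : ∀ (f h : g.isometryGroup) (ξ : TangentBundle 𝓘(ℝ, E) M),
      tangentMap 𝓘(ℝ, E) 𝓘(ℝ, E) (f : M ≃ₜ M) (tangentMap 𝓘(ℝ, E) 𝓘(ℝ, E) (h : M ≃ₜ M) ξ)
        = tangentMap 𝓘(ℝ, E) 𝓘(ℝ, E) ((f * h : g.isometryGroup) : M ≃ₜ M) ξ := fun f h ξ ↦
    (tangentMap_comp_at ξ (f.2.1.mdifferentiable (by simp) _)
      (h.2.1.mdifferentiable (by simp) _)).symm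
  have hT1 : ∀ ξ : TangentBundle 𝓘(ℝ, E) M,
      tangentMap 𝓘(ℝ, E) 𝓘(ℝ, E) ((1 : g.isometryGroup) : M ≃ₜ M) ξ = ξ := fun ξ ↦ by
    have h1 : (((1 : g.isometryGroup) : M ≃ₜ M) : M → M) = id := rfl
    rw [h1, tangentMap_id]
    rfl
  have : LocallyCompactSpace (TangentBundle 𝓘(ℝ, E) M) := by
    have : ProperSpace E := FiniteDimensional.proper ℝ E
    have : LocallyCompactSpace (ModelProd E E) := inferInstanceAs (LocallyCompactSpace (E × E))
    exact ChartedSpace.locallyCompactSpace (ModelProd E E) _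
  -- The quotients have derivative tending to `A' ∘ A = id` at `p`, so they tend to the identity on
  -- the whole tangent bundle. This is the Cauchy condition there, and it controls first derivatives
  -- together with values.
  have hcauchy1 := hcauchy (fun q ↦ q.1⁻¹ * q.2) (fun q h1 h2 ↦ mul_mem (inv_mem h1) h2) (by
    rw [← hA'A]
    refine (hcomp (hA'.comp tendsto_fst) (hA.comp tendsto_snd)).congr'
      ((hl.prod_mk hl).mono fun q hq ↦ ?_)
    exact (isotropyDeriv_mul he hp (inv_mem hq.1) hq.2).symm)
  have hcauchy2 := hcauchy (fun q ↦ q.1 * q.2⁻¹) (fun q h1 h2 ↦ mul_mem h1 (inv_mem h2)) (by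
    rw [← hAA']
    refine (hcomp (hA.comp tendsto_fst) (hA'.comp tendsto_snd)).congr'
      ((hl.prod_mk hl).mono fun q hq ↦ ?_)
    exact (isotropyDeriv_mul he hp hq.1 (inv_mem hq.2)).symm)
  choose F hF using exists_limit_of_cauchy l
    (fun f ↦ tangentMap 𝓘(ℝ, E) 𝓘(ℝ, E) ((f : g.isometryGroup) : M ≃ₜ M))
    (fun f ↦ tangentMap 𝓘(ℝ, E) 𝓘(ℝ, E) ((f⁻¹ : g.isometryGroup) : M ≃ₜ M))
    (fun f ↦ f.2.1.continuous_tangentMap (by simp))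
    (fun f ξ ↦ by rw [hTm, inv_mul_cancel, hT1]) (fun f ξ ↦ by rw [hTm, mul_inv_cancel, hT1])
    (by simpa only [hTm] using hcauchy1) (by simpa only [hTm] using hcauchy2)
  have hproj := FiberBundle.continuous_proj E (TangentSpace (M := M) 𝓘(ℝ, E))
  let f : M → M := fun x ↦ (F ⟨x, 0⟩).1
  have hzero : Continuous (fun x : M ↦ (⟨x, 0⟩ : TangentBundle 𝓘(ℝ, E) M)) :=
    (Bundle.contMDiff_zeroSection ℝ (TangentSpace (M := M) 𝓘(ℝ, E)) (n := 0) (F := E)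
      (IB := 𝓘(ℝ, E))).continuous
  have hconv : ∀ x, Tendsto (fun q : g.isometryGroup × M ↦ (q.1 : M ≃ₜ M) q.2)
      ((l : Filter g.isometryGroup) ×ˢ 𝓝 x) (𝓝 (f x)) := fun x ↦
    (hproj.tendsto _).comp ((hF ⟨x, 0⟩).comp (tendsto_id.prodMap (hzero.tendsto x)))
  have hpt : ∀ ξ, Tendsto (fun h : g.isometryGroup ↦ tangentMap 𝓘(ℝ, E) 𝓘(ℝ, E) (h : M ≃ₜ M) ξ) l
      (𝓝 (F ξ)) := fun ξ ↦
    (hF ξ).comp (tendsto_id.prodMk (tendsto_const_pure.mono_right (pure_le_nhds _)))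
  have hpt' : ∀ x, Tendsto (fun h : g.isometryGroup ↦ (h : M ≃ₜ M) x) l (𝓝 (f x)) := fun x ↦
    (hconv x).comp (tendsto_id.prodMk (tendsto_const_pure.mono_right (pure_le_nhds _)))
  have hFf : ∀ ξ, (F ξ).1 = f ξ.1 := fun ξ ↦
    tendsto_nhds_unique ((hproj.tendsto _).comp (hpt ξ)) (hpt' ξ.1)
  obtain ⟨h1, h2⟩ := contMDiff_of_tendsto_tangentMap hFf hpt
  exact ⟨f, h1, h2, hconv⟩

/-- If the derivatives at `p` of the isometries fixing `p` are bounded, then the isotropy group of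
`p` is compact. -/
theorem isCompact_isotropyGroup [T2Space M] [ConnectedSpace M]
    (he : e ∈ IsManifold.maximalAtlas 𝓘(ℝ, E) ∞ M) {p : M} (hp : p ∈ e.source) {C : ℝ}
    (hC : ∀ f ∈ g.isotropyGroup p, ‖isotropyDeriv e p f‖ ≤ C) :
    IsCompact (g.isotropyGroup p : Set g.isometryGroup) := by
  rw [isCompact_iff_ultrafilter_le_nhds]
  intro l hl
  have hl' : ∀ᶠ f in (l : Filter g.isometryGroup), f ∈ g.isotropyGroup p := le_principal_iff.1 hl
  obtain ⟨f, hf, hfg, hfl⟩ := exists_limit_of_bounded_isotropyDeriv he hp hC l hl'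
  -- Applying the same result to the inverses gives a smooth candidate for the inverse of `f`.
  -- Convergence at moving points makes the two limits mutually inverse.
  obtain ⟨f', hf', -, hfl'⟩ := exists_limit_of_bounded_isotropyDeriv he hp hC
    (l.map fun h ↦ h⁻¹) (hl'.mono fun h hh ↦ inv_mem hh)
  have hpt : ∀ x, Tendsto (fun h : g.isometryGroup ↦ (h : M ≃ₜ M) x) l (𝓝 (f x)) := fun x ↦
    (hfl x).comp (tendsto_id.prodMk (tendsto_const_pure.mono_right (pure_le_nhds _)))
  have hfl'' : ∀ x, Tendsto (fun q : g.isometryGroup × M ↦ ((q.1⁻¹ : g.isometryGroup) : M ≃ₜ M) q.2)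
      ((l : Filter g.isometryGroup) ×ˢ 𝓝 x) (𝓝 (f' x)) := fun x ↦
    (hfl' x).comp (tendsto_map.prodMap tendsto_id)
  have hpt' : ∀ x, Tendsto (fun h : g.isometryGroup ↦ ((h⁻¹ : g.isometryGroup) : M ≃ₜ M) x) l
      (𝓝 (f' x)) := fun x ↦
    (hfl'' x).comp (tendsto_id.prodMk (tendsto_const_pure.mono_right (pure_le_nhds _)))
  have hleft : Function.LeftInverse f' f := fun x ↦ by
    refine tendsto_nhds_unique ((hfl'' (f x)).comp (tendsto_id.prodMk (hpt x))) ?_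
    refine tendsto_const_nhds.congr fun h ↦ ?_
    exact ((h : M ≃ₜ M).symm_apply_apply x).symm
  have hright : Function.RightInverse f' f := fun x ↦ by
    refine tendsto_nhds_unique ((hfl (f' x)).comp (tendsto_id.prodMk (hpt' x))) ?_
    refine tendsto_const_nhds.congr fun h ↦ ?_
    exact ((h : M ≃ₜ M).apply_symm_apply x).symm
  let φ : M ≃ₜ M := ⟨⟨f, f', hleft, hright⟩, hf.continuous, hf'.continuous⟩
  refine ⟨⟨φ, hf, hf', hfg⟩, ?_, ?_⟩
  · refine tendsto_nhds_unique (hpt p) (tendsto_const_nhds.congr' ?_)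
    filter_upwards [hl'] with h hh using (show (h : M ≃ₜ M) p = p from hh).symm
  · rw [nhds_induced, ← tendsto_iff_comap, ContinuousMap.tendsto_nhds_compactOpen]
    intro K hK U hU hKU
    -- Local uniformity settles the condition near each point of `K`. Compactness reduces the
    -- condition on `K` to finitely many such neighborhoods.
    refine hK.induction_on (p := fun K ↦ ∀ᶠ h : g.isometryGroup in (l : Filter g.isometryGroup),
      MapsTo (h : M ≃ₜ M) K U) (.of_forall fun _ ↦ mapsTo_empty _ _)
      (fun s t hst ht ↦ ht.mono fun h hh ↦ hh.mono_left hst)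
      (fun s t hs ht ↦ (hs.and ht).mono fun h hh ↦ hh.1.union hh.2) fun x hx ↦ ?_
    obtain ⟨P, hP, Q, hQ, hPQ⟩ :=
      eventually_prod_iff.1 ((hfl x).eventually (hU.mem_nhds (hKU hx)))
    exact ⟨{y | Q y}, mem_nhdsWithin_of_mem_nhds hQ, hP.mono fun h hh y hy ↦ hPQ hh hy⟩

end LorentzianMetric

/-! ### Divergent families of linear Lorentzian isometries -/

section LorentzianLinearAlgebra

variable {E : Type*} [NormedAddCommGroup E] [NormedSpace ℝ E] [FiniteDimensional ℝ E]
  {B : E →L[ℝ] E →L[ℝ] ℝ} {z : E}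

/-- A form which is positive definite on the orthogonal of `z` dominates the norm there. -/
theorem exists_norm_sq_le_of_orthogonal (hpos : ∀ w, B z w = 0 → w ≠ 0 → 0 < B w w) :
    ∃ K : ℝ, 0 < K ∧ ∀ w, B z w = 0 → ‖w‖ ^ 2 ≤ K * B w w := by
  have : ProperSpace E := FiniteDimensional.proper ℝ E
  have hcompact : IsCompact (Metric.sphere (0 : E) 1 ∩ {w | B z w = 0}) :=
    (isCompact_sphere 0 1).inter_right (isClosed_eq (B z).continuous continuous_const)
  obtain ⟨a, ha, hle⟩ := hcompact.exists_forall_le' (f := fun w ↦ B w w) (a := 0)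
    (B.continuous.clm_apply continuous_id).continuousOn fun w hw ↦
      hpos w hw.2 (ne_zero_of_mem_unit_sphere ⟨w, hw.1⟩)
  refine ⟨a⁻¹, inv_pos.2 ha, fun w hw ↦ ?_⟩
  rcases eq_or_ne w 0 with rfl | hw0
  · simp
  have hn : ‖w‖ ≠ 0 := norm_ne_zero_iff.2 hw0
  have h1 := hle (‖w‖⁻¹ • w) ⟨by simp [norm_smul, hn], by simp [hw]⟩
  simp only [map_smul, smul_apply, smul_eq_mul] at h1
  rw [← mul_assoc, ← sq, inv_pow, ← div_eq_inv_mul, le_div_iff₀ (by positivity)] at h1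
  rw [← div_eq_inv_mul, le_div_iff₀ ha]
  linarith

theorem eq_zero_of_forall_eq_zero (hB : ∀ v w, B v w = B w v)
    (hpos : ∀ w, B z w = 0 → w ≠ 0 → 0 < B w w) {x : E} (hx : B x = 0) : x = 0 := by
  by_contra h
  have h1 := hpos x (by rw [hB, hx]; rfl) h
  rw [hx] at h1
  exact lt_irrefl _ h1

variable {ι : Type*} {l : Ultrafilter ι} {A : ι → E →L[ℝ] E}

/-- A divergent family of isometries of a Lorentzian form strongly contracts some direction. -/
theorem exists_contracted_direction (hB : ∀ v w, B v w = B w v) (hz : B z z < 0)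
    (hpos : ∀ w, B z w = 0 → w ≠ 0 → 0 < B w w) (hA : ∀ i v w, B (A i v) (A i w) = B v w)
    (hn : Tendsto (fun i ↦ ‖A i‖) l atTop) :
    ∃ (y : E) (u : ι → E), y ≠ 0 ∧ Tendsto u l (𝓝 y) ∧ Tendsto (fun i ↦ A i (u i)) l (𝓝 0) := by
  have : ProperSpace E := FiniteDimensional.proper ℝ E
  have hz0 : z ≠ 0 := fun h ↦ by simp [h] at hz
  have : Nontrivial E := ⟨z, 0, hz0⟩
  -- A unit vector stretched least by `A i`.
  have hmin : ∀ i, ∃ u ∈ Metric.sphere (0 : E) 1, ∀ w, ‖A i u‖ * ‖w‖ ≤ ‖A i w‖ := by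
    intro i
    obtain ⟨u, hu, hmin⟩ := (isCompact_sphere (0 : E) 1).exists_isMinOn
      (NormedSpace.sphere_nonempty.2 zero_le_one) (f := fun u ↦ ‖A i u‖)
      (A i).continuous.norm.continuousOn
    refine ⟨u, hu, fun w ↦ ?_⟩
    rcases eq_or_ne w 0 with rfl | hw0
    · simp
    have hnw : ‖w‖ ≠ 0 := norm_ne_zero_iff.2 hw0
    have h1 : ‖A i u‖ ≤ ‖A i (‖w‖⁻¹ • w)‖ := hmin (by simp [norm_smul, hnw])
    rw [map_smul, norm_smul, norm_inv, norm_norm, ← div_eq_inv_mul,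
      le_div_iff₀ (by positivity)] at h1
    exact h1
  choose u hu hAu using hmin
  obtain ⟨κ, hκ, hanti⟩ := LinearMap.exists_antilipschitzWith (B : E →ₗ[ℝ] E →L[ℝ] ℝ)
    (LinearMap.ker_eq_bot'.2 fun x hx ↦ eq_zero_of_forall_eq_zero hB hpos hx)
  have hκB : ∀ x, ‖x‖ ≤ κ * ‖B x‖ := fun x ↦ by simpa using hanti.le_mul_dist x 0
  have hinj : ∀ i, Function.Injective (A i) := fun i ↦
    (injective_iff_map_eq_zero (A i)).2 fun x hx ↦ eq_zero_of_forall_eq_zero hB hpos (by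
      ext w
      rw [← hA i, hx]
      simp)
  -- Up to the isomorphism given by `B`, the inverse of a `B`-isometry is its adjoint. Large norm
  -- thus forces a small minimal stretching factor, with `κ` accounting for the nondegeneracy of
  -- `B`.
  have hbound : ∀ i, ‖A i (u i)‖ * ‖A i‖ ≤ κ * ‖B‖ := by
    intro i
    have hpos' : 0 < ‖A i (u i)‖ := norm_pos_iff.2 fun h ↦
      ne_zero_of_mem_unit_sphere ⟨u i, hu i⟩ (hinj i (h.trans (map_zero _).symm))
    rw [mul_comm, ← le_div_iff₀ hpos']
    refine (A i).opNorm_le_bound (by positivity) fun x ↦ ?_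
    refine (hκB _).trans ?_
    have h1 : ‖B (A i x)‖ ≤ ‖B‖ * ‖x‖ / ‖A i (u i)‖ := by
      refine (B (A i x)).opNorm_le_bound (by positivity) fun w ↦ ?_
      obtain ⟨v, rfl⟩ := (LinearMap.injective_iff_surjective (f := (A i : E →ₗ[ℝ] E))).1 (hinj i) w
      change ‖B (A i x) (A i v)‖ ≤ _ * ‖A i v‖
      rw [hA, div_mul_eq_mul_div, le_div_iff₀ hpos']
      calc ‖B x v‖ * ‖A i (u i)‖ ≤ ‖B‖ * ‖x‖ * ‖v‖ * ‖A i (u i)‖ := by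
            gcongr
            exact B.le_opNorm₂ x v
        _ = ‖B‖ * ‖x‖ * (‖A i (u i)‖ * ‖v‖) := by ring
        _ ≤ _ := by gcongr; exact hAu i v
    calc κ * ‖B (A i x)‖ ≤ κ * (‖B‖ * ‖x‖ / ‖A i (u i)‖) := by gcongr
      _ = _ := by ring
  obtain ⟨y, hy, hlim⟩ := (isCompact_sphere (0 : E) 1).ultrafilter_le_nhds (l.map u)
    (le_principal_iff.2 (Eventually.of_forall hu : ∀ᶠ i in (l : Filter ι), u i ∈ _))
  refine ⟨y, u, ne_zero_of_mem_unit_sphere ⟨y, hy⟩, hlim, ?_⟩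
  refine squeeze_zero_norm' ?_ ((tendsto_const_nhds (x := κ * ‖B‖)).div_atTop hn)
  filter_upwards [hn.eventually_gt_atTop 0] with i hi
  rw [le_div_iff₀ hi]
  exact hbound i

/-- A divergent family of isometries of a Lorentzian form approximately stabilizes, with bounded
distortion, a hyperplane. -/
theorem exists_hyperplane_of_divergent (hpos : ∀ w, B z w = 0 → w ≠ 0 → 0 < B w w)
    (hA : ∀ i v w, B (A i v) (A i w) = B v w) (hn : Tendsto (fun i ↦ ‖A i‖) l atTop) :
    ∃ F : Submodule ℝ E, Module.finrank ℝ F + 1 = Module.finrank ℝ E ∧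
      (∀ (c : E) (c' : E) (u : ι → E), Tendsto u l (𝓝 c) →
        Tendsto (fun i ↦ A i (u i)) l (𝓝 c') → c ∈ F) ∧
      ∃ C : ℝ, 0 ≤ C ∧ ∀ v ∈ F, ∃ (v' : E) (u : ι → E), ‖v'‖ ≤ C * ‖v‖ ∧ Tendsto u l (𝓝 v) ∧
        Tendsto (fun i ↦ A i (u i)) l (𝓝 v') := by
  have : ProperSpace E := FiniteDimensional.proper ℝ E
  have : ProperSpace (E →L[ℝ] E) := FiniteDimensional.proper ℝ _
  have hinv : Tendsto (fun i ↦ ‖A i‖⁻¹) l (𝓝 0) := tendsto_inv_atTop_zero.comp hn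
  have hnorm : ∀ᶠ i in (l : Filter ι), ‖‖A i‖⁻¹ • A i‖ = 1 := by
    filter_upwards [hn.eventually_gt_atTop 0] with i hi
    rw [norm_smul, norm_inv, norm_norm, inv_mul_cancel₀ hi.ne']
  obtain ⟨T, hT1, hT⟩ := (isCompact_sphere (0 : E →L[ℝ] E) 1).ultrafilter_le_nhds
    (l.map fun i ↦ ‖A i‖⁻¹ • A i) (le_principal_iff.2
      (hnorm.mono fun i hi ↦ mem_sphere_zero_iff_norm.2 hi :
        ∀ᶠ i in (l : Filter ι), ‖A i‖⁻¹ • A i ∈ _))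
  replace hT : Tendsto (fun i ↦ ‖A i‖⁻¹ • A i) l (𝓝 T) := hT
  -- `B` takes the value `B x x / ‖A i‖ ^ 2` on the rescaled images, and this tends to zero.
  have hTnull : ∀ x, B (T x) (T x) = 0 := by
    intro x
    have h1 := tendsto_clm_apply hT (tendsto_const_nhds (x := x))
    have h2 := tendsto_clm_apply (tendsto_clm_apply (tendsto_const_nhds (x := B)) h1) h1
    refine tendsto_nhds_unique h2 ?_
    have h3 := (hinv.mul hinv).mul_const (B x x)
    rw [mul_zero, zero_mul] at h3
    refine h3.congr fun i ↦ ?_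
    simp only [smul_apply, map_smul, smul_eq_mul, hA]
    ring
  have hker : ∀ x, B z (T x) = 0 → T x = 0 := fun x hx ↦ by
    by_contra h
    exact (hpos _ hx h).ne' (hTnull x)
  -- Since `B` is positive definite on the orthogonal of `z`, pairing with `z` is injective on the
  -- isotropic image of `T`. Hence `ker T` is the kernel of the single functional `φ`, a hyperplane.
  let φ : Module.Dual ℝ E := (B z ∘L T : E →L[ℝ] ℝ)
  have hφ : φ ≠ 0 := by
    intro h
    have h1 : T = 0 := by
      ext x
      exact hker x (LinearMap.congr_fun h x)
    rw [h1] at hT1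
    simp at hT1
  have hmem : ∀ x, x ∈ LinearMap.ker φ ↔ B z (T x) = 0 := fun x ↦ Iff.rfl
  refine ⟨LinearMap.ker φ, Module.Dual.finrank_ker_add_one_of_ne_zero hφ, ?_, ?_⟩
  · intro c c' u hu hAu
    have h1 := tendsto_clm_apply hT hu
    have h2 := hinv.smul hAu
    rw [zero_smul] at h2
    rw [hmem, tendsto_nhds_unique h1 h2, map_zero]
  · obtain ⟨K, hK, hKle⟩ := exists_norm_sq_le_of_orthogonal hpos
    refine ⟨√(K * ‖B‖), Real.sqrt_nonneg _, fun v hv ↦ ?_⟩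
    rw [hmem] at hv
    obtain ⟨x, hx⟩ : ∃ x, B z (T x) ≠ 0 := by
      by_contra! h
      exact hφ (LinearMap.ext h)
    have hlim : ∀ w, Tendsto (fun i ↦ ‖A i‖⁻¹ * B z (A i w)) l (𝓝 (B z (T w))) := fun w ↦ by
      have h1 := ((B z).continuous.tendsto _).comp
        (tendsto_clm_apply hT (tendsto_const_nhds (x := w)))
      refine h1.congr fun i ↦ ?_
      simp
    -- The correction by `s i • x` makes `A i (u i)` orthogonal to `z`. It tends to zero because,
    -- after division by `‖A i‖`, the numerator tends to `φ v = 0` and the denominator to `φ x ≠ 0`.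
    let s : ι → ℝ := fun i ↦ -(B z (A i v) / B z (A i x))
    have hs : Tendsto s l (𝓝 0) := by
      have h1 := ((hlim v).div (hlim x) hx).neg
      rw [hv, zero_div, neg_zero] at h1
      refine h1.congr' ?_
      filter_upwards [hn.eventually_gt_atTop 0] with i hi
      change -(‖A i‖⁻¹ * B z (A i v) / (‖A i‖⁻¹ * B z (A i x))) = -(_ / _)
      rw [mul_div_mul_left _ _ (inv_ne_zero hi.ne')]
    let u : ι → E := fun i ↦ v + s i • x
    have hu : Tendsto u l (𝓝 v) := by
      have h1 := (tendsto_const_nhds (x := v)).add (hs.smul_const x)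
      rwa [zero_smul, add_zero] at h1
    have hperp : ∀ᶠ i in (l : Filter ι), B z (A i (u i)) = 0 := by
      filter_upwards [(hlim x).eventually_ne hx] with i hi
      have h1 : B z (A i x) ≠ 0 := right_ne_zero_of_mul hi
      simp only [u, s, map_add, map_smul, smul_eq_mul]
      field_simp
      ring
    -- On the orthogonal of `z` the form controls the norm, and its value on `A i (u i)` is that on
    -- `u i`. Hence the bound `C = √(K * ‖B‖)`, independent of `v`.
    have hle : ∀ᶠ i in (l : Filter ι), ‖A i (u i)‖ ≤ √(K * ‖B‖) * ‖u i‖ := by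
      filter_upwards [hperp] with i hi
      refine abs_le_of_sq_le_sq' ?_ (by positivity) |>.2
      rw [mul_pow, Real.sq_sqrt (by positivity)]
      calc ‖A i (u i)‖ ^ 2 ≤ K * B (A i (u i)) (A i (u i)) := hKle _ hi
        _ = K * B (u i) (u i) := by rw [hA]
        _ ≤ K * (‖B‖ * ‖u i‖ * ‖u i‖) := by
          gcongr
          exact (le_abs_self _).trans (B.le_opNorm₂ _ _)
        _ = _ := by ring
    have hev : ∀ᶠ i in (l : Filter ι), A i (u i) ∈
        Metric.closedBall (0 : E) (√(K * ‖B‖) * (‖v‖ + 1)) := by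
      filter_upwards [hle, hu.norm.eventually_le_const (lt_add_one ‖v‖)] with i h1 h2
      rw [mem_closedBall_zero_iff]
      exact h1.trans (by gcongr)
    obtain ⟨v', -, hv'⟩ := (isCompact_closedBall (0 : E) _).ultrafilter_le_nhds
      (l.map fun i ↦ A i (u i)) (le_principal_iff.2 hev)
    replace hv' : Tendsto (fun i ↦ A i (u i)) l (𝓝 v') := hv'
    exact ⟨v', u, le_of_tendsto_of_tendsto hv'.norm (hu.norm.const_mul _) hle, hu, hv'⟩

end LorentzianLinearAlgebra

/-! ### Normal charts, linear isometries and tangent spaces -/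

namespace LorentzianMetric

variable {E : Type u} [NormedAddCommGroup E] [NormedSpace ℝ E]
  {M : Type*} [TopologicalSpace M] [ChartedSpace E M] [IsManifold 𝓘(ℝ, E) ∞ M]
  {g : LorentzianMetric E M} {e : OpenPartialHomeomorph M E}

/-- The restriction of a chart to an open part of its target. -/
theorem exists_chart_restriction (he : e ∈ IsManifold.maximalAtlas 𝓘(ℝ, E) ∞ M) {s : Set E}
    (hs : IsOpen s) (hse : s ⊆ e.target) :
    ∃ e' ∈ IsManifold.maximalAtlas 𝓘(ℝ, E) ∞ M, (e' : M → E) = e ∧ (e'.symm : E → M) = e.symm ∧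
      e'.target = s ∧ e'.source = e.source ∩ e ⁻¹' s := by
  have ho := e.isOpen_inter_preimage hs
  refine ⟨e.restr (e.source ∩ e ⁻¹' s), restr_mem_maximalAtlas _ he ho, rfl, rfl, ?_, ?_⟩
  · rw [OpenPartialHomeomorph.restr_target, ho.interior_eq]
    ext y
    refine ⟨fun hy ↦ ?_, fun hy ↦ ⟨hse hy, e.map_target (hse hy), ?_⟩⟩
    · have h1 := hy.2.2
      rwa [mem_preimage, e.right_inv hy.1] at h1
    · rwa [mem_preimage, e.right_inv (hse hy)]
  · rw [OpenPartialHomeomorph.restr_source, ho.interior_eq]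
    exact inter_eq_right.2 inter_subset_left

/-- Composing a chart with a smooth change of coordinates gives a chart. -/
theorem trans_mem_maximalAtlas (he : e ∈ IsManifold.maximalAtlas 𝓘(ℝ, E) ∞ M)
    {h : OpenPartialHomeomorph E E} (hh : ContDiffOn ℝ ∞ h h.source)
    (hh' : ContDiffOn ℝ ∞ h.symm h.target) :
    e.trans h ∈ IsManifold.maximalAtlas 𝓘(ℝ, E) ∞ M := by
  rw [IsManifold.mem_maximalAtlas_iff_contMDiffOn]
  refine ⟨?_, ?_⟩
  · refine hh.contMDiffOn.comp ((contMDiffOn_of_mem_maximalAtlas he).mono ?_) ?_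
    · intro x hx
      rw [OpenPartialHomeomorph.trans_source] at hx
      exact hx.1
    · intro x hx
      rw [OpenPartialHomeomorph.trans_source] at hx
      exact hx.2
  · refine (contMDiffOn_symm_of_mem_maximalAtlas he).comp (hh'.contMDiffOn.mono ?_) ?_
    · intro x hx
      rw [OpenPartialHomeomorph.trans_target] at hx
      exact hx.1
    · intro x hx
      rw [OpenPartialHomeomorph.trans_target] at hx
      exact hx.2

/-- A normal chart centered at `x`: the isometries fixing `x` are linear in this chart. -/
theorem exists_normal_chart [FiniteDimensional ℝ E] [T2Space M] (g : LorentzianMetric E M) (x : M) :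
    ∃ N ∈ IsManifold.maximalAtlas 𝓘(ℝ, E) ∞ M, x ∈ N.source ∧ N x = 0 ∧
      ∃ R : ℝ, 0 < R ∧ N.target = Metric.ball 0 R ∧
      ∀ f ∈ g.isotropyGroup x, ∀ v, ‖v‖ < R → ‖isotropyDeriv N x f v‖ < R →
        (f : M ≃ₜ M) (N.symm v) = N.symm (isotropyDeriv N x f v) := by
  have := FiniteDimensional.complete ℝ E
  have he : chartAt E x ∈ IsManifold.maximalAtlas 𝓘(ℝ, E) ∞ M :=
    IsManifold.chart_mem_maximalAtlas x
  have hx : x ∈ (chartAt E x).source := mem_chart_source E x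
  set e := chartAt E x
  obtain ⟨Φ, Ω, hΩ, h0Ω, hΦ, hsm, hval, hd⟩ := g.exists_chart_exponential he (e.map_source hx)
  let X : E → E := fun v ↦ (Φ (e x, v) 1).1
  let O : Set E := {v | (e x, v) ∈ Ω}
  have hj : ContDiff ℝ ∞ (fun v : E ↦ (e x, v)) := contDiff_const.prodMk contDiff_id
  have hO : IsOpen O := hΩ.preimage hj.continuous
  have hX : ContDiffOn ℝ ∞ X O := hsm.comp hj.contDiffOn fun v hv ↦ hv
  have hXd : HasFDerivAt X (ContinuousLinearEquiv.refl ℝ E : E →L[ℝ] E) 0 := by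
    have h1 := HasFDerivAt.comp (g := fun a ↦ (Φ a 1).1) (0 : E) hd
      ((hasFDerivAt_const (e x) (0 : E)).prodMk (hasFDerivAt_id (0 : E)))
    refine h1.congr_fderiv ?_
    ext v
    simp
  obtain ⟨h, h0h, hhO, hhX, hhsymm⟩ := exists_smooth_local_inverse hO hX h0Ω _ hXd
  have hhx : h 0 = e x := by rw [hhX]; exact hval
  have hmem : ∀ v ∈ h.source, h v ∈ e.target := fun v hv ↦ by
    rw [hhX]
    exact ((hΦ _ (hhO hv)).2 1 (by norm_num)).1
  obtain ⟨R, hR, hRh⟩ := Metric.isOpen_iff.1 h.open_source 0 h0h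
  have hN₀ : e.trans h.symm ∈ IsManifold.maximalAtlas 𝓘(ℝ, E) ∞ M :=
    trans_mem_maximalAtlas he hhsymm ((hX.mono hhO).congr fun v _ ↦ hhX v)
  have htarget : Metric.ball (0 : E) R ⊆ (e.trans h.symm).target := by
    intro v hv
    rw [OpenPartialHomeomorph.trans_target]
    exact ⟨hRh hv, hmem v (hRh hv)⟩
  obtain ⟨N, hN, hcoe, hcoe', htgt, hsrc⟩ :=
    exists_chart_restriction hN₀ Metric.isOpen_ball htarget
  have hNv : ∀ v, N.symm v = e.symm (h v) := fun v ↦ by rw [hcoe']; rfl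
  have hNx : N x = 0 := by
    rw [hcoe]
    change h.symm (e x) = 0
    rw [← hhx, h.left_inv h0h]
  have hxN : x ∈ N.source := by
    rw [hsrc]
    refine ⟨?_, by rw [mem_preimage, ← hcoe, hNx]; exact Metric.mem_ball_self hR⟩
    rw [OpenPartialHomeomorph.trans_source]
    exact ⟨hx, by rw [mem_preimage, ← hhx]; exact h.map_source h0h⟩
  have hcomm : ∀ f ∈ g.isotropyGroup x, ∀ v, ‖v‖ < R → ‖isotropyDeriv e x f v‖ < R →
      (f : M ≃ₜ M) (N.symm v) = N.symm (isotropyDeriv e x f v) := by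
    intro f hf v hv hAv
    have hv' : v ∈ h.source := hRh (mem_ball_zero_iff.2 hv)
    have hAv' : isotropyDeriv e x f v ∈ h.source := hRh (mem_ball_zero_iff.2 hAv)
    have hc : _root_.coordTangentMap (chartMap e e (f : M ≃ₜ M)) (e x, v)
        = (e x, isotropyDeriv e x f v) := Prod.ext (chartMap_isotropy hx hf) rfl
    have h1 := exponential_comm he he f hΦ hΦ (hhO hv') (mem_chartDomain_isotropy hx hf)
      (by rw [hc]; exact hhO hAv')
    rw [hc] at h1
    change X v ∈ _ ∧ _ = X (isotropyDeriv e x f v) at h1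
    rw [hNv, hNv, hhX, hhX, ← h1.2]
    exact (symm_chartMap h1.1).symm
  -- In the chart `N` the isometry is, near `0`, the linear map `isotropyDeriv e x f`, so its
  -- derivative there is that same map.
  have hDeriv : ∀ f ∈ g.isotropyGroup x, isotropyDeriv N x f = isotropyDeriv e x f := by
    intro f hf
    have h1 : chartMap N N (f : M ≃ₜ M) =ᶠ[𝓝 (N x)] isotropyDeriv e x f := by
      have h2 : Tendsto (fun v ↦ ‖isotropyDeriv e x f v‖) (𝓝 0) (𝓝 0) := by
        have h3 := ((isotropyDeriv e x f).continuous.norm).tendsto 0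
        rwa [map_zero, norm_zero] at h3
      rw [hNx]
      filter_upwards [Metric.ball_mem_nhds (0 : E) hR, h2.eventually_lt_const hR] with v hv hAv
      change N ((f : M ≃ₜ M) (N.symm v)) = _
      rw [hcomm f hf v (mem_ball_zero_iff.1 hv) hAv, N.right_inv]
      rw [htgt]
      exact mem_ball_zero_iff.2 hAv
    rw [isotropyDeriv, h1.fderiv_eq, ContinuousLinearMap.fderiv]
  refine ⟨N, hN, hxN, hNx, R, hR, htgt, fun f hf v hv hAv ↦ ?_⟩
  rw [hDeriv f hf] at hAv ⊢
  exact hcomm f hf v hv hAv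

/-- Where an isometry is linear in a chart, its linear part preserves the metric coefficients. -/
theorem chartMetric_isotropyDeriv [FiniteDimensional ℝ E]
    (he : e ∈ IsManifold.maximalAtlas 𝓘(ℝ, E) ∞ M) {f : g.isometryGroup} {A : E →L[ℝ] E}
    (hA : ∀ v ∈ e.target, A v ∈ e.target → (f : M ≃ₜ M) (e.symm v) = e.symm (A v))
    {v : E} (hv : v ∈ e.target) (hAv : A v ∈ e.target) (a b : E) :
    g.chartMetric e (A v) (A a) (A b) = g.chartMetric e v a b := by
  have hd : v ∈ chartDomain e e (f : M ≃ₜ M) := by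
    refine ⟨hv, ?_⟩
    change (f : M ≃ₜ M) (e.symm v) ∈ e.source
    rw [hA v hv hAv]
    exact e.map_target hAv
  have heq : ∀ w ∈ e.target, A w ∈ e.target → chartMap e e (f : M ≃ₜ M) w = A w := by
    intro w hw hAw
    change e ((f : M ≃ₜ M) (e.symm w)) = _
    rw [hA w hw hAw, e.right_inv hAw]
  have h1 : chartMap e e (f : M ≃ₜ M) =ᶠ[𝓝 v] A := by
    filter_upwards [e.open_target.mem_nhds hv,
      A.continuous.continuousAt.preimage_mem_nhds (e.open_target.mem_nhds hAv)] with w hw hAw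
      using heq w hw hAw
  have h2 := (g.isIsometryOn_chartMap he he f).preserve v hd a b
  rwa [h1.fderiv_eq, ContinuousLinearMap.fderiv, heq v hv hAv] at h2

/-- Where an isometry is linear in a chart, its linear part maps geodesics to geodesics. -/
theorem IsChartGeodesicOn.map_linear [FiniteDimensional ℝ E] [T2Space M]
    (he : e ∈ IsManifold.maximalAtlas 𝓘(ℝ, E) ∞ M) {f : g.isometryGroup} {A : E →L[ℝ] E}
    (hA : ∀ v ∈ e.target, A v ∈ e.target → (f : M ≃ₜ M) (e.symm v) = e.symm (A v))
    {ζ ζ' : ℝ → E × E} {τ : ℝ} (hτ : 0 < τ) (hζ : g.IsChartGeodesicOn e ζ (Ioo (-τ) τ))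
    (hζ' : g.IsChartGeodesicOn e ζ' (Ioo (-τ) τ)) (h1 : (ζ' 0).1 = A (ζ 0).1)
    (h2 : (ζ' 0).2 = A (ζ 0).2) {t : ℝ} (ht : t ∈ Ioo (-τ) τ) : (ζ' t).1 = A (ζ t).1 := by
  have h0 : (0 : ℝ) ∈ Ioo (-τ) τ := ⟨by linarith, hτ⟩
  have hv := (hζ 0 h0).1
  have hAv : A (ζ 0).1 ∈ e.target := h1 ▸ (hζ' 0 h0).1
  have heq : chartMap e e (f : M ≃ₜ M) =ᶠ[𝓝 (ζ 0).1] A := by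
    filter_upwards [e.open_target.mem_nhds hv,
      A.continuous.continuousAt.preimage_mem_nhds (e.open_target.mem_nhds hAv)] with w hw hAw
    change e ((f : M ≃ₜ M) (e.symm w)) = _
    rw [hA w hw hAw, e.right_inv hAw]
  have hd : (ζ 0).1 ∈ chartDomain e e (f : M ≃ₜ M) := by
    refine ⟨hv, ?_⟩
    change (f : M ≃ₜ M) (e.symm _) ∈ e.source
    rw [hA _ hv hAv]
    exact e.map_target hAv
  have hinit : chartVector e (ζ' 0) = tangentMap 𝓘(ℝ, E) 𝓘(ℝ, E) (f : M ≃ₜ M)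
      (chartVector e (ζ 0)) := by
    rw [← chartVector_coordTangentMap he he f.2.1 hd]
    congr 1
    refine Prod.ext (h1.trans heq.eq_of_nhds.symm) ?_
    rw [h2]
    change _ = fderiv ℝ (chartMap e e (f : M ≃ₜ M)) (ζ 0).1 (ζ 0).2
    rw [heq.fderiv_eq, ContinuousLinearMap.fderiv]
  have hbase : ∀ s ∈ Ioo (-τ) τ, e.symm (ζ' s).1 = (f : M ≃ₜ M) (e.symm (ζ s).1) := fun s hs ↦
    congrArg Bundle.TotalSpace.proj (IsChartGeodesicOn.eq_tangentMap he he f hτ hζ hζ' hinit s hs)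
  have hcont : ∀ s ∈ Ioo (-τ) τ, ContinuousAt (fun r ↦ A (ζ r).1) s := fun s hs ↦
    A.continuous.continuousAt.comp (hζ s hs).2.continuousAt.fst
  have hcont' : ∀ s ∈ Ioo (-τ) τ, ContinuousAt (fun r ↦ (ζ' r).1) s := fun s hs ↦
    (hζ' s hs).2.continuousAt.fst
  -- Points of `M` already correspond at all times, but `A (ζ s).1` might leave the chart target. On
  -- `T` it is inside, hence also at nearby times, where `e.symm` is injective; closedness needs
  -- only continuity.
  let T : Set ℝ := {s | s ∈ Ioo (-τ) τ ∧ (ζ' s).1 = A (ζ s).1}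
  have hopen : IsOpen T := by
    refine isOpen_iff_mem_nhds.2 fun s hs ↦ ?_
    have hAs : A (ζ s).1 ∈ e.target := hs.2 ▸ (hζ' s hs.1).1
    filter_upwards [isOpen_Ioo.mem_nhds hs.1,
      (hcont s hs.1).preimage_mem_nhds (e.open_target.mem_nhds hAs)] with r hr hAr
    refine ⟨hr, e.symm.injOn (hζ' r hr).1 hAr ?_⟩
    rw [hbase r hr, hA _ (hζ r hr).1 hAr]
  refine (isPreconnected_Ioo.subset_of_closure_inter_subset hopen ⟨0, h0, h0, h1⟩ ?_ ht).2
  rintro s ⟨hsc, hs⟩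
  rw [mem_closure_iff_frequently] at hsc
  exact ⟨hs, tendsto_nhds_unique_of_frequently_eq (hcont' s hs) (hcont s hs)
    (hsc.mono fun r hr ↦ hr.2)⟩

/-- The tangent space, in a chart, of a set which is linear in this chart. -/
theorem mem_tangentSubspace_iff [FiniteDimensional ℝ E]
    (he : e ∈ IsManifold.maximalAtlas 𝓘(ℝ, E) ∞ M) {S : Set M}
    {F : Submodule ℝ E} (hS : ∀ q ∈ e.source, q ∈ S ↔ e q ∈ F) {q : M} (hq : q ∈ e.source)
    (hqS : q ∈ S) {v : TangentSpace 𝓘(ℝ, E) q} {y : E} (hy : chartVector e (e q, y) = ⟨q, v⟩) :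
    v ∈ tangentSubspace E S q ↔ y ∈ F := by
  have hcoord : ∀ (w : TangentSpace 𝓘(ℝ, E) q) (a : E), chartVector e (e q, a) = ⟨q, w⟩ →
      mfderiv 𝓘(ℝ, E) 𝓘(ℝ, E) e q w = a := by
    intro w a h
    have h1 := chartCoord_chartVector he (q := (e q, a)) (e.map_source hq)
    rw [h] at h1
    exact congrArg Prod.snd h1
  refine ⟨fun hv ↦ ?_, fun hyF ↦ Submodule.subset_span ?_⟩
  · let D : E →L[ℝ] E := mfderiv 𝓘(ℝ, E) 𝓘(ℝ, E) e q
    have hle : tangentSubspace E S q ≤ F.comap (D : E →ₗ[ℝ] E) := by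
      refine Submodule.span_le.2 ?_
      rintro w ⟨γ, hγ, hγS, hγw⟩
      have h0 : γ 0 = q := congrArg Bundle.TotalSpace.proj hγw
      subst h0
      have hw : mfderiv 𝓘(ℝ, ℝ) 𝓘(ℝ, E) γ 0 (1 : ℝ) = w := by
        rw [tangentMap] at hγw
        exact eq_of_heq (Bundle.TotalSpace.mk.inj hγw).2
      have hcomp : MDifferentiableAt 𝓘(ℝ, ℝ) 𝓘(ℝ, E) (e ∘ γ) 0 :=
        (mdifferentiableAt_chart he hq).comp _ (hγ.mdifferentiableAt (by simp))
      have h1 : mfderiv 𝓘(ℝ, ℝ) 𝓘(ℝ, E) (e ∘ γ) 0 = (mfderiv 𝓘(ℝ, E) 𝓘(ℝ, E) e (γ 0)).comp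
          (mfderiv 𝓘(ℝ, ℝ) 𝓘(ℝ, E) γ 0) :=
        mfderiv_comp 0 (mdifferentiableAt_chart he hq) (hγ.mdifferentiableAt (by simp))
      have h2 : HasDerivAt (e ∘ γ) (mfderiv 𝓘(ℝ, E) 𝓘(ℝ, E) e (γ 0) w) 0 := by
        have h3 := hcomp.differentiableAt.hasFDerivAt.hasDerivAt
        rw [← mfderiv_eq_fderiv, h1] at h3
        rw [← hw]
        exact h3
      have hmem : ∀ᶠ t in 𝓝 (0 : ℝ), e (γ t) ∈ F := by
        filter_upwards [hγS, hγ.continuousAt.preimage_mem_nhds (e.open_source.mem_nhds hq)]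
          with t h3 h4 using (hS _ h4).1 h3
      -- A velocity is a limit of difference quotients, which lie in the closed subspace `F`.
      refine F.closed_of_finiteDimensional.mem_of_tendsto (hasDerivAt_iff_tendsto_slope.1 h2)
        ((hmem.filter_mono nhdsWithin_le_nhds).mono fun t ht ↦ ?_)
      exact F.smul_mem _ (F.sub_mem ht ((hS _ hq).1 hqS))
    have h1 := hle hv
    change mfderiv 𝓘(ℝ, E) 𝓘(ℝ, E) e q v ∈ F at h1
    rwa [hcoord v y hy] at h1
  · let c : ℝ → E := fun t ↦ e q + t • y
    have hc : ContDiff ℝ ∞ c := contDiff_const.add (contDiff_id.smul contDiff_const)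
    have hc0 : c 0 = e q := by simp [c]
    have hcd : HasDerivAt c y 0 := by
      have h1 := ((hasDerivAt_id (0 : ℝ)).smul_const y).const_add (e q)
      rwa [one_smul] at h1
    have htgt : c 0 ∈ e.target := hc0 ▸ e.map_source hq
    refine ⟨e.symm ∘ c, (contMDiffAt_symm_of_mem_maximalAtlas he htgt).comp 0
      hc.contMDiff.contMDiffAt, ?_, ?_⟩
    · filter_upwards [hc.continuous.continuousAt.preimage_mem_nhds
        (e.open_target.mem_nhds htgt)] with t ht
      refine (hS _ (e.map_target ht)).2 ?_
      rw [e.right_inv ht]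
      exact F.add_mem ((hS q hq).1 hqS) (F.smul_mem _ hyF)
    · rw [tangentMap_comp_at _ (mdifferentiableAt_chart_symm he htgt)
        (hc.contMDiff.mdifferentiable (by simp) _), ← hy, chartVector]
      congr 1
      have h1 : mfderiv 𝓘(ℝ, ℝ) 𝓘(ℝ, E) c 0 (1 : ℝ) = y := by
        rw [mfderiv_eq_fderiv]
        exact hcd.deriv
      rw [tangentMap, h1, hc0]

/-- If the isotropy group of `p` is compact in a homogeneous manifold, then so are all the isotropy
groups. -/
theorem IsHomogeneous.isCompact_isotropyGroup (hg : g.IsHomogeneous) {x p : M}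
    (hx : IsCompact (g.isotropyGroup x : Set g.isometryGroup)) :
    IsCompact (g.isotropyGroup p : Set g.isometryGroup) := by
  obtain ⟨h, hh⟩ := hg x p
  -- Conjugation by an isometry carrying `x` to `p` identifies the two isotropy groups. It is
  -- continuous as a precomposition followed by a postcomposition.
  have hcont : Continuous fun k : g.isometryGroup ↦ h * k * h⁻¹ := by
    refine continuous_induced_rng.2 ?_
    have h1 : Continuous fun k : g.isometryGroup ↦ ((k : M ≃ₜ M) : C(M, M)) :=
      continuous_induced_dom
    exact (ContinuousMap.continuous_precomp
      (((h⁻¹ : g.isometryGroup) : M ≃ₜ M) : C(M, M))).comp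
      ((ContinuousMap.continuous_postcomp ((h : M ≃ₜ M) : C(M, M))).comp h1)
  have hinv : ∀ y, ((h⁻¹ : g.isometryGroup) : M ≃ₜ M) ((h : M ≃ₜ M) y) = y :=
    fun y ↦ (h : M ≃ₜ M).symm_apply_apply y
  convert hx.image hcont using 1
  ext k
  refine ⟨fun hk ↦ ⟨h⁻¹ * k * h, ?_, by group⟩, ?_⟩
  · change ((h⁻¹ : g.isometryGroup) : M ≃ₜ M) ((k : M ≃ₜ M) ((h : M ≃ₜ M) x)) = x
    rw [hh, show (k : M ≃ₜ M) p = p from hk, ← hh, hinv]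
  · rintro ⟨k, hk, rfl⟩
    change (h : M ≃ₜ M) ((k : M ≃ₜ M) (((h⁻¹ : g.isometryGroup) : M ≃ₜ M) p)) = p
    rw [← hh, hinv, show (k : M ≃ₜ M) x = x from hk]

variable [FiniteDimensional ℝ E]

theorem exists_eq_mk_of_proj_eq {ξ : TangentBundle 𝓘(ℝ, E) M} {q : M} (h : ξ.1 = q) :
    ∃ η : TangentSpace 𝓘(ℝ, E) q, ξ = ⟨q, η⟩ := by
  subst h
  exact ⟨ξ.2, rfl⟩

theorem chartVector_chartCoord_snd (he : e ∈ IsManifold.maximalAtlas 𝓘(ℝ, E) ∞ M) {q : M}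
    (hq : q ∈ e.source) (w : TangentSpace 𝓘(ℝ, E) q) :
    chartVector e (e q, (chartCoord e (⟨q, w⟩ : TangentBundle 𝓘(ℝ, E) M)).2) = ⟨q, w⟩ :=
  chartVector_chartCoord (ξ := ⟨q, w⟩) he hq

/-- The coefficients of a Lorentzian metric in a chart form a Lorentzian form. -/
theorem exists_timelike_chartMetric (he : e ∈ IsManifold.maximalAtlas 𝓘(ℝ, E) ∞ M) {x : M}
    (hx : x ∈ e.source) : ∃ z : E, g.chartMetric e (e x) z z < 0 ∧
      ∀ w, g.chartMetric e (e x) z w = 0 → w ≠ 0 → 0 < g.chartMetric e (e x) w w := by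
  obtain ⟨ζ, hζ, hpos⟩ := g.signature x
  have h1 := chartVector_chartCoord_snd he hx ζ
  refine ⟨_, by rwa [g.chartMetric_eq_inner h1 h1], fun w hw hw0 ↦ ?_⟩
  obtain ⟨θ, hθ⟩ := exists_eq_mk_of_proj_eq (ξ := chartVector e (e x, w)) (e.left_inv hx)
  rw [g.chartMetric_eq_inner h1 hθ] at hw
  rw [g.chartMetric_eq_inner hθ hθ]
  refine hpos θ hw ?_
  rintro rfl
  have h2 := chartCoord_chartVector he (q := (e x, w)) (e.map_source hx)
  rw [hθ] at h2
  refine hw0 ((congrArg Prod.snd h2).symm.trans ?_)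
  exact map_zero (mfderiv 𝓘(ℝ, E) 𝓘(ℝ, E) e x)

/-! ### The lightlike totally geodesic hypersurface -/

/-- Let `A i` be the linear parts of isometries which are linear in the chart `e`. If the `A i`
map vectors converging to elements of the hyperplane `F` to convergent vectors, and only those, and
contract some direction, then `F` defines a lightlike totally geodesic hypersurface. -/
theorem exists_hypersurface_of_linear_isometries [T2Space M] {ι : Type*} {l : Ultrafilter ι}
    (he : e ∈ IsManifold.maximalAtlas 𝓘(ℝ, E) ∞ M) {R : ℝ} (hR : 0 < R)
    (htgt : e.target = Metric.ball 0 R) {f : ι → g.isometryGroup} {A : ι → E →L[ℝ] E}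
    (hA : ∀ i, ∀ v ∈ e.target, A i v ∈ e.target →
      (f i : M ≃ₜ M) (e.symm v) = e.symm (A i v))
    {F : Submodule ℝ E} (hF : Module.finrank ℝ F + 1 = Module.finrank ℝ E)
    (hmem : ∀ (c c' : E) (u : ι → E), Tendsto u l (𝓝 c) →
      Tendsto (fun i ↦ A i (u i)) l (𝓝 c') → c ∈ F) {C : ℝ} (hC : 0 ≤ C)
    (hlift : ∀ v ∈ F, ∃ (v' : E) (u : ι → E), ‖v'‖ ≤ C * ‖v‖ ∧ Tendsto u l (𝓝 v) ∧
      Tendsto (fun i ↦ A i (u i)) l (𝓝 v'))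
    {y : E} (hy0 : y ≠ 0) {u : ι → E} (hu : Tendsto u l (𝓝 y))
    (hAu : Tendsto (fun i ↦ A i (u i)) l (𝓝 0)) {x : M} (hx : x ∈ e.source) (hex : e x = 0) :
    ∃ S : Set M, x ∈ S ∧ IsHypersurface E S ∧ g.IsTotallyGeodesic S ∧ g.IsLightlike S := by
  -- With this radius `C * r < R` and `r ≤ R`, so the limit positions of norm at most `C * ‖v‖` stay
  -- in the domain of the chart.
  let r : ℝ := R / (C + 1)
  have hr : 0 < r := by positivity
  have hrR : r ≤ R := div_le_self hR.le (by linarith)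
  have hCr : C * r < R := by
    rw [← mul_div_assoc, div_lt_iff₀ (by linarith)]
    nlinarith
  obtain ⟨N, hN, hcoe, hcoe', hNt, hNs⟩ := exists_chart_restriction he
    (Metric.isOpen_ball (x := (0 : E)) (ε := r)) (by rw [htgt]; exact Metric.ball_subset_ball hrR)
  have hsub : N.source ⊆ e.source := by rw [hNs]; exact inter_subset_left
  let S : Set M := {q | q ∈ N.source ∧ e q ∈ F}
  have hS : ∀ q ∈ N.source, q ∈ S ↔ N q ∈ F := fun q hq ↦ by
    rw [hcoe]
    exact ⟨fun h ↦ h.2, fun h ↦ ⟨hq, h⟩⟩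
  have hxS : x ∈ S := by
    refine ⟨?_, by rw [hex]; exact F.zero_mem⟩
    rw [hNs]
    exact ⟨hx, by rw [mem_preimage, hex]; exact Metric.mem_ball_self hr⟩
  have hball : ∀ q ∈ N.source, ‖e q‖ < r := fun q hq ↦ by
    rw [hNs] at hq
    exact mem_ball_zero_iff.1 hq.2
  have hvec : chartVector N = chartVector e := by
    funext a
    rw [chartVector, chartVector, hcoe']
  have htan : ∀ q ∈ S, ∀ (v : TangentSpace 𝓘(ℝ, E) q) (a : E), chartVector e (e q, a) = ⟨q, v⟩ →
      (v ∈ tangentSubspace E S q ↔ a ∈ F) := fun q hq v a h ↦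
    mem_tangentSubspace_iff hN hS hq.1 hq (by rwa [hvec, hcoe])
  have hyF : y ∈ F := hmem _ _ _ hu hAu
  have hlift' : ∀ q ∈ S, ∃ (v' : E) (b : ι → E), v' ∈ e.target ∧ Tendsto b l (𝓝 (e q)) ∧
      Tendsto (fun i ↦ A i (b i)) l (𝓝 v') := by
    intro q hq
    obtain ⟨v', b, hv', hb, hAb⟩ := hlift _ hq.2
    refine ⟨v', b, ?_, hb, hAb⟩
    rw [htgt, mem_ball_zero_iff]
    exact (hv'.trans (by gcongr; exact (hball q hq.1).le)).trans_lt hCr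
  refine ⟨S, hxS, fun q hq ↦ ⟨N, hN, hq.1, F, hF, hS⟩, ?_, ?_⟩
  · intro γ ε hε hγ hγ0 hγ'
    have h0ε : (0 : ℝ) ∈ Ioo (-ε) ε := ⟨by linarith, hε⟩
    have hq : γ 0 ∈ e.source := hsub hγ0.1
    have hγs : ContMDiffAt 𝓘(ℝ, ℝ) 𝓘(ℝ, E) ∞ γ 0 :=
      (hγ.1 0 h0ε).contMDiffAt (isOpen_Ioo.mem_nhds h0ε)
    have hζ := IsGeodesicOn.isChartGeodesicOn he isOpen_Ioo hγ
    set ζ : ℝ → E × E := fun t ↦ (e (γ t), deriv (e ∘ γ) t)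
    have hw : deriv (e ∘ γ) 0 ∈ F := by
      refine (htan _ hγ0 _ _ ?_).1 hγ'
      rw [← chartVector_chartCoord_snd he hq]
      congr 2
      have h1 : mfderiv 𝓘(ℝ, ℝ) 𝓘(ℝ, E) (e ∘ γ) 0 = (mfderiv 𝓘(ℝ, E) 𝓘(ℝ, E) e (γ 0)).comp
          (mfderiv 𝓘(ℝ, ℝ) 𝓘(ℝ, E) γ 0) :=
        mfderiv_comp 0 (mdifferentiableAt_chart he hq) (hγs.mdifferentiableAt (by simp))
      rw [mfderiv_eq_fderiv] at h1
      exact congrArg (fun L : ℝ →L[ℝ] E ↦ L 1) h1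
    obtain ⟨v', b, hv', hb, hAb⟩ := hlift' _ hγ0
    obtain ⟨w', d, -, hd, hAd⟩ := hlift _ hw
    obtain ⟨α, τ, hτ, hα, hαc⟩ := g.exists_local_geodesic_flow he (ζ 0) (e.map_source hq)
    obtain ⟨α', τ', hτ', hα', hαc'⟩ := g.exists_local_geodesic_flow he (v', w') hv'
    have hbd : Tendsto (fun i ↦ (b i, d i)) l (𝓝 (ζ 0)) := hb.prodMk_nhds hd
    have hAbd : Tendsto (fun i ↦ (A i (b i), A i (d i))) l (𝓝 (v', w')) := hAb.prodMk_nhds hAd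
    have hσ : 0 < min τ τ' := lt_min hτ hτ'
    have hsub1 : Ioo (-min τ τ') (min τ τ') ⊆ Ioo (-τ) τ :=
      Ioo_subset_Ioo (neg_le_neg (min_le_left _ _)) (min_le_left _ _)
    have hsub2 : Ioo (-min τ τ') (min τ τ') ⊆ Ioo (-τ') τ' :=
      Ioo_subset_Ioo (neg_le_neg (min_le_right _ _)) (min_le_right _ _)
    -- `A i` carries the geodesic with data `(b i, d i)` to the one with data `(A i (b i), A i (d
    -- i))`. Both families converge by continuous dependence, so the position at time `t` is a limit
    -- of points with convergent images, and `hmem` puts it in `F`.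
    have hαF : ∀ t ∈ Ioo (-min τ τ') (min τ τ'), (α (ζ 0) t).1 ∈ F := by
      intro t ht
      refine hmem _ (α' (v', w') t).1 (fun i ↦ (α (b i, d i) t).1)
        ((continuous_fst.tendsto _).comp ((hαc t (hsub1 ht)).tendsto.comp hbd)) ?_
      refine ((continuous_fst.tendsto _).comp ((hαc' t (hsub2 ht)).tendsto.comp hAbd)).congr' ?_
      filter_upwards [hbd.eventually hα, hAbd.eventually hα'] with i h1 h2
      exact IsChartGeodesicOn.map_linear he (hA i) hσ (fun s hs ↦ h1.2 s (hsub1 hs))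
        (fun s hs ↦ h2.2 s (hsub2 hs)) (by rw [h1.1, h2.1]) (by rw [h1.1, h2.1]) ht
    have hsrc : ∀ᶠ t in 𝓝 (0 : ℝ), γ t ∈ N.source :=
      hγs.continuousAt.preimage_mem_nhds (N.open_source.mem_nhds hγ0.1)
    have heq : α (ζ 0) =ᶠ[𝓝 0] ζ := by
      refine IsChartGeodesicOn.eventually_eq (g := g) he ?_ ?_ hα.self_of_nhds.1
      · filter_upwards [Ioo_mem_nhds (neg_lt_zero.2 hτ) hτ] with s hs
        exact fun t ht ↦ hα.self_of_nhds.2 t (by rwa [mem_singleton_iff.1 ht])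
      · filter_upwards [isOpen_Ioo.mem_nhds h0ε, hsrc] with s hs hs'
        exact fun t ht ↦ hζ t (by rw [mem_singleton_iff.1 ht]; exact ⟨hs, hsub hs'⟩)
    filter_upwards [heq, hsrc, Ioo_mem_nhds (neg_lt_zero.2 hσ) hσ] with t h1 h2 h3
    have h4 := hαF t h3
    rw [h1] at h4
    exact ⟨h2, h4⟩
  · intro q hq
    have hqe := hsub hq.1
    obtain ⟨η, hη⟩ := exists_eq_mk_of_proj_eq (ξ := chartVector e (e q, y)) (e.left_inv hqe)
    -- The null direction at every point of `S` is the constant coordinate vector `y`.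
    refine ⟨η, (htan q hq η y hη).2 hyF, ?_, fun w hw ↦ ?_⟩
    · rintro rfl
      have h2 := chartCoord_chartVector he (q := (e q, y)) (e.map_source hqe)
      rw [hη] at h2
      refine hy0 ((congrArg Prod.snd h2).symm.trans ?_)
      exact map_zero (mfderiv 𝓘(ℝ, E) 𝓘(ℝ, E) e q)
    · have hθ := chartVector_chartCoord_snd he hqe w
      set θ := (chartCoord e (⟨q, w⟩ : TangentBundle 𝓘(ℝ, E) M)).2
      rw [← g.chartMetric_eq_inner hη hθ]
      obtain ⟨v', b, hv', hb, hAb⟩ := hlift' q hq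
      obtain ⟨θ', d, -, hd, hAd⟩ := hlift _ ((htan q hq w θ hθ).1 hw)
      have hG := g.isMetricOn_chartMetric he
      have hGc : ∀ v ∈ e.target, ContinuousAt (g.chartMetric e) v := fun v hv ↦
        hG.contDiffOn.continuousOn.continuousAt (hG.isOpen.mem_nhds hv)
      -- The same numbers are computed at `b i` and at `A i (b i)`. The first expression tends to
      -- the pairing of `y` and `θ`, the second to zero since `A i (u i) → 0`.
      have h1 := tendsto_clm_apply (tendsto_clm_apply
        ((hGc _ (e.map_source hqe)).tendsto.comp hb) hu) hd
      have h2 := tendsto_clm_apply (tendsto_clm_apply ((hGc v' hv').tendsto.comp hAb) hAu) hAd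
      rw [map_zero] at h2
      refine tendsto_nhds_unique h1 (h2.congr' ?_)
      filter_upwards [hb.eventually (e.open_target.mem_nhds (e.map_source hqe)),
        hAb.eventually (e.open_target.mem_nhds hv')] with i h3 h4
      exact chartMetric_isotropyDeriv he (hA i) h3 h4 _ _

end LorentzianMetric

end

/-! ### The main theorem -/

theorem mainTheorem9 {E : Type*} [NormedAddCommGroup E] [NormedSpace ℝ E] [FiniteDimensional ℝ E]
    {M : Type*} [TopologicalSpace M] [T2Space M] [SecondCountableTopology M] [ConnectedSpace M]
    [ChartedSpace E M] [IsManifold 𝓘(ℝ, E) ∞ M]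
    (g : LorentzianMetric E M) (hhom : g.IsHomogeneous)
    (p : M) (hiso : ¬ IsCompact (g.isotropyGroup p : Set g.isometryGroup)) :
    ∀ x : M, ∃ S : Set M, x ∈ S ∧ IsHypersurface E S ∧
      g.IsTotallyGeodesic S ∧ g.IsLightlike S := by
  intro x
  obtain ⟨N, hN, hxN, hNx, R, hR, htgt, hlin⟩ := g.exists_normal_chart x
  -- A bound on the derivatives at `x` would make the isotropy group of `x` compact, and with it
  -- that of `p`.
  have hunbounded : ∀ n : ℕ, ∃ f ∈ g.isotropyGroup x,
      (n : ℝ) < ‖LorentzianMetric.isotropyDeriv N x f‖ := by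
    intro n
    by_contra! h
    exact hiso (hhom.isCompact_isotropyGroup
      (LorentzianMetric.isCompact_isotropyGroup hN hxN h))
  choose f hf hfn using hunbounded
  let A : ℕ → E →L[ℝ] E := fun n ↦ LorentzianMetric.isotropyDeriv N x (f n)
  have hA : ∀ n, ∀ v ∈ N.target, A n v ∈ N.target →
      (f n : M ≃ₜ M) (N.symm v) = N.symm (A n v) := by
    intro n v hv hAv
    rw [htgt, mem_ball_zero_iff] at hv hAv
    exact hlin (f n) (hf n) v hv hAv
  have h0 : (0 : E) ∈ N.target := hNx ▸ N.map_source hxN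
  have hpres : ∀ n v w, g.chartMetric N (N x) (A n v) (A n w) = g.chartMetric N (N x) v w := by
    intro n v w
    have h1 := LorentzianMetric.chartMetric_isotropyDeriv hN (hA n) h0
      (by rwa [map_zero]) v w
    rwa [map_zero, ← hNx] at h1
  -- A nonprincipal ultrafilter refines `atTop`, so divergence persists, while every bounded family
  -- acquires a limit.
  have hn : Tendsto (fun n ↦ ‖A n‖) (hyperfilter ℕ) atTop :=
    (tendsto_atTop_mono (fun n ↦ (hfn n).le) tendsto_natCast_atTop_atTop).mono_left
      Nat.hyperfilter_le_atTop
  obtain ⟨z, hz, hpos⟩ := LorentzianMetric.exists_timelike_chartMetric (g := g) hN hxN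
  obtain ⟨y, u, hy0, hu, hAu⟩ := exists_contracted_direction
    ((g.isMetricOn_chartMetric hN).symm _ (N.map_source hxN)) hz hpos hpres hn
  obtain ⟨F, hF, hmem, C, hC, hlift⟩ := exists_hyperplane_of_divergent hpos hpres hn
  exact LorentzianMetric.exists_hypersurface_of_linear_isometries hN hR htgt hA hF hmem hC hlift
    hy0 hu hAu hxN hNx
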